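/- Let $m\ge 2$ and let $F\in \mathrm{GL}_m(\mathbb C)$ satisfy $F\bar F=\pm 1$. Let $\mathbb C[O_F^+]$ be the universal unital $*$-algebra with generators $u_{ij}$, $1\le i,j\le m$, subject to the relations that $U=(u_{ij})$ is unitary and $U=F\bar UF^{-1}$, where $\bar U=(u_{ij}^*)$; it is a Hopf $*$-algebra with $\Delta(u_{ij})=\sum_k u_{ik}\otimes u_{kj}$, $\varepsilon(u_{ij})=\delta_{ij}$, $S(u_{ij})=u_{ji}^*$. Let $T$ be a compact abelian group, identify $\mathbb C[T]$ with the group algebra $\mathbb C\hat T$ of the dual group, let $Z=(z_{ij})\in \mathrm{Mat}_m(\mathbb C[T])$ be a unitary corepresentation matrix (that is, $Z$ is unitary, $\Delta(z_{ij})=\sum_k z_{ik}\otimes z_{kj}$ and $\varepsilon(z_{ij})=\delta_{ij}$) with $F\bar ZF^{-1}=Z$, and let $\pi\colon\mathbb C[O_F^+]\to\mathbb C[T]$ be the Hopf $*$-algebra map with $\pi(u_{ij})=z_{ij}$. Let $\beta\colon\hat T\times\hat T\to\mathbb T$ be a bicharacter, extended bilinearly to $\mathbb C[T]\times\mathbb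 C[T]$. The transmutation $\mathbb C[O_F^+]_\beta$ is the coalgebra $H=\mathbb C[O_F^+]$ with the coaction $x\mapsto x_{(2)}\otimes\pi(S(x_{(1)})x_{(3)})$ of $\mathbb C[T]$ and with $$x\cdot_\beta y=\beta(a^{-1}b,c^{-1})xy,\qquad x^{*_\beta}=\beta(a^{-1}b,a^{-1})x^*,\qquad S_\beta(x)=\beta(a^{-1}b,b)S(x)$$ for $x\in H_{a,b}$, $y\in H_{c,d}$, where $H_{a,b}=\{x\in H : (\pi\otimes\iota)\Delta(x)=a\otimes x,\ (\iota\otimes\pi)\Delta(x)=x\otimes b\}$ for $a,b\in\hat T$, so that $H=\bigoplus_{a,b}H_{a,b}$. For a matrix $V=(v_{ij})\in\mathrm{Mat}_m(B)$ over a unital $*$-algebra $B$ put $$\bar V_Z=(\bar v^Z_{ij})_{i,j},\qquad \bar v^Z_{ij}=\sum_{s,l,t}\beta(z_{tj}^*z_{sl},z_{il}^*)\,v_{st}^*.$$ A braided compact matrix quantum group over $(T,Z,\beta)$ with fundamental unitary $U$ is a Hopf $*$-algebra $A$ in the category of right $\mathbb C[T]$-comodules with the braiding $x\otimes y\mapsto\beta(x^{(2)},y^{(2)})\,y^{(1)}\otimes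 x^{(1)}$ that is generated as a $*$-algebra by the entries of a matrix $U\in\mathrm{Mat}_m(A)$ such that the pair $(Z,U)$ defines a unitary $A$-comodule and the pair $(\bar Z,\bar U_Z)$ defines a unitarizable $A$-comodule. Here a pair $(Z',U')$ of corepresentation matrices of $\mathbb C[T]$ and of the coalgebra $A$ defines an $A$-comodule if $e_j\mapsto\sum_i e_i\otimes u'_{ij}$ is a morphism of $\mathbb C[T]$-comodules $\mathbb C^m\to\mathbb C^m\otimes A$, where $\mathbb C^m$ carries the coaction $e_j\mapsto\sum_i e_i\otimes z'_{ij}$; this comodule is unitary if the matrix $\big(\sum_k z'_{ik}\otimes u'_{kj}\big)_{i,j}$ over the bosonization $\mathbb C[T]\# A=\mathbb C[T]\otimes_\beta A$ is unitary, and unitarizable if it becomes unitary after a change of basis of $\mathbb C^m$. Then: 1. $\mathbb C[O_F^+]_\beta$ is a braided compact matrix quantum group over $(T,Z,\beta)$ with fundamental unitary $U=(u_{ij})_{i,j}$. 2. As a $*$-algebra, $\mathbb C[O_F^+]_\beta$ is the universal unital $*$-algebra with generators $u_{ij}$ satisfying the relations: $U=(u_{ij})_{i,j}$ is unitary and $U=F\bar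 U_ZF^{-1}$. That is, these relations hold in $\mathbb C[O_F^+]_\beta$, and for every unital $*$-algebra $B$ and every unitary $V\in\mathrm{Mat}_m(B)$ with $V=F\bar V_ZF^{-1}$ there is a unique unital $*$-homomorphism $f\colon\mathbb C[O_F^+]_\beta\to B$ with $f(u_{ij})=v_{ij}$ for all $i,j$. -/

import Mathlib

noncomputable section

open scoped TensorProduct
open Coalgebra HopfAlgebra

/-! ### Universal unital star-algebras -/

/-- Auxiliary ring homomorphism `FreeAlgebra ℂ X → Bᵐᵒᵖ` that is conjugate-linear and sends the
generator `x` to `f x`. -/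
def conjLift {X B : Type*} [Ring B] [Algebra ℂ B] (f : X → B) : FreeAlgebra ℂ X →+* Bᵐᵒᵖ :=
  letI : Algebra ℂ Bᵐᵒᵖ := ((algebraMap ℂ Bᵐᵒᵖ).comp (starRingEnd ℂ)).toAlgebra'
    (fun c x => Algebra.commutes (starRingEnd ℂ c) x)
  (FreeAlgebra.lift ℂ (fun x => MulOpposite.op (f x))).toRingHom

theorem conjLift_ι {X B : Type*} [Ring B] [Algebra ℂ B] (f : X → B) (x : X) :
    conjLift f (FreeAlgebra.ι ℂ x) = MulOpposite.op (f x) := by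
  let _ : Algebra ℂ Bᵐᵒᵖ := ((algebraMap ℂ Bᵐᵒᵖ).comp (starRingEnd ℂ)).toAlgebra'
    (fun c x => Algebra.commutes (starRingEnd ℂ c) x)
  exact FreeAlgebra.lift_ι_apply (R := ℂ) (fun x => MulOpposite.op (f x)) x

theorem conjLift_algebraMap {X B : Type*} [Ring B] [Algebra ℂ B] (f : X → B) (c : ℂ) :
    conjLift f (algebraMap ℂ _ c) = MulOpposite.op (algebraMap ℂ B (starRingEnd ℂ c)) := by
  let _ : Algebra ℂ Bᵐᵒᵖ := ((algebraMap ℂ Bᵐᵒᵖ).comp (starRingEnd ℂ)).toAlgebra'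
    (fun c x => Algebra.commutes (starRingEnd ℂ c) x)
  exact (FreeAlgebra.lift ℂ (fun x => MulOpposite.op (f x))).commutes c

/-- The free unital `*`-algebra over `ℂ` on a set `X`: the free algebra on the letters `x` (left
summand) and `x*` (right summand). -/
def FreeStarAlg (X : Type*) : Type _ := FreeAlgebra ℂ (X ⊕ X)

namespace FreeStarAlg

variable {X : Type*}

instance : Ring (FreeStarAlg X) := inferInstanceAs (Ring (FreeAlgebra ℂ (X ⊕ X)))
instance : Algebra ℂ (FreeStarAlg X) := inferInstanceAs (Algebra ℂ (FreeAlgebra ℂ (X ⊕ X)))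

/-- The letters `x` and `x*`. -/
def letter (x : X ⊕ X) : FreeStarAlg X := FreeAlgebra.ι ℂ x

/-- The generator `x`. -/
def gen (x : X) : FreeStarAlg X := letter (Sum.inl x)

/-- The homomorphism of algebras with prescribed values on the letters. -/
def lift {B : Type*} [Ring B] [Algebra ℂ B] (f : X ⊕ X → B) : FreeStarAlg X →ₐ[ℂ] B :=
  FreeAlgebra.lift ℂ f

theorem lift_letter {B : Type*} [Ring B] [Algebra ℂ B] (f : X ⊕ X → B) (x : X ⊕ X) :
    lift f (letter x) = f x :=
  FreeAlgebra.lift_ι_apply f x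

theorem algHom_ext {B : Type*} [Ring B] [Algebra ℂ B] {φ ψ : FreeStarAlg X →ₐ[ℂ] B}
    (h : ∀ x, φ (letter x) = ψ (letter x)) : φ = ψ :=
  FreeAlgebra.hom_ext (funext h)

theorem induction {P : FreeStarAlg X → Prop} (h1 : ∀ c : ℂ, P (algebraMap ℂ _ c))
    (h2 : ∀ x, P (letter x)) (h3 : ∀ a b, P a → P b → P (a * b))
    (h4 : ∀ a b, P a → P b → P (a + b)) (a : FreeStarAlg X) : P a :=
  FreeAlgebra.induction (R := ℂ) (X := X ⊕ X) (motive := P) h1 h2 h3 h4 a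

/-- The conjugate-linear anti-multiplicative map exchanging `x` and `x*`. -/
def starHom : FreeStarAlg X →+* (FreeStarAlg X)ᵐᵒᵖ :=
  conjLift (fun x : X ⊕ X => letter x.swap)

theorem starHom_letter (x : X ⊕ X) : starHom (letter x) = MulOpposite.op (letter x.swap) :=
  conjLift_ι _ x

theorem starHom_algebraMap (c : ℂ) : starHom (algebraMap ℂ (FreeStarAlg X) c) =
    MulOpposite.op (algebraMap ℂ (FreeStarAlg X) (starRingEnd ℂ c)) :=
  conjLift_algebraMap _ c

theorem starHom_starHom (a : FreeStarAlg X) : (starHom (starHom a).unop).unop = a := by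
  induction a using FreeStarAlg.induction with
  | h1 c => simp [starHom_algebraMap]
  | h2 x => simp [starHom_letter]
  | h3 a b ha hb => simp [ha, hb]
  | h4 a b ha hb => simp [ha, hb]

instance : StarRing (FreeStarAlg X) where
  star a := (starHom a).unop
  star_involutive := starHom_starHom
  star_mul a b := by rw [map_mul, MulOpposite.unop_mul]
  star_add a b := by rw [map_add, MulOpposite.unop_add]

theorem star_letter (x : X ⊕ X) : star (letter x) = letter x.swap :=
  congrArg MulOpposite.unop (starHom_letter x)

theorem star_algebraMap (c : ℂ) :
    star (algebraMap ℂ (FreeStarAlg X) c) = algebraMap ℂ (FreeStarAlg X) (starRingEnd ℂ c) :=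
  congrArg MulOpposite.unop (starHom_algebraMap c)

end FreeStarAlg

/-- The universal unital `*`-algebra generated by a set `X` subject to the relations `a = b` for all
`a, b` with `r a b`: the quotient of the free `*`-algebra by the `*`-ideal generated by the
differences `a - b`. -/
def UnivStarAlg {X : Type*} (r : FreeStarAlg X → FreeStarAlg X → Prop) : Type _ :=
  RingQuot (fun a b => r a b ∨ r (star a) (star b))

namespace UnivStarAlg

variable {X : Type*} (r : FreeStarAlg X → FreeStarAlg X → Prop)

instance : Ring (UnivStarAlg r) :=
  inferInstanceAs (Ring (RingQuot (fun a b => r a b ∨ r (star a) (star b))))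
instance : Algebra ℂ (UnivStarAlg r) :=
  inferInstanceAs (Algebra ℂ (RingQuot (fun a b => r a b ∨ r (star a) (star b))))

instance : StarRing (UnivStarAlg r) :=
  RingQuot.starRing (fun a b => r a b ∨ r (star a) (star b)) (fun a b h => by
    rw [star_star, star_star]; exact h.symm)

/-- The quotient map. -/
def mk : FreeStarAlg X →ₐ[ℂ] UnivStarAlg r :=
  RingQuot.mkAlgHom ℂ (fun a b => r a b ∨ r (star a) (star b))

theorem mk_surjective : Function.Surjective (mk r) := RingQuot.mkAlgHom_surjective ℂ _

theorem mk_star (a : FreeStarAlg X) : mk r (star a) = star (mk r a) := by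
  simp [mk, RingQuot.mkAlgHom, RingQuot.mkRingHom]
  rfl

theorem mk_eq {a b : FreeStarAlg X} (h : r a b) : mk r a = mk r b :=
  RingQuot.mkAlgHom_rel ℂ (Or.inl h)

instance : StarModule ℂ (UnivStarAlg r) where
  star_smul c x := by
    obtain ⟨a, rfl⟩ := mk_surjective r x
    have h : star (algebraMap ℂ (UnivStarAlg r) c) = algebraMap ℂ (UnivStarAlg r) (star c) := by
      rw [← (mk r).commutes, ← mk_star, FreeStarAlg.star_algebraMap, (mk r).commutes]
      rfl
    rw [Algebra.smul_def, Algebra.smul_def, star_mul, h]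
    exact (Algebra.commutes _ _).symm

/-- The generator `x`. -/
def gen (x : X) : UnivStarAlg r := mk r (FreeStarAlg.gen x)

/-- Extension of an assignment `x ↦ f x`, `x* ↦ g x` to a homomorphism of algebras. -/
def lift {B : Type*} [Ring B] [Algebra ℂ B] (f g : X → B)
    (h : ∀ a b, r a b ∨ r (star a) (star b) →
      FreeStarAlg.lift (Sum.elim f g) a = FreeStarAlg.lift (Sum.elim f g) b) :
    UnivStarAlg r →ₐ[ℂ] B :=
  RingQuot.liftAlgHom ℂ ⟨FreeStarAlg.lift (Sum.elim f g), fun {a b} => h a b⟩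

variable {r}

theorem lift_mk {B : Type*} [Ring B] [Algebra ℂ B] (f g : X → B)
    (h : ∀ a b, r a b ∨ r (star a) (star b) →
      FreeStarAlg.lift (Sum.elim f g) a = FreeStarAlg.lift (Sum.elim f g) b)
    (a : FreeStarAlg X) : lift r f g h (mk r a) = FreeStarAlg.lift (Sum.elim f g) a :=
  RingQuot.liftAlgHom_mkAlgHom_apply _ _ _ _

theorem algHom_ext {B : Type*} [Ring B] [Algebra ℂ B] {φ ψ : UnivStarAlg r →ₐ[ℂ] B}
    (h : ∀ x, φ (gen r x) = ψ (gen r x)) (h' : ∀ x, φ (star (gen r x)) = ψ (star (gen r x))) :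
    φ = ψ := by
  have key : φ.comp (mk r) = ψ.comp (mk r) := by
    refine FreeStarAlg.algHom_ext fun x => ?_
    rcases x with x | x
    · exact h x
    · have := h' x
      rwa [gen, ← mk_star, FreeStarAlg.gen, FreeStarAlg.star_letter] at this
  ext a
  obtain ⟨a, rfl⟩ := mk_surjective r a
  exact DFunLike.congr_fun key a

end UnivStarAlg

/-! ### Free orthogonal quantum groups -/

/-- The entrywise adjoint `Ū = (u_ij*)` of a matrix `U = (u_ij)`. -/
def conjMat {m : ℕ} {B : Type*} [Star B] (U : Matrix (Fin m) (Fin m) B) :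
    Matrix (Fin m) (Fin m) B :=
  U.map star

/-- A scalar matrix regarded as a matrix over a unital algebra. -/
def scalarMat {m : ℕ} (B : Type*) [Ring B] [Algebra ℂ B] (F : Matrix (Fin m) (Fin m) ℂ) :
    Matrix (Fin m) (Fin m) B :=
  F.map (algebraMap ℂ B)

/-- The matrix `F M F⁻¹` for an invertible scalar matrix `F`. -/
def conjugateBy {m : ℕ} {B : Type*} [Ring B] [Algebra ℂ B] (F : GL (Fin m) ℂ)
    (M : Matrix (Fin m) (Fin m) B) : Matrix (Fin m) (Fin m) B :=
  scalarMat B (F : Matrix (Fin m) (Fin m) ℂ) * M *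
    scalarMat B ((F⁻¹ : GL (Fin m) ℂ) : Matrix (Fin m) (Fin m) ℂ)

theorem scalarMat_mul {m : ℕ} (B : Type*) [Ring B] [Algebra ℂ B] (F G : Matrix (Fin m) (Fin m) ℂ) :
    scalarMat B F * scalarMat B G = scalarMat B (F * G) :=
  (Matrix.map_mul (f := algebraMap ℂ B)).symm

theorem scalarMat_one {m : ℕ} (B : Type*) [Ring B] [Algebra ℂ B] :
    scalarMat B (1 : Matrix (Fin m) (Fin m) ℂ) = 1 :=
  Matrix.map_one _ (map_zero _) (map_one _)

/-- The matrix `U` over a unital `*`-algebra is unitary. -/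
def IsUnitaryMat {m : ℕ} {B : Type*} [Ring B] [StarRing B] (U : Matrix (Fin m) (Fin m) B) : Prop :=
  U.conjTranspose * U = 1 ∧ U * U.conjTranspose = 1

/-- The entrywise complex conjugate of an invertible scalar matrix. -/
def conjGL {m : ℕ} (F : GL (Fin m) ℂ) : GL (Fin m) ℂ :=
  Matrix.GeneralLinearGroup.map (starRingEnd ℂ) F

namespace FreeOrth

variable {m : ℕ} (F : GL (Fin m) ℂ)

/-- The matrix of generators of the free `*`-algebra on letters `u_ij`. -/
def freeU (m : ℕ) : Matrix (Fin m) (Fin m) (FreeStarAlg (Fin m × Fin m)) :=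
  Matrix.of fun i j => FreeStarAlg.gen (i, j)

/-- The defining relations of `ℂ[O_F⁺]`: `U*U = 1`, `UU* = 1` and `U = F Ū F⁻¹`, entry by entry. -/
inductive Rel : FreeStarAlg (Fin m × Fin m) → FreeStarAlg (Fin m × Fin m) → Prop
  | left (i j : Fin m) :
      Rel (((freeU m).conjTranspose * freeU m) i j)
        ((1 : Matrix (Fin m) (Fin m) (FreeStarAlg (Fin m × Fin m))) i j)
  | right (i j : Fin m) :
      Rel ((freeU m * (freeU m).conjTranspose) i j)
        ((1 : Matrix (Fin m) (Fin m) (FreeStarAlg (Fin m × Fin m))) i j)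
  | orth (i j : Fin m) :
      Rel (freeU m i j) (conjugateBy F (conjMat (freeU m)) i j)

end FreeOrth

/-- The `*`-algebra `ℂ[O_F⁺]`: the universal unital `*`-algebra with generators `u_ij`,
`1 ≤ i, j ≤ m`, such that `U = (u_ij)` is unitary and `U = F Ū F⁻¹`. -/
def FreeOrth {m : ℕ} (F : GL (Fin m) ℂ) : Type := UnivStarAlg (FreeOrth.Rel F)

namespace FreeOrth

variable {m : ℕ} (F : GL (Fin m) ℂ)

instance : Ring (FreeOrth F) := inferInstanceAs (Ring (UnivStarAlg (Rel F)))
instance : Algebra ℂ (FreeOrth F) := inferInstanceAs (Algebra ℂ (UnivStarAlg (Rel F)))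
instance : StarRing (FreeOrth F) := inferInstanceAs (StarRing (UnivStarAlg (Rel F)))
instance : StarModule ℂ (FreeOrth F) := inferInstanceAs (StarModule ℂ (UnivStarAlg (Rel F)))

/-- The fundamental matrix `U = (u_ij)`. -/
def fund : Matrix (Fin m) (Fin m) (FreeOrth F) :=
  Matrix.of fun i j => UnivStarAlg.gen (Rel F) (i, j)

variable {F}

/-- A pair of matrices `(U, V)` satisfying the relations that hold for `(U, Ū)` in
`ℂ[O_F⁺]`. -/
structure IsPair {B : Type*} [Ring B] [Algebra ℂ B] (F : GL (Fin m) ℂ)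
    (U V : Matrix (Fin m) (Fin m) B) : Prop where
  left : V.transpose * U = 1
  right : U * V.transpose = 1
  orth : U = conjugateBy F V
  orth' : V = conjugateBy (conjGL F) U

section lift

variable {B : Type*} [Ring B] [Algebra ℂ B] {U V : Matrix (Fin m) (Fin m) B}

theorem lift_aux (h : IsPair F U V) (a b : FreeStarAlg (Fin m × Fin m))
    (hab : Rel F a b ∨ Rel F (star a) (star b)) :
    FreeStarAlg.lift (Sum.elim (fun p => U p.1 p.2) (fun p => V p.1 p.2)) a =
      FreeStarAlg.lift (Sum.elim (fun p => U p.1 p.2) (fun p => V p.1 p.2)) b := by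
  set L := FreeStarAlg.lift (Sum.elim (fun p : Fin m × Fin m => U p.1 p.2) (fun p => V p.1 p.2))
    with hL
  have hU : ∀ i j, L (freeU m i j) = U i j := fun i j => FreeStarAlg.lift_letter _ _
  have hV : ∀ i j, L (star (freeU m i j)) = V i j := fun i j => by
    rw [freeU, Matrix.of_apply, FreeStarAlg.gen, FreeStarAlg.star_letter]
    exact FreeStarAlg.lift_letter _ _
  have h1 : ∀ i j, L ((1 : Matrix (Fin m) (Fin m) (FreeStarAlg (Fin m × Fin m))) i j) =
      (1 : Matrix (Fin m) (Fin m) B) i j := fun i j => by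
    rw [Matrix.one_apply, Matrix.one_apply]; split_ifs <;> simp
  have hl : ∀ i j, L (((freeU m).conjTranspose * freeU m) i j) =
      (1 : Matrix (Fin m) (Fin m) B) i j := fun i j => by
    rw [← h.left]
    simp [Matrix.mul_apply, hU, hV]
  have hr : ∀ i j, L ((freeU m * (freeU m).conjTranspose) i j) =
      (1 : Matrix (Fin m) (Fin m) B) i j := fun i j => by
    rw [← h.right]
    simp [Matrix.mul_apply, hU, hV]
  have hc : ∀ i j, L (conjugateBy F (conjMat (freeU m)) i j) = U i j := fun i j => by
    conv_rhs => rw [h.orth]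
    simp [conjugateBy, conjMat, scalarMat, Matrix.mul_apply, hV]
  have hc' : ∀ i j, L (star (conjugateBy F (conjMat (freeU m)) i j)) = V i j := fun i j => by
    conv_rhs => rw [h.orth']
    simp only [conjugateBy, conjMat, scalarMat, Matrix.mul_apply, Matrix.map_apply, star_sum,
      star_mul, star_star, FreeStarAlg.star_algebraMap, map_sum, map_mul, hU, AlgHom.commutes]
    refine Finset.sum_congr rfl fun k _ => ?_
    rw [← Algebra.commutes]
    congr 1
    refine Finset.sum_congr rfl fun l _ => ?_
    rw [← Algebra.commutes]
    rfl
  rcases hab with hab | hab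
  · cases hab with
    | left i j => rw [hl, h1]
    | right i j => rw [hr, h1]
    | orth i j => rw [hU, hc]
  · obtain ⟨a, rfl⟩ : ∃ a', a = star a' := ⟨star a, (star_star a).symm⟩
    obtain ⟨b, rfl⟩ : ∃ b', b = star b' := ⟨star b, (star_star b).symm⟩
    rw [star_star, star_star] at hab
    have hs1 : ∀ i j, star ((1 : Matrix (Fin m) (Fin m) (FreeStarAlg (Fin m × Fin m))) i j) =
        (1 : Matrix (Fin m) (Fin m) (FreeStarAlg (Fin m × Fin m))) j i := fun i j => by
      rw [← Matrix.conjTranspose_apply, Matrix.conjTranspose_one]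
    cases hab with
    | left i j =>
      rw [hs1, h1, ← Matrix.conjTranspose_apply, Matrix.conjTranspose_mul,
        Matrix.conjTranspose_conjTranspose, hl]
    | right i j =>
      rw [hs1, h1, ← Matrix.conjTranspose_apply, Matrix.conjTranspose_mul,
        Matrix.conjTranspose_conjTranspose, hr]
    | orth i j => rw [hV, hc']

/-- The homomorphism of algebras with `u_ij ↦ U_ij` and `u_ij* ↦ V_ij`. -/
def lift (U V : Matrix (Fin m) (Fin m) B) (h : IsPair F U V) : FreeOrth F →ₐ[ℂ] B :=
  UnivStarAlg.lift (Rel F) (fun p => U p.1 p.2) (fun p => V p.1 p.2) (lift_aux h)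

@[simp] theorem lift_fund (h : IsPair F U V) (i j : Fin m) : lift U V h (fund F i j) = U i j :=
  (UnivStarAlg.lift_mk _ _ _ _).trans (FreeStarAlg.lift_letter _ _)

@[simp] theorem lift_star_fund (h : IsPair F U V) (i j : Fin m) :
    lift U V h (star (fund F i j)) = V i j := by
  have h1 : star (fund F i j) = UnivStarAlg.mk (Rel F) (star (FreeStarAlg.gen (i, j))) :=
    (UnivStarAlg.mk_star _ _).symm
  rw [h1, FreeStarAlg.gen, FreeStarAlg.star_letter]
  exact (UnivStarAlg.lift_mk _ _ _ _).trans (FreeStarAlg.lift_letter _ _)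

theorem algHom_ext {φ ψ : FreeOrth F →ₐ[ℂ] B} (h : ∀ i j, φ (fund F i j) = ψ (fund F i j))
    (h' : ∀ i j, φ (star (fund F i j)) = ψ (star (fund F i j))) : φ = ψ :=
  UnivStarAlg.algHom_ext (r := Rel F) (fun x => h x.1 x.2) (fun x => h' x.1 x.2)

/-- In a `*`-algebra, a unitary matrix with `U = F Ū F⁻¹` gives a pair `(U, Ū)`. -/
theorem IsPair.of_unitary [StarRing B] [StarModule ℂ B] (h : IsUnitaryMat U)
    (h' : U = conjugateBy F (conjMat U)) : IsPair F U (conjMat U) where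
  left := h.1
  right := h.2
  orth := h'
  orth' := by
    ext i j
    conv_lhs => rw [h']
    simp only [conjugateBy, conjMat, scalarMat, Matrix.mul_apply, Matrix.map_apply, star_sum,
      star_mul, star_star, ← algebraMap_star_comm]
    refine Finset.sum_congr rfl fun k _ => ?_
    rw [← Algebra.commutes]
    congr 1
    refine Finset.sum_congr rfl fun l _ => ?_
    rw [← Algebra.commutes]
    rfl

theorem conjugateBy_inv (G : GL (Fin m) ℂ) (M : Matrix (Fin m) (Fin m) B) :
    conjugateBy G⁻¹ (conjugateBy G M) = M := by
  have h1 : scalarMat B ((G⁻¹ : GL (Fin m) ℂ) : Matrix (Fin m) (Fin m) ℂ) * scalarMat B G = 1 := by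
    rw [scalarMat_mul, ← Units.val_mul, inv_mul_cancel, Units.val_one, scalarMat_one]
  simp only [conjugateBy, inv_inv]
  rw [mul_assoc, mul_assoc, h1, mul_one, ← mul_assoc, h1, one_mul]

end lift

variable (F)

theorem fund_unitary : IsUnitaryMat (fund F) := by
  have h : ∀ M : Matrix (Fin m) (Fin m) (FreeStarAlg (Fin m × Fin m)), ∀ i j,
      Rel F (M i j) ((1 : Matrix (Fin m) (Fin m) (FreeStarAlg (Fin m × Fin m))) i j) →
      UnivStarAlg.mk (Rel F) (M i j) = (1 : Matrix (Fin m) (Fin m) (FreeOrth F)) i j := by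
    intro M i j hr
    rw [UnivStarAlg.mk_eq _ hr, Matrix.one_apply, Matrix.one_apply]
    split_ifs
    · exact map_one _
    · exact map_zero _
  constructor
  · ext i j
    rw [← h _ i j (Rel.left i j), Matrix.mul_apply, Matrix.mul_apply, map_sum]
    refine Finset.sum_congr rfl fun k _ => ?_
    rw [map_mul, Matrix.conjTranspose_apply, Matrix.conjTranspose_apply, UnivStarAlg.mk_star]
    rfl
  · ext i j
    rw [← h _ i j (Rel.right i j), Matrix.mul_apply, Matrix.mul_apply, map_sum]
    refine Finset.sum_congr rfl fun k _ => ?_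
    rw [map_mul, Matrix.conjTranspose_apply, Matrix.conjTranspose_apply, UnivStarAlg.mk_star]
    rfl

theorem fund_conj : fund F = conjugateBy F (conjMat (fund F)) := by
  ext i j
  have h : fund F i j = _ := UnivStarAlg.mk_eq _ (Rel.orth (F := F) i j)
  rw [h]
  simp only [conjugateBy, conjMat, scalarMat, Matrix.mul_apply, Matrix.map_apply, map_sum, map_mul,
    UnivStarAlg.mk_star, AlgHom.commutes]
  rfl

theorem fund_isPair : IsPair F (fund F) (conjMat (fund F)) :=
  .of_unitary (fund_unitary F) (fund_conj F)

/-- The matrix `(∑ₖ x_ik ⊗ y_kj)`. -/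
def tmulMat {A B : Type*} [Ring A] [Algebra ℂ A] [Ring B] [Algebra ℂ B]
    (x : Matrix (Fin m) (Fin m) A) (y : Matrix (Fin m) (Fin m) B) :
    Matrix (Fin m) (Fin m) (A ⊗[ℂ] B) :=
  Matrix.of fun i j => ∑ k, x i k ⊗ₜ[ℂ] y k j

theorem conjugateBy_eq {A : Type*} [Ring A] [Algebra ℂ A] (G : GL (Fin m) ℂ)
    (M : Matrix (Fin m) (Fin m) A) (i j : Fin m) : conjugateBy G M i j =
      ∑ k, ∑ l, ((G : Matrix (Fin m) (Fin m) ℂ) i l *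
        ((G⁻¹ : GL (Fin m) ℂ) : Matrix (Fin m) (Fin m) ℂ) k j) • M l k := by
  simp only [conjugateBy, scalarMat, Matrix.mul_apply, Matrix.map_apply, Finset.sum_mul]
  refine Finset.sum_congr rfl fun k _ => Finset.sum_congr rfl fun l _ => ?_
  rw [mul_assoc, ← Algebra.commutes, ← mul_assoc, ← map_mul, Algebra.smul_def]

/-- Matrices in the two tensor factors, `x_13`-style legs: `x ⊗ 1` and `1 ⊗ y`. -/
theorem tmulMat_eq {A B : Type*} [Ring A] [Algebra ℂ A] [Ring B] [Algebra ℂ B]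
    (x : Matrix (Fin m) (Fin m) A) (y : Matrix (Fin m) (Fin m) B) :
    tmulMat x y = x.map (Algebra.TensorProduct.includeLeft : A →ₐ[ℂ] A ⊗[ℂ] B) *
      y.map (Algebra.TensorProduct.includeRight : B →ₐ[ℂ] A ⊗[ℂ] B) := by
  ext i j
  simp [tmulMat, Matrix.mul_apply]

theorem conjugateBy_mul {A : Type*} [Ring A] [Algebra ℂ A] (G : GL (Fin m) ℂ)
    (M N : Matrix (Fin m) (Fin m) A) :
    conjugateBy G (M * N) = conjugateBy G M * conjugateBy G N := by
  have h1 : scalarMat A ((G⁻¹ : GL (Fin m) ℂ) : Matrix (Fin m) (Fin m) ℂ) * scalarMat A G = 1 := by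
    rw [scalarMat_mul, ← Units.val_mul, inv_mul_cancel, Units.val_one, scalarMat_one]
  simp only [conjugateBy]
  rw [show ∀ a b c d e f : Matrix (Fin m) (Fin m) A, a * b * c * (d * e * f) =
    a * (b * (c * d) * e) * f by intros; noncomm_ring, h1, mul_one]

theorem conjugateBy_map {A B : Type*} [Ring A] [Algebra ℂ A] [Ring B] [Algebra ℂ B]
    (G : GL (Fin m) ℂ) (M : Matrix (Fin m) (Fin m) A) (φ : A →ₐ[ℂ] B) :
    conjugateBy G (M.map φ) = (conjugateBy G M).map φ := by
  ext i j
  simp [conjugateBy_eq]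

variable {F} in
theorem IsPair.tmul {A B : Type*} [Ring A] [Algebra ℂ A] [Ring B] [Algebra ℂ B]
    {U V : Matrix (Fin m) (Fin m) A} {U' V' : Matrix (Fin m) (Fin m) B}
    (h : IsPair F U V) (h' : IsPair F U' V') : IsPair F (tmulMat U U') (tmulMat V V') where
  left := by
    have e : (tmulMat V V').transpose =
        V'.transpose.map (Algebra.TensorProduct.includeRight : B →ₐ[ℂ] A ⊗[ℂ] B) *
        V.transpose.map (Algebra.TensorProduct.includeLeft : A →ₐ[ℂ] A ⊗[ℂ] B) := by
      ext i j
      simp [tmulMat, Matrix.mul_apply]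
    rw [e, tmulMat_eq, mul_assoc, ← mul_assoc (V.transpose.map _), ← Matrix.map_mul, h.left,
      Matrix.map_one _ (map_zero _) (map_one _), one_mul, ← Matrix.map_mul, h'.left,
      Matrix.map_one _ (map_zero _) (map_one _)]
  right := by
    have e : (tmulMat V V').transpose =
        V'.transpose.map (Algebra.TensorProduct.includeRight : B →ₐ[ℂ] A ⊗[ℂ] B) *
        V.transpose.map (Algebra.TensorProduct.includeLeft : A →ₐ[ℂ] A ⊗[ℂ] B) := by
      ext i j
      simp [tmulMat, Matrix.mul_apply]
    rw [e, tmulMat_eq, mul_assoc, ← mul_assoc (U'.map _), ← Matrix.map_mul, h'.right,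
      Matrix.map_one _ (map_zero _) (map_one _), one_mul, ← Matrix.map_mul, h.right,
      Matrix.map_one _ (map_zero _) (map_one _)]
  orth := by
    rw [tmulMat_eq, tmulMat_eq, conjugateBy_mul, conjugateBy_map, conjugateBy_map, ← h.orth,
      ← h'.orth]
  orth' := by
    rw [tmulMat_eq, tmulMat_eq, conjugateBy_mul, conjugateBy_map, conjugateBy_map, ← h.orth',
      ← h'.orth']

/-- The coproduct, `Δ(u_ij) = ∑ₖ u_ik ⊗ u_kj` and `Δ(u_ij*) = ∑ₖ u_ik* ⊗ u_kj*`. -/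
def comulHom : FreeOrth F →ₐ[ℂ] FreeOrth F ⊗[ℂ] FreeOrth F :=
  lift (tmulMat (fund F) (fund F)) (tmulMat (conjMat (fund F)) (conjMat (fund F)))
    ((fund_isPair F).tmul (fund_isPair F))

theorem isPair_one : IsPair F (1 : Matrix (Fin m) (Fin m) ℂ) 1 := by
  have h : ∀ G : GL (Fin m) ℂ, conjugateBy G (1 : Matrix (Fin m) (Fin m) ℂ) = 1 := fun G => by
    rw [conjugateBy, mul_one, scalarMat_mul, ← Units.val_mul, mul_inv_cancel, Units.val_one,
      scalarMat_one]
  exact ⟨by simp, by simp, (h F).symm, (h _).symm⟩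

/-- The counit, `ε(u_ij) = ε(u_ij*) = δ_ij`. -/
def counitHom : FreeOrth F →ₐ[ℂ] ℂ := lift 1 1 (isPair_one F)

theorem comulHom_fund (i j : Fin m) :
    comulHom F (fund F i j) = ∑ k, fund F i k ⊗ₜ[ℂ] fund F k j := lift_fund _ _ _

theorem comulHom_star_fund (i j : Fin m) :
    comulHom F (star (fund F i j)) = ∑ k, star (fund F i k) ⊗ₜ[ℂ] star (fund F k j) :=
  lift_star_fund _ _ _

theorem counitHom_fund (i j : Fin m) :
    counitHom F (fund F i j) = (1 : Matrix (Fin m) (Fin m) ℂ) i j := lift_fund _ _ _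

theorem counitHom_star_fund (i j : Fin m) :
    counitHom F (star (fund F i j)) = (1 : Matrix (Fin m) (Fin m) ℂ) i j := lift_star_fund _ _ _

instance : Bialgebra ℂ (FreeOrth F) :=
  Bialgebra.ofAlgHom (comulHom F) (counitHom F)
    (by
      apply algHom_ext <;> intro i j
      · simp [comulHom_fund, TensorProduct.sum_tmul, TensorProduct.tmul_sum]
        exact Finset.sum_comm
      · simp [comulHom_star_fund, TensorProduct.sum_tmul, TensorProduct.tmul_sum]
        exact Finset.sum_comm)
    (by
      apply algHom_ext <;> intro i j
      · simp [comulHom_fund, counitHom_fund, Matrix.one_apply, TensorProduct.ite_tmul]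
      · simp [comulHom_star_fund, counitHom_star_fund, Matrix.one_apply, TensorProduct.ite_tmul])
    (by
      apply algHom_ext <;> intro i j
      · simp [comulHom_fund, counitHom_fund, Matrix.one_apply, TensorProduct.tmul_ite]
      · simp [comulHom_star_fund, counitHom_star_fund, Matrix.one_apply, TensorProduct.tmul_ite])

theorem comul_fund (i j : Fin m) :
    comul (R := ℂ) (fund F i j) = ∑ k, fund F i k ⊗ₜ[ℂ] fund F k j := comulHom_fund F i j

theorem comul_star_fund (i j : Fin m) :
    comul (R := ℂ) (star (fund F i j)) = ∑ k, star (fund F i k) ⊗ₜ[ℂ] star (fund F k j) :=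
  comulHom_star_fund F i j

theorem counit_fund (i j : Fin m) :
    counit (R := ℂ) (fund F i j) = (1 : Matrix (Fin m) (Fin m) ℂ) i j := counitHom_fund F i j

theorem counit_star_fund (i j : Fin m) :
    counit (R := ℂ) (star (fund F i j)) = (1 : Matrix (Fin m) (Fin m) ℂ) i j :=
  counitHom_star_fund F i j

theorem induction {P : FreeOrth F → Prop} (h1 : ∀ c : ℂ, P (algebraMap ℂ _ c))
    (h2 : ∀ i j, P (fund F i j)) (h2' : ∀ i j, P (star (fund F i j)))
    (h3 : ∀ a b, P a → P b → P (a * b))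
    (h4 : ∀ a b, P a → P b → P (a + b)) (a : FreeOrth F) : P a := by
  obtain ⟨a, rfl⟩ := UnivStarAlg.mk_surjective (Rel F) a
  induction a using FreeStarAlg.induction with
  | h1 c => rw [AlgHom.commutes]; exact h1 c
  | h2 x =>
    rcases x with x | x
    · exact h2 x.1 x.2
    · have : FreeStarAlg.letter (Sum.inr x) = star (FreeStarAlg.gen x) := by
        rw [FreeStarAlg.gen, FreeStarAlg.star_letter]; rfl
      rw [this, UnivStarAlg.mk_star]
      exact h2' x.1 x.2
  | h3 a b ha hb => rw [map_mul]; exact h3 _ _ ha hb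
  | h4 a b ha hb => rw [map_add]; exact h4 _ _ ha hb

/-- The matrix `F⁻¹ U* F`, the value of the antipode on `Ū`. -/
def antiV : Matrix (Fin m) (Fin m) (FreeOrth F) := conjugateBy F⁻¹ (fund F).conjTranspose

theorem conjugateBy_one {A : Type*} [Ring A] [Algebra ℂ A] (G : GL (Fin m) ℂ) :
    conjugateBy G (1 : Matrix (Fin m) (Fin m) A) = 1 := by
  rw [conjugateBy, mul_one, scalarMat_mul, ← Units.val_mul, mul_inv_cancel, Units.val_one,
    scalarMat_one]

theorem conjMat_fund : conjMat (fund F) = conjugateBy F⁻¹ (fund F) := by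
  conv_rhs => rw [fund_conj F, conjugateBy_inv]

theorem conjMat_mul_antiV : conjMat (fund F) * antiV F = 1 := by
  rw [conjMat_fund, antiV, ← conjugateBy_mul, (fund_unitary F).2, conjugateBy_one]

theorem antiV_mul_conjMat : antiV F * conjMat (fund F) = 1 := by
  rw [conjMat_fund, antiV, ← conjugateBy_mul, (fund_unitary F).1, conjugateBy_one]

theorem antiV_eq : antiV F = conjugateBy (conjGL F) (fund F).conjTranspose := by
  have h : conjMat (fund F) * conjugateBy (conjGL F) (fund F).conjTranspose = 1 := by
    conv_lhs => rw [(fund_isPair F).orth']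
    rw [← conjugateBy_mul, (fund_unitary F).2, conjugateBy_one]
  calc antiV F = antiV F * (conjMat (fund F) * conjugateBy (conjGL F) (fund F).conjTranspose) := by
        rw [h, mul_one]
    _ = _ := by rw [← mul_assoc, antiV_mul_conjMat, one_mul]

theorem conjugateBy_op (G : GL (Fin m) ℂ) (M : Matrix (Fin m) (Fin m) (FreeOrth F)) :
    conjugateBy G (M.map MulOpposite.op) = (conjugateBy G M).map MulOpposite.op := by
  ext i j
  simp [conjugateBy_eq]

/-- The antipode as a homomorphism to the opposite algebra:
`S(u_ij) = u_ji*` and `S(u_ij*) = (F⁻¹ U* F)_ij`. -/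
def antipodeHom : FreeOrth F →ₐ[ℂ] (FreeOrth F)ᵐᵒᵖ :=
  lift ((fund F).conjTranspose.map MulOpposite.op) ((antiV F).map MulOpposite.op)
    { left := by
        ext i j
        have := congrFun (congrFun (conjMat_mul_antiV F) j) i
        apply MulOpposite.unop_injective
        rw [Matrix.mul_apply] at this ⊢
        simp only [Matrix.transpose_apply, Matrix.map_apply, ← MulOpposite.op_mul,
          Matrix.conjTranspose_apply, Finset.unop_sum, MulOpposite.unop_op]
        refine this.trans ?_
        rw [Matrix.one_apply, Matrix.one_apply]
        simp only [eq_comm]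
        split_ifs <;> rfl
      right := by
        ext i j
        have := congrFun (congrFun (antiV_mul_conjMat F) j) i
        apply MulOpposite.unop_injective
        rw [Matrix.mul_apply] at this ⊢
        simp only [Matrix.transpose_apply, Matrix.map_apply, ← MulOpposite.op_mul,
          Matrix.conjTranspose_apply, Finset.unop_sum, MulOpposite.unop_op]
        refine this.trans ?_
        rw [Matrix.one_apply, Matrix.one_apply]
        simp only [eq_comm]
        split_ifs <;> rfl
      orth := by
        rw [conjugateBy_op, antiV]
        congr 1
        have := conjugateBy_inv F⁻¹ (fund F).conjTranspose
        rw [inv_inv] at this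
        rw [this]
      orth' := by rw [conjugateBy_op, antiV_eq] }

/-- The antipode of `ℂ[O_F⁺]`. -/
def antipodeLin : FreeOrth F →ₗ[ℂ] FreeOrth F :=
  (MulOpposite.opLinearEquiv ℂ).symm.toLinearMap ∘ₗ (antipodeHom F).toLinearMap

theorem antipodeLin_fund (i j : Fin m) : antipodeLin F (fund F i j) = star (fund F j i) :=
  congrArg MulOpposite.unop (lift_fund (F := F) _ i j)

theorem antipodeLin_star_fund (i j : Fin m) :
    antipodeLin F (star (fund F i j)) = antiV F i j :=
  congrArg MulOpposite.unop (lift_star_fund (F := F) _ i j)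

theorem antipodeLin_mul (a b : FreeOrth F) :
    antipodeLin F (a * b) = antipodeLin F b * antipodeLin F a := by
  simp [antipodeLin]

theorem antipodeLin_algebraMap (c : ℂ) :
    antipodeLin F (algebraMap ℂ _ c) = algebraMap ℂ _ c := by
  simp [antipodeLin]

theorem antipodeLin_one : antipodeLin F 1 = 1 := by
  simp [antipodeLin]

theorem antipode_left (x : FreeOrth F) :
    LinearMap.mul' ℂ (FreeOrth F) ((antipodeLin F).rTensor _ (comul x)) =
      algebraMap ℂ _ (counit (R := ℂ) x) := by
  induction x using FreeOrth.induction with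
  | h1 c =>
    rw [Bialgebra.comul_algebraMap, Bialgebra.counit_algebraMap]
    simp [Algebra.TensorProduct.algebraMap_apply, antipodeLin_algebraMap]
  | h2 i j =>
    have h := congrFun (congrFun (fund_unitary F).1 i) j
    rw [comul_fund, counit_fund]
    simp only [map_sum, LinearMap.rTensor_tmul, LinearMap.mul'_apply, antipodeLin_fund]
    rw [Matrix.mul_apply] at h
    refine h.trans ?_
    rw [Matrix.one_apply, Matrix.one_apply]; split_ifs <;> simp
  | h2' i j =>
    have h := congrFun (congrFun (antiV_mul_conjMat F) i) j
    rw [comul_star_fund, counit_star_fund]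
    simp only [map_sum, LinearMap.rTensor_tmul, LinearMap.mul'_apply, antipodeLin_star_fund]
    rw [Matrix.mul_apply] at h
    refine h.trans ?_
    rw [Matrix.one_apply, Matrix.one_apply]; split_ifs <;> simp
  | h3 a b ha hb =>
    have key : ∀ s t : FreeOrth F ⊗[ℂ] FreeOrth F, ∀ c : ℂ,
        LinearMap.mul' ℂ (FreeOrth F) ((antipodeLin F).rTensor _ s) = algebraMap ℂ _ c →
        LinearMap.mul' ℂ (FreeOrth F) ((antipodeLin F).rTensor _ (s * t)) =
        algebraMap ℂ _ c * LinearMap.mul' ℂ (FreeOrth F) ((antipodeLin F).rTensor _ t) := by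
      intro s t c hs
      induction t with
      | zero => simp
      | add t t' h h' => simp only [mul_add, map_add, h, h']
      | tmul p q =>
        have h' : ∀ s : FreeOrth F ⊗[ℂ] FreeOrth F,
            LinearMap.mul' ℂ (FreeOrth F) ((antipodeLin F).rTensor _ (s * p ⊗ₜ q)) =
            antipodeLin F p * LinearMap.mul' ℂ (FreeOrth F) ((antipodeLin F).rTensor _ s) * q := by
          intro s
          induction s with
          | zero => simp
          | add t t' h h' => simp only [add_mul, mul_add, map_add, h, h']
          | tmul a b => simp [antipodeLin_mul, mul_assoc]
        rw [h', hs, ← Algebra.commutes, mul_assoc, LinearMap.rTensor_tmul, LinearMap.mul'_apply]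
    rw [Bialgebra.comul_mul, key _ _ _ ha, hb, Bialgebra.counit_mul, map_mul]
  | h4 a b ha hb => simp only [map_add, ha, hb]

theorem antipode_right (x : FreeOrth F) :
    LinearMap.mul' ℂ (FreeOrth F) ((antipodeLin F).lTensor _ (comul x)) =
      algebraMap ℂ _ (counit (R := ℂ) x) := by
  induction x using FreeOrth.induction with
  | h1 c =>
    rw [Bialgebra.comul_algebraMap, Bialgebra.counit_algebraMap]
    simp [Algebra.TensorProduct.algebraMap_apply, antipodeLin_one]
  | h2 i j =>
    have h := congrFun (congrFun (fund_unitary F).2 i) j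
    rw [comul_fund, counit_fund]
    simp only [map_sum, LinearMap.lTensor_tmul, LinearMap.mul'_apply, antipodeLin_fund]
    rw [Matrix.mul_apply] at h
    refine h.trans ?_
    rw [Matrix.one_apply, Matrix.one_apply]; split_ifs <;> simp
  | h2' i j =>
    have h := congrFun (congrFun (conjMat_mul_antiV F) i) j
    rw [comul_star_fund, counit_star_fund]
    simp only [map_sum, LinearMap.lTensor_tmul, LinearMap.mul'_apply, antipodeLin_star_fund]
    rw [Matrix.mul_apply] at h
    refine h.trans ?_
    rw [Matrix.one_apply, Matrix.one_apply]; split_ifs <;> simp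
  | h3 a b ha hb =>
    have key : ∀ s t : FreeOrth F ⊗[ℂ] FreeOrth F, ∀ c : ℂ,
        LinearMap.mul' ℂ (FreeOrth F) ((antipodeLin F).lTensor _ t) = algebraMap ℂ _ c →
        LinearMap.mul' ℂ (FreeOrth F) ((antipodeLin F).lTensor _ (s * t)) =
        LinearMap.mul' ℂ (FreeOrth F) ((antipodeLin F).lTensor _ s) * algebraMap ℂ _ c := by
      intro s t c ht
      induction s with
      | zero => simp
      | add t t' h h' => simp only [add_mul, map_add, h, h']
      | tmul p q =>
        have h' : ∀ t : FreeOrth F ⊗[ℂ] FreeOrth F,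
            LinearMap.mul' ℂ (FreeOrth F) ((antipodeLin F).lTensor _ (p ⊗ₜ q * t)) =
            p * LinearMap.mul' ℂ (FreeOrth F) ((antipodeLin F).lTensor _ t) * antipodeLin F q := by
          intro t
          induction t with
          | zero => simp
          | add t t' h h' => simp only [add_mul, mul_add, map_add, h, h']
          | tmul a b => simp [antipodeLin_mul, mul_assoc]
        rw [h', ht, mul_assoc, Algebra.commutes, ← mul_assoc, LinearMap.lTensor_tmul,
          LinearMap.mul'_apply]
    rw [Bialgebra.comul_mul, key _ _ _ hb, ha, Bialgebra.counit_mul, map_mul]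
  | h4 a b ha hb => simp only [map_add, ha, hb]

instance : HopfAlgebra ℂ (FreeOrth F) where
  antipode := antipodeLin F
  mul_antipode_rTensor_comul := LinearMap.ext (antipode_left F)
  mul_antipode_lTensor_comul := LinearMap.ext (antipode_right F)

theorem antipode_fund (i j : Fin m) : antipode ℂ (fund F i j) = star (fund F j i) :=
  antipodeLin_fund F i j

end FreeOrth

/-! ### Hopf star-algebras over a torus -/

section GroupAlgebra

variable {Γ : Type*}

/-- The conjugate-linear ring endomorphism of the group algebra with `g ↦ g⁻¹`. -/
def groupAlgStarHom (Γ : Type*) [CommGroup Γ] : MonoidAlgebra ℂ Γ →+* MonoidAlgebra ℂ Γ :=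
  (MonoidAlgebra.mapDomainRingHom ℂ (invMonoidHom : Γ →* Γ)).comp
    (MonoidAlgebra.mapRingHom Γ (starRingEnd ℂ))

section

variable [CommGroup Γ]

theorem groupAlgStarHom_single (g : Γ) (c : ℂ) :
    groupAlgStarHom Γ (MonoidAlgebra.single g c) = MonoidAlgebra.single g⁻¹ (star c) := by
  simp [groupAlgStarHom]

/-- The `*`-structure `(∑ c_g g)* = ∑ c̄_g g⁻¹` on the group algebra of an abelian group. -/
instance : StarRing (MonoidAlgebra ℂ Γ) where
  star := groupAlgStarHom Γ
  star_involutive x := by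
    induction x using MonoidAlgebra.induction_linear with
    | zero => simp
    | add x y hx hy => simp only [map_add, hx, hy]
    | single g c => simp [groupAlgStarHom_single]
  star_mul x y := by rw [map_mul, mul_comm]
  star_add x y := map_add _ x y

theorem MonoidAlgebra.star_single' (g : Γ) (c : ℂ) :
    star (MonoidAlgebra.single g c) = MonoidAlgebra.single g⁻¹ (star c) :=
  groupAlgStarHom_single g c

instance : StarModule ℂ (MonoidAlgebra ℂ Γ) where
  star_smul c x := by
    induction x using MonoidAlgebra.induction_linear with
    | zero => simp
    | add x y hx hy => simp only [smul_add, star_add, hx, hy]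
    | single g d =>
      rw [MonoidAlgebra.smul_single, MonoidAlgebra.star_single', MonoidAlgebra.star_single',
        MonoidAlgebra.smul_single, smul_eq_mul, smul_eq_mul, star_mul, mul_comm]

end

/-- The linear extension to the group algebra of a function on the group. -/
def linExt {M : Type*} [AddCommGroup M] [Module ℂ M] (f : Γ → M) : MonoidAlgebra ℂ Γ →ₗ[ℂ] M :=
  (MonoidAlgebra.basis Γ ℂ).constr ℂ f

@[simp] theorem linExt_single {M : Type*} [AddCommGroup M] [Module ℂ M] (f : Γ → M) (g : Γ) :
    linExt f (MonoidAlgebra.single g 1) = f g := by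
  rw [← MonoidAlgebra.basis_apply, linExt, Module.Basis.constr_basis]

/-- The bilinear extension of a function of two variables on the group, as a linear functional on
`ℂΓ ⊗ ℂΓ`. -/
def biExt (φ : Γ → Γ → ℂ) : MonoidAlgebra ℂ Γ ⊗[ℂ] MonoidAlgebra ℂ Γ →ₗ[ℂ] ℂ :=
  TensorProduct.lift (linExt fun a => linExt (φ a))

@[simp] theorem biExt_single (φ : Γ → Γ → ℂ) (a b : Γ) :
    biExt φ (MonoidAlgebra.single a 1 ⊗ₜ[ℂ] MonoidAlgebra.single b 1) = φ a b := by
  simp [biExt]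

/-- The coefficient of `a` in an element of the group algebra. -/
def coef (a : Γ) : MonoidAlgebra ℂ Γ →ₗ[ℂ] ℂ := (MonoidAlgebra.basis Γ ℂ).coord a

theorem coef_single (a g : Γ) (c : ℂ) :
    coef a (MonoidAlgebra.single g c) = Finsupp.single g c a := rfl

theorem exists_sum_coef (k : MonoidAlgebra ℂ Γ) :
    ∃ s : Finset Γ, ∀ s', s ⊆ s' → ∑ a ∈ s', coef a k = counit (R := ℂ) k := by
  classical
  induction k using MonoidAlgebra.induction_linear with
  | zero => exact ⟨∅, fun s' _ => by simp⟩
  | add x y hx hy =>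
    obtain ⟨s, hs⟩ := hx
    obtain ⟨t, ht⟩ := hy
    refine ⟨s ∪ t, fun s' h => ?_⟩
    rw [map_add, ← hs s' (Finset.union_subset_left h), ← ht s' (Finset.union_subset_right h),
      ← Finset.sum_add_distrib]
    exact Finset.sum_congr rfl fun a _ => map_add _ _ _
  | single g c =>
    refine ⟨{g}, fun s' h => ?_⟩
    have hg : g ∈ s' := h (Finset.mem_singleton_self g)
    simp [coef_single, Finsupp.single_apply, hg]

/-- The bilinear extension of a bicharacter. -/
def bichar [CommGroup Γ] (β : Γ →* Γ →* Circle) : MonoidAlgebra ℂ Γ ⊗[ℂ] MonoidAlgebra ℂ Γ →ₗ[ℂ] ℂ :=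
  biExt fun a b => (β a b : ℂ)

end GroupAlgebra

/-- A Hopf `*`-algebra: a Hopf algebra and a `*`-algebra such that the coproduct is
`*`-preserving. -/
class HopfStarAlgebra (H : Type*) [Ring H] [StarRing H] [HopfAlgebra ℂ H] : Prop
    extends StarModule ℂ H where
  comul_star : ∀ x : H, comul (R := ℂ) (star x) = star (comul (R := ℂ) x)

/-- Hopf `*`-algebra maps `π : H → ℂΓ` (for `Γ` the dual of a compact abelian group `T`, this is a
map `H → ℂ[T]`). -/
structure TorusMap (H Γ : Type*) [Ring H] [StarRing H] [HopfAlgebra ℂ H] [CommGroup Γ]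
    extends H →ₐc[ℂ] MonoidAlgebra ℂ Γ where
  map_star : ∀ x, toFun (star x) = star (toFun x)

section Transmutation

variable {H Γ : Type*} [Ring H] [StarRing H] [HopfAlgebra ℂ H] [CommGroup Γ]

namespace TorusMap

variable (π : TorusMap H Γ)

/-- The underlying linear map. -/
def lin : H →ₗ[ℂ] MonoidAlgebra ℂ Γ := (π.toBialgHom : H →ₐ[ℂ] MonoidAlgebra ℂ Γ).toLinearMap

/-- The left coaction `δ_L = (π ⊗ ι)Δ`. -/
def leftCoaction : H →ₗ[ℂ] MonoidAlgebra ℂ Γ ⊗[ℂ] H := π.lin.rTensor H ∘ₗ comul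

/-- The right coaction `δ_R = (ι ⊗ π)Δ`. -/
def rightCoaction : H →ₗ[ℂ] H ⊗[ℂ] MonoidAlgebra ℂ Γ := π.lin.lTensor H ∘ₗ comul

/-- The homogeneous component `H_{a,b} = {x | δ_L(x) = a ⊗ x, δ_R(x) = x ⊗ b}`. -/
def homog (a b : Γ) : Submodule ℂ H where
  carrier := {x | π.leftCoaction x = MonoidAlgebra.single a 1 ⊗ₜ x ∧
    π.rightCoaction x = x ⊗ₜ MonoidAlgebra.single b 1}
  add_mem' := fun {x y} hx hy => ⟨by rw [map_add, hx.1, hy.1, TensorProduct.tmul_add],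
    by rw [map_add, hx.2, hy.2, TensorProduct.add_tmul]⟩
  zero_mem' := ⟨by simp, by simp⟩
  smul_mem' := fun c x hx => ⟨by rw [map_smul, hx.1, TensorProduct.tmul_smul],
    by rw [map_smul, hx.2, TensorProduct.smul_tmul']⟩

theorem lin_mul (x y : H) : π.lin (x * y) = π.lin x * π.lin y :=
  map_mul (π.toBialgHom : H →ₐ[ℂ] MonoidAlgebra ℂ Γ) x y

theorem lin_one : π.lin 1 = 1 := map_one (π.toBialgHom : H →ₐ[ℂ] MonoidAlgebra ℂ Γ)

theorem lin_star (x : H) : π.lin (star x) = star (π.lin x) := π.map_star x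

theorem counit_lin (x : H) : counit (R := ℂ) (π.lin x) = counit (R := ℂ) x :=
  LinearMap.congr_fun π.toBialgHom.counit_comp x

theorem comul_lin (x : H) : comul (R := ℂ) (π.lin x) = TensorProduct.map π.lin π.lin (comul x) :=
  (LinearMap.congr_fun π.toBialgHom.map_comp_comul x).symm

/-- The convolution inverse of `π` is `π ∘ S`, as well as `S ∘ π`. -/
theorem lin_antipode (x : H) : π.lin (antipode ℂ x) = antipode ℂ (π.lin x) := by
  have h1 : WithConv.toConv (π.lin ∘ₗ antipode ℂ) * WithConv.toConv π.lin = 1 := by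
    ext x
    rw [(ℛ ℂ x).convMul_apply]
    simp only [LinearMap.comp_apply, ← lin_mul, ← map_sum,
      sum_antipode_mul_eq_algebraMap_counit]
    simp [Algebra.algebraMap_eq_smul_one, lin_one]
  have h2 : WithConv.toConv π.lin * WithConv.toConv (antipode ℂ ∘ₗ π.lin) = 1 := by
    ext x a
    have := LinearMap.congr_fun (mul_antipode_lTensor_comul (R := ℂ) (A := MonoidAlgebra ℂ Γ))
      (π.lin x)
    rw [(ℛ ℂ x).convMul_apply]
    simp only [LinearMap.comp_apply, comul_lin, counit_lin, ← (ℛ ℂ x).eq, map_sum,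
      TensorProduct.map_tmul, LinearMap.lTensor_tmul, LinearMap.mul'_apply] at this
    simpa using congrArg (fun k => MonoidAlgebra.coeff k a) this
  exact LinearMap.congr_fun (congrArg WithConv.ofConv (left_inv_eq_right_inv h1 h2)) x

/-- The adjoint coaction `ad(x) = x₍₂₎ ⊗ S(x₍₁₎) x₍₃₎`. -/
def ad (H : Type*) [Ring H] [HopfAlgebra ℂ H] : H →ₗ[ℂ] H ⊗[ℂ] H :=
  (LinearMap.mul' ℂ H ∘ₗ (antipode ℂ).rTensor H).lTensor H ∘ₗ
    (TensorProduct.leftComm ℂ H H H).toLinearMap ∘ₗ comul.lTensor H ∘ₗ comul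

/-- The restricted adjoint coaction `ad_π = (ι ⊗ π) ad`. -/
def adCoaction : H →ₗ[ℂ] H ⊗[ℂ] MonoidAlgebra ℂ Γ := π.lin.lTensor H ∘ₗ ad H

/-- The map `x ↦ x₍₂₎ ⊗ (π(x₍₁₎) ⊗ π(x₍₃₎))`, with value `x ⊗ (a ⊗ b)` on `H_{a,b}`. -/
def biCoaction : H →ₗ[ℂ] H ⊗[ℂ] (MonoidAlgebra ℂ Γ ⊗[ℂ] MonoidAlgebra ℂ Γ) :=
  (TensorProduct.leftComm ℂ (MonoidAlgebra ℂ Γ) H (MonoidAlgebra ℂ Γ)).toLinearMap ∘ₗ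
    π.rightCoaction.lTensor _ ∘ₗ π.leftCoaction

/-- The linear map `H → H` that multiplies each homogeneous component `H_{a,b}` by `φ(a,b)`. -/
def weight (φ : Γ → Γ → ℂ) : H →ₗ[ℂ] H :=
  (TensorProduct.rid ℂ H).toLinearMap ∘ₗ (biExt φ).lTensor H ∘ₗ π.biCoaction

variable {π}

theorem biCoaction_of_mem {a b : Γ} {x : H} (hx : x ∈ π.homog a b) :
    π.biCoaction x = x ⊗ₜ (MonoidAlgebra.single a 1 ⊗ₜ MonoidAlgebra.single b 1) := by
  rw [biCoaction, LinearMap.comp_apply, LinearMap.comp_apply, hx.1, LinearMap.lTensor_tmul, hx.2]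
  simp

theorem weight_of_mem {φ : Γ → Γ → ℂ} {a b : Γ} {x : H} (hx : x ∈ π.homog a b) :
    π.weight φ x = φ a b • x := by
  simp [weight, biCoaction_of_mem hx]

theorem adCoaction_eq (x : H) : π.adCoaction x =
    (LinearMap.mul' ℂ (MonoidAlgebra ℂ Γ) ∘ₗ (antipode ℂ).rTensor _).lTensor H
      (π.biCoaction x) := by
  have key : ∀ t : H ⊗[ℂ] (H ⊗[ℂ] H),
      π.lin.lTensor H ((LinearMap.mul' ℂ H ∘ₗ (antipode ℂ).rTensor H).lTensor H
        (TensorProduct.leftComm ℂ H H H t)) =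
      (LinearMap.mul' ℂ (MonoidAlgebra ℂ Γ) ∘ₗ (antipode ℂ).rTensor _).lTensor H
        (TensorProduct.leftComm ℂ (MonoidAlgebra ℂ Γ) H (MonoidAlgebra ℂ Γ)
          (TensorProduct.map π.lin (π.lin.lTensor H) t)) := by
    intro t
    induction t with
    | zero => simp
    | add s t hs ht => simp only [map_add, hs, ht]
    | tmul x t =>
      induction t with
      | zero => simp
      | add s t hs ht => simp only [TensorProduct.tmul_add, map_add, hs, ht]
      | tmul y z => simp [lin_mul, lin_antipode]
  have h2 : ∀ t : H ⊗[ℂ] H, TensorProduct.map π.lin (π.lin.lTensor H) (comul.lTensor H t) =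
      π.rightCoaction.lTensor _ (π.lin.rTensor H t) := by
    intro t
    induction t with
    | zero => simp
    | add s t hs ht => simp only [map_add, hs, ht]
    | tmul x t => simp [rightCoaction]
  simp only [adCoaction, ad, biCoaction, LinearMap.comp_apply, leftCoaction, LinearEquiv.coe_coe]
  rw [key, h2]

theorem adCoaction_of_mem {a b : Γ} {x : H} (hx : x ∈ π.homog a b) :
    π.adCoaction x = x ⊗ₜ MonoidAlgebra.single (a⁻¹ * b) 1 := by
  rw [adCoaction_eq, biCoaction_of_mem hx]
  simp [MonoidAlgebra.single_mul_single]

theorem mul_mem {a b c d : Γ} {x y : H} (hx : x ∈ π.homog a b) (hy : y ∈ π.homog c d) :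
    x * y ∈ π.homog (a * c) (b * d) := by
  have h1 : ∀ s t : H ⊗[ℂ] H, π.lin.rTensor H (s * t) = π.lin.rTensor H s * π.lin.rTensor H t :=
    map_mul (Algebra.TensorProduct.map (π.toBialgHom : H →ₐ[ℂ] MonoidAlgebra ℂ Γ) (.id ℂ H))
  have h2 : ∀ s t : H ⊗[ℂ] H, π.lin.lTensor H (s * t) = π.lin.lTensor H s * π.lin.lTensor H t :=
    map_mul (Algebra.TensorProduct.map (.id ℂ H) (π.toBialgHom : H →ₐ[ℂ] MonoidAlgebra ℂ Γ))
  have hx1 : π.lin.rTensor H (comul x) = _ := hx.1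
  have hx2 : π.lin.lTensor H (comul x) = _ := hx.2
  have hy1 : π.lin.rTensor H (comul y) = _ := hy.1
  have hy2 : π.lin.lTensor H (comul y) = _ := hy.2
  constructor
  · rw [leftCoaction, LinearMap.comp_apply, Bialgebra.comul_mul, h1, hx1, hy1]
    simp [MonoidAlgebra.single_mul_single]
  · rw [rightCoaction, LinearMap.comp_apply, Bialgebra.comul_mul, h2, hx2, hy2]
    simp [MonoidAlgebra.single_mul_single]

theorem one_mem : (1 : H) ∈ π.homog 1 1 := by
  constructor
  · simp [leftCoaction, Algebra.TensorProduct.one_def, lin_one, MonoidAlgebra.one_def]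
  · simp [rightCoaction, Algebra.TensorProduct.one_def, lin_one, MonoidAlgebra.one_def]

theorem star_mem [HopfStarAlgebra H] {a b : Γ} {x : H} (hx : x ∈ π.homog a b) :
    star x ∈ π.homog a⁻¹ b⁻¹ := by
  have h1 : ∀ t : H ⊗[ℂ] H, π.lin.rTensor H (star t) = star (π.lin.rTensor H t) := by
    intro t
    induction t with
    | zero => simp
    | add s t hs ht => simp only [star_add, map_add, hs, ht]
    | tmul x t => simp [lin_star]
  have h2 : ∀ t : H ⊗[ℂ] H, π.lin.lTensor H (star t) = star (π.lin.lTensor H t) := by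
    intro t
    induction t with
    | zero => simp
    | add s t hs ht => simp only [star_add, map_add, hs, ht]
    | tmul x t => simp [lin_star]
  have hx1 : π.lin.rTensor H (comul x) = _ := hx.1
  have hx2 : π.lin.lTensor H (comul x) = _ := hx.2
  constructor
  · rw [leftCoaction, LinearMap.comp_apply, HopfStarAlgebra.comul_star, h1, hx1]
    simp [MonoidAlgebra.star_single']
  · rw [rightCoaction, LinearMap.comp_apply, HopfStarAlgebra.comul_star, h2, hx2]
    simp [MonoidAlgebra.star_single']

variable (π)

/-- The component of an element of left degree `a`. -/
def leftPart (a : Γ) : H →ₗ[ℂ] H :=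
  (TensorProduct.lid ℂ H).toLinearMap ∘ₗ (coef a).rTensor H ∘ₗ π.leftCoaction

/-- The component of an element of right degree `b`. -/
def rightPart (b : Γ) : H →ₗ[ℂ] H :=
  (TensorProduct.rid ℂ H).toLinearMap ∘ₗ (coef b).lTensor H ∘ₗ π.rightCoaction

theorem exists_sum_leftPart (x : H) : ∃ s : Finset Γ, ∑ a ∈ s, π.leftPart a x = x := by
  classical
  have key : ∀ t : MonoidAlgebra ℂ Γ ⊗[ℂ] H, ∃ s : Finset Γ, ∀ s', s ⊆ s' →
      ∑ a ∈ s', TensorProduct.lid ℂ H ((coef a).rTensor H t) =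
        TensorProduct.lid ℂ H ((counit (R := ℂ)).rTensor H t) := by
    intro t
    induction t with
    | zero => exact ⟨∅, fun s' _ => by simp⟩
    | add x y hx hy =>
      obtain ⟨s, hs⟩ := hx
      obtain ⟨t, ht⟩ := hy
      refine ⟨s ∪ t, fun s' h => ?_⟩
      rw [map_add, map_add, ← hs s' (Finset.union_subset_left h),
        ← ht s' (Finset.union_subset_right h), ← Finset.sum_add_distrib]
      exact Finset.sum_congr rfl fun a _ => by rw [map_add, map_add]
    | tmul k h =>
      obtain ⟨s, hs⟩ := exists_sum_coef k
      refine ⟨s, fun s' h' => ?_⟩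
      simp only [LinearMap.rTensor_tmul, TensorProduct.lid_tmul, ← Finset.sum_smul, hs s' h']
  obtain ⟨s, hs⟩ := key (π.leftCoaction x)
  refine ⟨s, (hs s subset_rfl).trans ?_⟩
  have : ∀ t : H ⊗[ℂ] H, (counit (R := ℂ)).rTensor H (π.lin.rTensor H t) =
      (counit (R := ℂ)).rTensor H t := by
    intro t
    induction t with
    | zero => simp
    | add s t hs ht => simp only [map_add, hs, ht]
    | tmul x t => simp [counit_lin]
  rw [leftCoaction, LinearMap.comp_apply, this, Coalgebra.rTensor_counit_comul]
  simp

theorem exists_sum_rightPart (x : H) : ∃ s : Finset Γ, ∑ a ∈ s, π.rightPart a x = x := by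
  classical
  have key : ∀ t : H ⊗[ℂ] MonoidAlgebra ℂ Γ, ∃ s : Finset Γ, ∀ s', s ⊆ s' →
      ∑ a ∈ s', TensorProduct.rid ℂ H ((coef a).lTensor H t) =
        TensorProduct.rid ℂ H ((counit (R := ℂ)).lTensor H t) := by
    intro t
    induction t with
    | zero => exact ⟨∅, fun s' _ => by simp⟩
    | add x y hx hy =>
      obtain ⟨s, hs⟩ := hx
      obtain ⟨t, ht⟩ := hy
      refine ⟨s ∪ t, fun s' h => ?_⟩
      rw [map_add, map_add, ← hs s' (Finset.union_subset_left h),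
        ← ht s' (Finset.union_subset_right h), ← Finset.sum_add_distrib]
      exact Finset.sum_congr rfl fun a _ => by rw [map_add, map_add]
    | tmul h k =>
      obtain ⟨s, hs⟩ := exists_sum_coef k
      refine ⟨s, fun s' h' => ?_⟩
      simp only [LinearMap.lTensor_tmul, TensorProduct.rid_tmul, ← Finset.sum_smul, hs s' h']
  obtain ⟨s, hs⟩ := key (π.rightCoaction x)
  refine ⟨s, (hs s subset_rfl).trans ?_⟩
  have : ∀ t : H ⊗[ℂ] H, (counit (R := ℂ)).lTensor H (π.lin.lTensor H t) =
      (counit (R := ℂ)).lTensor H t := by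
    intro t
    induction t with
    | zero => simp
    | add s t hs ht => simp only [map_add, hs, ht]
    | tmul x t => simp [counit_lin]
  rw [rightCoaction, LinearMap.comp_apply, this, Coalgebra.lTensor_counit_comul]
  simp

theorem leftCoaction_coassoc (x : H) : π.leftCoaction.lTensor _ (π.leftCoaction x) =
    TensorProduct.assoc ℂ _ _ _ ((comul (R := ℂ)).rTensor H (π.leftCoaction x)) := by
  have h1 : ∀ t : H ⊗[ℂ] H, π.leftCoaction.lTensor _ (π.lin.rTensor H t) =
      TensorProduct.map π.lin (π.lin.rTensor H) ((comul (R := ℂ)).lTensor H t) := by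
    intro t
    induction t with
    | zero => simp
    | add s t hs ht => simp only [map_add, hs, ht]
    | tmul x t => simp [leftCoaction]
  have h2 : ∀ t : H ⊗[ℂ] H, (comul (R := ℂ)).rTensor H (π.lin.rTensor H t) =
      (TensorProduct.map π.lin π.lin).rTensor H ((comul (R := ℂ)).rTensor H t) := by
    intro t
    induction t with
    | zero => simp
    | add s t hs ht => simp only [map_add, hs, ht]
    | tmul x t => simp [comul_lin]
  have h3 : ∀ t : (H ⊗[ℂ] H) ⊗[ℂ] H,
      TensorProduct.assoc ℂ _ _ _ ((TensorProduct.map π.lin π.lin).rTensor H t) =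
      TensorProduct.map π.lin (π.lin.rTensor H) (TensorProduct.assoc ℂ _ _ _ t) := fun t =>
    LinearMap.congr_fun (TensorProduct.ext_threefold (g := (TensorProduct.assoc ℂ _ _ _).toLinearMap
      ∘ₗ (TensorProduct.map π.lin π.lin).rTensor H)
      (h := TensorProduct.map π.lin (π.lin.rTensor H) ∘ₗ (TensorProduct.assoc ℂ _ _ _).toLinearMap)
      (fun x y z => by simp)) t
  have h4 : π.leftCoaction x = π.lin.rTensor H (comul x) := rfl
  rw [h4, h1, h2, h3, Coalgebra.coassoc_apply]

theorem rightCoaction_coassoc (x : H) : π.rightCoaction.rTensor _ (π.rightCoaction x) =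
    (TensorProduct.assoc ℂ _ _ _).symm ((comul (R := ℂ)).lTensor H (π.rightCoaction x)) := by
  have h1 : ∀ t : H ⊗[ℂ] H, π.rightCoaction.rTensor _ (π.lin.lTensor H t) =
      TensorProduct.map (π.lin.lTensor H) π.lin ((comul (R := ℂ)).rTensor H t) := by
    intro t
    induction t with
    | zero => simp
    | add s t hs ht => simp only [map_add, hs, ht]
    | tmul x t => simp [rightCoaction]
  have h2 : ∀ t : H ⊗[ℂ] H, (comul (R := ℂ)).lTensor H (π.lin.lTensor H t) =
      (TensorProduct.map π.lin π.lin).lTensor H ((comul (R := ℂ)).lTensor H t) := by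
    intro t
    induction t with
    | zero => simp
    | add s t hs ht => simp only [map_add, hs, ht]
    | tmul x t => simp [comul_lin]
  have h3 : ∀ t : (H ⊗[ℂ] H) ⊗[ℂ] H, (TensorProduct.assoc ℂ _ _ _).symm
      ((TensorProduct.map π.lin π.lin).lTensor H (TensorProduct.assoc ℂ _ _ _ t)) =
      TensorProduct.map (π.lin.lTensor H) π.lin t := fun t =>
    LinearMap.congr_fun (TensorProduct.ext_threefold
      (g := (TensorProduct.assoc ℂ _ _ _).symm.toLinearMap ∘ₗ
        (TensorProduct.map π.lin π.lin).lTensor H ∘ₗ (TensorProduct.assoc ℂ _ _ _).toLinearMap)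
      (h := TensorProduct.map (π.lin.lTensor H) π.lin) (fun x y z => by simp)) t
  have h4 : π.rightCoaction x = π.lin.lTensor H (comul x) := rfl
  rw [h4, h1, h2, ← Coalgebra.coassoc_apply, h3]

theorem leftCoaction_rightCoaction (x : H) : π.leftCoaction.rTensor _ (π.rightCoaction x) =
    (TensorProduct.assoc ℂ _ _ _).symm (π.rightCoaction.lTensor _ (π.leftCoaction x)) := by
  have h1 : ∀ t : H ⊗[ℂ] H, π.leftCoaction.rTensor _ (π.lin.lTensor H t) =
      TensorProduct.map (π.lin.rTensor H) π.lin ((comul (R := ℂ)).rTensor H t) := by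
    intro t
    induction t with
    | zero => simp
    | add s t hs ht => simp only [map_add, hs, ht]
    | tmul x t => simp [leftCoaction]
  have h2 : ∀ t : H ⊗[ℂ] H, π.rightCoaction.lTensor _ (π.lin.rTensor H t) =
      TensorProduct.map π.lin (π.lin.lTensor H) ((comul (R := ℂ)).lTensor H t) := by
    intro t
    induction t with
    | zero => simp
    | add s t hs ht => simp only [map_add, hs, ht]
    | tmul x t => simp [rightCoaction]
  have h3 : ∀ t : (H ⊗[ℂ] H) ⊗[ℂ] H, (TensorProduct.assoc ℂ _ _ _).symm
      (TensorProduct.map π.lin (π.lin.lTensor H) (TensorProduct.assoc ℂ _ _ _ t)) =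
      TensorProduct.map (π.lin.rTensor H) π.lin t := fun t =>
    LinearMap.congr_fun (TensorProduct.ext_threefold
      (g := (TensorProduct.assoc ℂ _ _ _).symm.toLinearMap ∘ₗ
        TensorProduct.map π.lin (π.lin.lTensor H) ∘ₗ (TensorProduct.assoc ℂ _ _ _).toLinearMap)
      (h := TensorProduct.map (π.lin.rTensor H) π.lin) (fun x y z => by simp)) t
  have h4 : π.rightCoaction x = π.lin.lTensor H (comul x) := rfl
  have h5 : π.leftCoaction x = π.lin.rTensor H (comul x) := rfl
  rw [h4, h5, h1, h2, ← Coalgebra.coassoc_apply, h3]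

theorem leftCoaction_leftPart (a : Γ) (x : H) :
    π.leftCoaction (π.leftPart a x) = MonoidAlgebra.single a 1 ⊗ₜ π.leftPart a x := by
  have h1 : ∀ t : MonoidAlgebra ℂ Γ ⊗[ℂ] H,
      π.leftCoaction (TensorProduct.lid ℂ H ((coef a).rTensor H t)) =
      TensorProduct.lid ℂ _ ((coef a).rTensor _ (π.leftCoaction.lTensor _ t)) := by
    intro t
    induction t with
    | zero => simp
    | add s t hs ht => simp only [map_add, hs, ht]
    | tmul x t => simp
  have h2 : ∀ t : MonoidAlgebra ℂ Γ ⊗[ℂ] H,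
      TensorProduct.lid ℂ _ ((coef a).rTensor _
        (TensorProduct.assoc ℂ _ _ _ ((comul (R := ℂ)).rTensor H t))) =
      MonoidAlgebra.single a 1 ⊗ₜ TensorProduct.lid ℂ H ((coef a).rTensor H t) := by
    intro t
    induction t with
    | zero => simp
    | add s t hs ht => simp only [map_add, hs, ht, TensorProduct.tmul_add]
    | tmul k h =>
      induction k using MonoidAlgebra.induction_linear with
      | zero => simp
      | add x y hx hy => simp only [TensorProduct.add_tmul, map_add, hx, hy, TensorProduct.tmul_add]
      | single g c =>
        have hc : (MonoidAlgebra.single g c : MonoidAlgebra ℂ Γ) = c • MonoidAlgebra.single g 1 := by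
          simp
        rw [hc]
        simp only [LinearMap.rTensor_tmul, map_smul, MonoidAlgebra.comul_single,
          CommSemiring.comul_apply, TensorProduct.map_tmul, MonoidAlgebra.lsingle_apply,
          TensorProduct.smul_tmul', TensorProduct.assoc_tmul, TensorProduct.lid_tmul,
          TensorProduct.tmul_smul]
        by_cases hg : g = a
        · rw [hg]
        · simp [coef_single, hg]
  have h3 : π.leftPart a x = TensorProduct.lid ℂ H ((coef a).rTensor H (π.leftCoaction x)) := rfl
  rw [h3, h1, leftCoaction_coassoc, h2]

theorem rightCoaction_rightPart (a : Γ) (x : H) :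
    π.rightCoaction (π.rightPart a x) = π.rightPart a x ⊗ₜ MonoidAlgebra.single a 1 := by
  have h1 : ∀ t : H ⊗[ℂ] MonoidAlgebra ℂ Γ,
      π.rightCoaction (TensorProduct.rid ℂ H ((coef a).lTensor H t)) =
      TensorProduct.rid ℂ _ ((coef a).lTensor _ (π.rightCoaction.rTensor _ t)) := by
    intro t
    induction t with
    | zero => simp
    | add s t hs ht => simp only [map_add, hs, ht]
    | tmul x t => simp
  have h2 : ∀ t : H ⊗[ℂ] MonoidAlgebra ℂ Γ,
      TensorProduct.rid ℂ _ ((coef a).lTensor _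
        ((TensorProduct.assoc ℂ _ _ _).symm ((comul (R := ℂ)).lTensor H t))) =
      TensorProduct.rid ℂ H ((coef a).lTensor H t) ⊗ₜ MonoidAlgebra.single a 1 := by
    intro t
    induction t with
    | zero => simp
    | add s t hs ht => simp only [map_add, hs, ht, TensorProduct.add_tmul]
    | tmul h k =>
      induction k using MonoidAlgebra.induction_linear with
      | zero => simp
      | add x y hx hy => simp only [TensorProduct.tmul_add, map_add, hx, hy, TensorProduct.add_tmul]
      | single g c =>
        have hc : (MonoidAlgebra.single g c : MonoidAlgebra ℂ Γ) = c • MonoidAlgebra.single g 1 := by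
          simp
        rw [hc]
        simp only [LinearMap.lTensor_tmul, MonoidAlgebra.comul_single,
          CommSemiring.comul_apply, TensorProduct.map_tmul, MonoidAlgebra.lsingle_apply,
          TensorProduct.smul_tmul', TensorProduct.assoc_symm_tmul, TensorProduct.rid_tmul,
          TensorProduct.tmul_smul]
        by_cases hg : g = a
        · rw [hg]
        · simp [coef_single, hg]
  have h3 : π.rightPart a x = TensorProduct.rid ℂ H ((coef a).lTensor H (π.rightCoaction x)) := rfl
  rw [h3, h1, rightCoaction_coassoc, h2]

theorem leftCoaction_rightPart (a b : Γ) (x : H)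
    (hx : π.leftCoaction x = MonoidAlgebra.single a 1 ⊗ₜ x) :
    π.leftCoaction (π.rightPart b x) = MonoidAlgebra.single a 1 ⊗ₜ π.rightPart b x := by
  have h1 : ∀ t : H ⊗[ℂ] MonoidAlgebra ℂ Γ,
      π.leftCoaction (TensorProduct.rid ℂ H ((coef b).lTensor H t)) =
      TensorProduct.rid ℂ _ ((coef b).lTensor _ (π.leftCoaction.rTensor _ t)) := by
    intro t
    induction t with
    | zero => simp
    | add s t hs ht => simp only [map_add, hs, ht]
    | tmul x t => simp
  have h2 : ∀ t : H ⊗[ℂ] MonoidAlgebra ℂ Γ, TensorProduct.rid ℂ _ ((coef b).lTensor _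
      ((TensorProduct.assoc ℂ _ _ _).symm ((MonoidAlgebra.single a 1 : MonoidAlgebra ℂ Γ) ⊗ₜ t))) =
      MonoidAlgebra.single a 1 ⊗ₜ TensorProduct.rid ℂ H ((coef b).lTensor H t) := by
    intro t
    induction t with
    | zero => simp
    | add s t hs ht => simp only [map_add, hs, ht, TensorProduct.tmul_add]
    | tmul x t => simp
  have h3 : π.rightPart b x = TensorProduct.rid ℂ H ((coef b).lTensor H (π.rightCoaction x)) := rfl
  rw [h3, h1, leftCoaction_rightCoaction, hx, LinearMap.lTensor_tmul, h2]

/-- Every element is a sum of homogeneous ones. -/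
theorem homog_induction {P : H → Prop} (h0 : P 0) (hadd : ∀ x y, P x → P y → P (x + y))
    (hh : ∀ a b, ∀ x ∈ π.homog a b, P x) (x : H) : P x := by
  have hsum : ∀ (s : Finset Γ) (f : Γ → H), (∀ a, P (f a)) → P (∑ a ∈ s, f a) := by
    classical
    intro s f hf
    induction s using Finset.induction_on with
    | empty => simpa using h0
    | insert a s ha hs => rw [Finset.sum_insert ha]; exact hadd _ _ (hf a) hs
  obtain ⟨s, hs⟩ := π.exists_sum_leftPart x
  rw [← hs]
  refine hsum _ _ fun a => ?_
  obtain ⟨t, ht⟩ := π.exists_sum_rightPart (π.leftPart a x)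
  rw [← ht]
  refine hsum _ _ fun b => hh a b _ ⟨?_, π.rightCoaction_rightPart b _⟩
  exact π.leftCoaction_rightPart a b _ (π.leftCoaction_leftPart a x)

end TorusMap

end Transmutation

section Transmutation

variable {H Γ : Type*} [Ring H] [StarRing H] [HopfAlgebra ℂ H] [CommGroup Γ]

namespace TorusMap

/-- The transmuted product
`x ⊗ y ↦ x ·_β y = β(x⁽²⁾, S(π(y₍₁₎))) x⁽¹⁾ y₍₂₎` with `x⁽¹⁾ ⊗ x⁽²⁾ = ad_π(x)`; on homogeneous elements
see `transMul_of_mem`. -/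
def transMul (π : TorusMap H Γ) (β : Γ →* Γ →* Circle) : H ⊗[ℂ] H →ₗ[ℂ] H :=
  LinearMap.mul' ℂ H ∘ₗ
    TensorProduct.map ((TensorProduct.rid ℂ H).toLinearMap ∘ₗ (bichar β).lTensor H)
      LinearMap.id ∘ₗ
    (TensorProduct.tensorTensorTensorAssoc ℂ H (MonoidAlgebra ℂ Γ) (MonoidAlgebra ℂ Γ)
      H).toLinearMap ∘ₗ
    TensorProduct.map π.adCoaction ((antipode ℂ).rTensor H ∘ₗ π.leftCoaction)

variable {π : TorusMap H Γ} {β : Γ →* Γ →* Circle}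

/-- `x ·_β y = β(a⁻¹b, c⁻¹) xy` for `x ∈ H_{a,b}`, `y ∈ H_{c,d}`. -/
theorem transMul_of_mem {a b c d : Γ} {x y : H} (hx : x ∈ π.homog a b) (hy : y ∈ π.homog c d) :
    π.transMul β (x ⊗ₜ y) = (β (a⁻¹ * b) c⁻¹ : ℂ) • (x * y) := by
  simp [transMul, adCoaction_of_mem hx, hy.1, bichar]

theorem transMul_mem {a b c d : Γ} {x y : H} (hx : x ∈ π.homog a b) (hy : y ∈ π.homog c d) :
    π.transMul β (x ⊗ₜ y) ∈ π.homog (a * c) (b * d) := by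
  rw [transMul_of_mem hx hy]; exact Submodule.smul_mem _ _ (mul_mem hx hy)

theorem transMul_assoc (x y z : H) :
    π.transMul β (π.transMul β (x ⊗ₜ y) ⊗ₜ z) = π.transMul β (x ⊗ₜ π.transMul β (y ⊗ₜ z)) := by
  induction x using π.homog_induction with
  | h0 => simp
  | hadd x x' hx hx' => simp only [TensorProduct.add_tmul, map_add, hx, hx']
  | hh a b x hx =>
  induction y using π.homog_induction with
  | h0 => simp
  | hadd x x' hx hx' => simp only [TensorProduct.add_tmul, TensorProduct.tmul_add, map_add, hx, hx']
  | hh c d y hy =>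
  induction z using π.homog_induction with
  | h0 => simp
  | hadd x x' hx hx' => simp only [TensorProduct.tmul_add, map_add, hx, hx']
  | hh e f z hz =>
  rw [transMul_of_mem (transMul_mem hx hy) hz, transMul_of_mem hx (transMul_mem hy hz),
    transMul_of_mem hx hy, transMul_of_mem hy hz, smul_mul_assoc, mul_smul_comm, smul_smul,
    smul_smul, mul_assoc]
  congr 1
  simp only [map_mul, map_inv, MonoidHom.mul_apply, MonoidHom.inv_apply, mul_inv, Circle.coe_mul,
    Circle.coe_inv]
  ring

theorem transMul_one_left (x : H) : π.transMul β (1 ⊗ₜ x) = x := by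
  induction x using π.homog_induction with
  | h0 => simp
  | hadd x x' hx hx' => simp only [TensorProduct.tmul_add, map_add, hx, hx']
  | hh a b x hx => rw [transMul_of_mem one_mem hx]; simp

theorem transMul_one_right (x : H) : π.transMul β (x ⊗ₜ 1) = x := by
  induction x using π.homog_induction with
  | h0 => simp
  | hadd x x' hx hx' => simp only [TensorProduct.add_tmul, map_add, hx, hx']
  | hh a b x hx => rw [transMul_of_mem hx one_mem]; simp

variable (π β)

/-- The transmuted antipode, `S_β(x) = β(a⁻¹b, b) S(x)` for `x ∈ H_{a,b}`. -/
def transAntipode : H →ₗ[ℂ] H := antipode ℂ ∘ₗ π.weight fun a b => (β (a⁻¹ * b) b : ℂ)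

/-- The transmuted involution; on homogeneous elements see `transStar_of_mem`. -/
def transStar (x : H) : H := star (π.weight (fun a b => star (β (a⁻¹ * b) a⁻¹ : ℂ)) x)

variable {π β}

theorem transAntipode_of_mem {a b : Γ} {x : H} (hx : x ∈ π.homog a b) :
    π.transAntipode β x = (β (a⁻¹ * b) b : ℂ) • antipode ℂ x := by
  rw [transAntipode, LinearMap.comp_apply, weight_of_mem hx, map_smul]

theorem transStar_add (x y : H) : π.transStar β (x + y) = π.transStar β x + π.transStar β y := by
  rw [transStar, map_add, star_add]; rfl

variable [HopfStarAlgebra H]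

/-- `x^{*_β} = β(a⁻¹b, a⁻¹) x*` for `x ∈ H_{a,b}`. -/
theorem transStar_of_mem {a b : Γ} {x : H} (hx : x ∈ π.homog a b) :
    π.transStar β x = (β (a⁻¹ * b) a⁻¹ : ℂ) • star x := by
  rw [transStar, weight_of_mem hx, star_smul, star_star]

theorem transStar_mem {a b : Γ} {x : H} (hx : x ∈ π.homog a b) :
    π.transStar β x ∈ π.homog a⁻¹ b⁻¹ := by
  rw [transStar_of_mem hx]; exact Submodule.smul_mem _ _ (star_mem hx)

theorem transStar_smul (c : ℂ) (x : H) : π.transStar β (c • x) = star c • π.transStar β x := by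
  rw [transStar, map_smul, star_smul]; rfl

theorem transStar_transStar (x : H) : π.transStar β (π.transStar β x) = x := by
  induction x using π.homog_induction with
  | h0 => simp [transStar]
  | hadd x x' hx hx' => rw [transStar_add, transStar_add, hx, hx']
  | hh a b x hx =>
    rw [transStar_of_mem (transStar_mem hx), transStar_of_mem hx, star_smul, star_star, smul_smul]
    have h : ((β (a⁻¹⁻¹ * b⁻¹) a⁻¹⁻¹ : ℂ)) = (β (a⁻¹ * b) a⁻¹ : ℂ) := by
      simp [mul_comm]
    rw [h, Complex.star_def, Complex.mul_conj, Circle.normSq_coe, Complex.ofReal_one, one_smul]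

theorem transStar_transMul (x y : H) : π.transStar β (π.transMul β (x ⊗ₜ y)) =
    π.transMul β (π.transStar β y ⊗ₜ π.transStar β x) := by
  induction x using π.homog_induction with
  | h0 => simp [transStar]
  | hadd x x' hx hx' =>
    simp only [TensorProduct.add_tmul, TensorProduct.tmul_add, map_add, transStar_add, hx, hx']
  | hh a b x hx =>
  induction y using π.homog_induction with
  | h0 => simp [transStar]
  | hadd x x' hx hx' =>
    simp only [TensorProduct.add_tmul, TensorProduct.tmul_add, map_add, transStar_add, hx, hx']
  | hh c d y hy =>
    rw [transMul_of_mem (transStar_mem hy) (transStar_mem hx),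
      transStar_of_mem (transMul_mem hx hy), transMul_of_mem hx hy, transStar_of_mem hx,
      transStar_of_mem hy, star_smul, star_mul, smul_mul_assoc, mul_smul_comm, smul_smul, smul_smul,
      smul_smul]
    congr 1
    rw [Complex.star_def, ← Circle.coe_inv_eq_conj]
    simp only [← Circle.coe_mul]
    congr 1
    simp only [map_mul, map_inv, MonoidHom.mul_apply, MonoidHom.inv_apply, mul_inv, inv_inv]
    apply Circle.ext
    simp only [Circle.coe_mul, Circle.coe_inv]
    field_simp

end TorusMap

/-- The transmutation `H_β` of a Hopf `*`-algebra `H` along `π : H → ℂΓ` and a bicharacter `β`: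
the vector space `H` with its coproduct and counit, the product `x ·_β y`, the antipode `S_β`, and
the involution `*_β`. -/
def Transmutation (_π : TorusMap H Γ) (_β : Γ →* Γ →* Circle) : Type _ := H

namespace Transmutation

variable (π : TorusMap H Γ) (β : Γ →* Γ →* Circle)

instance : AddCommGroup (Transmutation π β) := inferInstanceAs (AddCommGroup H)

instance : Module ℂ (Transmutation π β) := inferInstanceAs (Module ℂ H)

/-- The identity map, from `H` to `H_β`. -/
def of : H ≃ₗ[ℂ] Transmutation π β := LinearEquiv.refl ℂ H

instance : One (Transmutation π β) := ⟨of π β 1⟩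

instance : Mul (Transmutation π β) :=
  ⟨fun x y => of π β (π.transMul β ((of π β).symm x ⊗ₜ[ℂ] (of π β).symm y))⟩

theorem mul_def (x y : Transmutation π β) :
    x * y = of π β (π.transMul β ((of π β).symm x ⊗ₜ[ℂ] (of π β).symm y)) := rfl

instance : Ring (Transmutation π β) where
  __ := (inferInstance : AddCommGroup (Transmutation π β))
  mul_assoc := π.transMul_assoc
  one_mul := π.transMul_one_left
  mul_one := π.transMul_one_right
  zero_mul x := by rw [mul_def, map_zero, TensorProduct.zero_tmul, map_zero, map_zero]
  mul_zero x := by rw [mul_def, map_zero, TensorProduct.tmul_zero, map_zero, map_zero]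
  left_distrib x y z := by
    simp only [mul_def, map_add, TensorProduct.tmul_add]
  right_distrib x y z := by
    simp only [mul_def, map_add, TensorProduct.add_tmul]

instance : Algebra ℂ (Transmutation π β) :=
  Algebra.ofModule
    (fun c x y => by simp only [mul_def, map_smul, ← TensorProduct.smul_tmul'])
    (fun c x y => by simp only [mul_def, map_smul, TensorProduct.tmul_smul])

instance : Coalgebra ℂ (Transmutation π β) := inferInstanceAs (Coalgebra ℂ H)

instance [HopfStarAlgebra H] : StarRing (Transmutation π β) where
  star x := of π β (π.transStar β ((of π β).symm x))
  star_involutive := π.transStar_transStar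
  star_mul := π.transStar_transMul
  star_add := π.transStar_add

instance [HopfStarAlgebra H] : StarModule ℂ (Transmutation π β) where
  star_smul := π.transStar_smul

/-- The antipode of `H_β`. -/
def antipode : Transmutation π β →ₗ[ℂ] Transmutation π β :=
  (of π β).toLinearMap ∘ₗ π.transAntipode β ∘ₗ (of π β).symm.toLinearMap

/-- The coaction of `ℂΓ` on `H_β`, the restricted adjoint coaction of `H`. -/
def coaction : Transmutation π β →ₗ[ℂ] Transmutation π β ⊗[ℂ] MonoidAlgebra ℂ Γ :=
  (of π β).toLinearMap.rTensor (MonoidAlgebra ℂ Γ) ∘ₗ π.adCoaction ∘ₗ (of π β).symm.toLinearMap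

end Transmutation

end Transmutation

/-! ### Braided Hopf star-algebras and braided compact matrix quantum groups -/

section Braided

variable {Γ : Type*} [CommGroup Γ]

/-- The coaction on the tensor product of two `ℂΓ`-comodules,
`m ⊗ n ↦ (m⁽¹⁾ ⊗ n⁽¹⁾) ⊗ m⁽²⁾n⁽²⁾`. -/
def tensorCoaction {M N : Type*} [AddCommGroup M] [Module ℂ M] [AddCommGroup N] [Module ℂ N]
    (δM : M →ₗ[ℂ] M ⊗[ℂ] MonoidAlgebra ℂ Γ) (δN : N →ₗ[ℂ] N ⊗[ℂ] MonoidAlgebra ℂ Γ) :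
    M ⊗[ℂ] N →ₗ[ℂ] (M ⊗[ℂ] N) ⊗[ℂ] MonoidAlgebra ℂ Γ :=
  (LinearMap.mul' ℂ (MonoidAlgebra ℂ Γ)).lTensor (M ⊗[ℂ] N) ∘ₗ
    (TensorProduct.tensorTensorTensorComm ℂ M (MonoidAlgebra ℂ Γ) N
      (MonoidAlgebra ℂ Γ)).toLinearMap ∘ₗ
    TensorProduct.map δM δN

/-- The braiding of two `ℂΓ`-comodules, `m ⊗ n ↦ β(m⁽²⁾, n⁽²⁾) n⁽¹⁾ ⊗ m⁽¹⁾`. -/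
def braiding (β : Γ →* Γ →* Circle) {M N : Type*} [AddCommGroup M] [Module ℂ M] [AddCommGroup N]
    [Module ℂ N] (δM : M →ₗ[ℂ] M ⊗[ℂ] MonoidAlgebra ℂ Γ)
    (δN : N →ₗ[ℂ] N ⊗[ℂ] MonoidAlgebra ℂ Γ) : M ⊗[ℂ] N →ₗ[ℂ] N ⊗[ℂ] M :=
  (TensorProduct.rid ℂ (N ⊗[ℂ] M)).toLinearMap ∘ₗ
    TensorProduct.map (TensorProduct.comm ℂ M N).toLinearMap (bichar β) ∘ₗ
    (TensorProduct.tensorTensorTensorComm ℂ M (MonoidAlgebra ℂ Γ) N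
      (MonoidAlgebra ℂ Γ)).toLinearMap ∘ₗ
    TensorProduct.map δM δN

/-- The product of the braided tensor product `A ⊗_β B`,
`(a ⊗ b)(a' ⊗ b') = β(b⁽²⁾, a'⁽²⁾) aa'⁽¹⁾ ⊗ b⁽¹⁾b'`. -/
def braidedMul (β : Γ →* Γ →* Circle) {A B : Type*} [Ring A] [Algebra ℂ A] [Ring B] [Algebra ℂ B]
    (δA : A →ₗ[ℂ] A ⊗[ℂ] MonoidAlgebra ℂ Γ) (δB : B →ₗ[ℂ] B ⊗[ℂ] MonoidAlgebra ℂ Γ) :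
    (A ⊗[ℂ] B) ⊗[ℂ] (A ⊗[ℂ] B) →ₗ[ℂ] A ⊗[ℂ] B :=
  TensorProduct.map (LinearMap.mul' ℂ A) (LinearMap.mul' ℂ B) ∘ₗ
    (TensorProduct.tensorTensorTensorAssoc ℂ A A B B).symm.toLinearMap ∘ₗ
    ((braiding β δB δA).lTensor A).rTensor B ∘ₗ
    (TensorProduct.tensorTensorTensorAssoc ℂ A B A B).toLinearMap

/-- The involution of the braided tensor product `A ⊗_β B`,
`(a ⊗ b)* = (1 ⊗ b*)(a* ⊗ 1) = β(b⁽²⁾*, a⁽²⁾*) a⁽¹⁾* ⊗ b⁽¹⁾*`. -/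
def braidedStar (β : Γ →* Γ →* Circle) {A B : Type*} [Ring A] [StarRing A] [Algebra ℂ A]
    [StarModule ℂ A] [Ring B] [StarRing B] [Algebra ℂ B] [StarModule ℂ B]
    (δA : A →ₗ[ℂ] A ⊗[ℂ] MonoidAlgebra ℂ Γ) (δB : B →ₗ[ℂ] B ⊗[ℂ] MonoidAlgebra ℂ Γ)
    (x : A ⊗[ℂ] B) : A ⊗[ℂ] B :=
  braiding β δB δA (TensorProduct.comm ℂ A B (star x))

/-- `δ` makes the unital `*`-algebra `A` a right `ℂΓ`-comodule `*`-algebra: `δ` is a coaction and a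
unital `*`-homomorphism. -/
structure IsComoduleStarAlgebra {A : Type*} [Ring A] [StarRing A] [Algebra ℂ A] [StarModule ℂ A]
    (δ : A →ₗ[ℂ] A ⊗[ℂ] MonoidAlgebra ℂ Γ) : Prop where
  coassoc : ∀ a, TensorProduct.assoc ℂ _ _ _ (δ.rTensor (MonoidAlgebra ℂ Γ) (δ a)) =
    (comul (R := ℂ)).lTensor A (δ a)
  counit : ∀ a, (counit (R := ℂ)).lTensor A (δ a) = a ⊗ₜ[ℂ] (1 : ℂ)
  map_one : δ 1 = 1
  map_mul : ∀ a b, δ (a * b) = δ a * δ b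
  map_star : ∀ a, δ (star a) = star (δ a)

/-- Braided Hopf `*`-algebras, that is, Hopf `*`-algebras in the braided category of
`ℂΓ`-comodules with the braiding given by `β`. Here `A` is a unital `*`-algebra and a
(coassociative and counital) coalgebra, `δ` is the coaction of `ℂΓ` and `S` the antipode. -/
structure IsBraidedHopfStarAlgebra (β : Γ →* Γ →* Circle) {A : Type*} [Ring A] [StarRing A]
    [Algebra ℂ A] [StarModule ℂ A] [Coalgebra ℂ A] (δ : A →ₗ[ℂ] A ⊗[ℂ] MonoidAlgebra ℂ Γ)
    (S : A →ₗ[ℂ] A) : Prop extends IsComoduleStarAlgebra δ where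
  comul_equivariant : ∀ a, tensorCoaction δ δ (comul (R := ℂ) a) =
    (comul (R := ℂ)).rTensor (MonoidAlgebra ℂ Γ) (δ a)
  counit_equivariant : ∀ a, (Coalgebra.counit (R := ℂ)).rTensor (MonoidAlgebra ℂ Γ) (δ a) =
    Coalgebra.counit (R := ℂ) a ⊗ₜ[ℂ] (1 : MonoidAlgebra ℂ Γ)
  antipode_equivariant : ∀ a, δ (S a) = S.rTensor (MonoidAlgebra ℂ Γ) (δ a)
  comul_one : comul (R := ℂ) (1 : A) = 1 ⊗ₜ[ℂ] 1
  comul_mul : ∀ a b : A, comul (R := ℂ) (a * b) =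
    braidedMul β δ δ (comul (R := ℂ) a ⊗ₜ[ℂ] comul (R := ℂ) b)
  comul_star : ∀ a : A, comul (R := ℂ) (star a) = braidedStar β δ δ (comul (R := ℂ) a)
  counit_one : Coalgebra.counit (R := ℂ) (1 : A) = 1
  counit_mul : ∀ a b : A, Coalgebra.counit (R := ℂ) (a * b) =
    Coalgebra.counit (R := ℂ) a * Coalgebra.counit (R := ℂ) b
  counit_star : ∀ a : A, Coalgebra.counit (R := ℂ) (star a) = star (Coalgebra.counit (R := ℂ) a)
  antipode_left : ∀ a : A, LinearMap.mul' ℂ A (S.rTensor A (comul (R := ℂ) a)) =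
    algebraMap ℂ A (Coalgebra.counit (R := ℂ) a)
  antipode_right : ∀ a : A, LinearMap.mul' ℂ A (S.lTensor A (comul (R := ℂ) a)) =
    algebraMap ℂ A (Coalgebra.counit (R := ℂ) a)

variable {m : ℕ}

/-- A corepresentation matrix for a coalgebra: `Δ(u_ij) = ∑ₖ u_ik ⊗ u_kj`, `ε(u_ij) = δ_ij`. -/
structure IsCorepMat {C : Type*} [AddCommGroup C] [Module ℂ C] [Coalgebra ℂ C]
    (U : Matrix (Fin m) (Fin m) C) : Prop where
  comul : ∀ i j, Coalgebra.comul (R := ℂ) (U i j) = ∑ k, U i k ⊗ₜ[ℂ] U k j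
  counit : ∀ i j, Coalgebra.counit (R := ℂ) (U i j) = (1 : Matrix (Fin m) (Fin m) ℂ) i j

/-- The map `δ_U : ℂᵐ → ℂᵐ ⊗ C`, `δ_U(e_j) = ∑ᵢ e_i ⊗ u_ij`. -/
def coactionOfMat {C : Type*} [AddCommGroup C] [Module ℂ C] (U : Matrix (Fin m) (Fin m) C) :
    (Fin m → ℂ) →ₗ[ℂ] (Fin m → ℂ) ⊗[ℂ] C :=
  (Pi.basisFun ℂ (Fin m)).constr ℂ fun j => ∑ i, Pi.single i (1 : ℂ) ⊗ₜ[ℂ] U i j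

section

variable (β : Γ →* Γ →* Circle) {A : Type*} [Ring A] [StarRing A] [Algebra ℂ A] [StarModule ℂ A]
  [Coalgebra ℂ A] (δ : A →ₗ[ℂ] A ⊗[ℂ] MonoidAlgebra ℂ Γ)

/-- The pair `(Z, U)` defines a comodule over the braided Hopf `*`-algebra `A`: `Z` and `U` are
corepresentation matrices, and `δ_U` is a morphism of `ℂΓ`-comodules, i.e.
`(δ_U ⊗ ι) δ_Z = δ_{M ⊗ A} δ_U` where `M = ℂᵐ` carries the coaction `δ_Z`. -/
structure IsBraidedComodule (Z : Matrix (Fin m) (Fin m) (MonoidAlgebra ℂ Γ))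
    (U : Matrix (Fin m) (Fin m) A) : Prop where
  corep_left : IsCorepMat Z
  corep_right : IsCorepMat U
  equivariant : (coactionOfMat U).rTensor (MonoidAlgebra ℂ Γ) ∘ₗ coactionOfMat Z =
    tensorCoaction (coactionOfMat Z) δ ∘ₗ coactionOfMat U

/-- The corepresentation matrix `Z # U = (∑ₖ z_ik # u_kj)` of the bosonization
`ℂΓ # A = ℂΓ ⊗_β A`. -/
def smashMat (Z : Matrix (Fin m) (Fin m) (MonoidAlgebra ℂ Γ)) (U : Matrix (Fin m) (Fin m) A) :
    Matrix (Fin m) (Fin m) (MonoidAlgebra ℂ Γ ⊗[ℂ] A) :=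
  Matrix.of fun i j => ∑ k, Z i k ⊗ₜ[ℂ] U k j

/-- The pair `(Z, U)` defines a unitary comodule (with respect to the standard scalar product of
`ℂᵐ`): the matrix `W = Z # U` of the corresponding comodule over the bosonization is unitary, where
the bosonization `ℂΓ # A = ℂΓ ⊗_β A` has the product and the involution of the braided tensor
product, `ℂΓ` coacting on itself by its coproduct. -/
structure IsUnitaryBraidedComodule (Z : Matrix (Fin m) (Fin m) (MonoidAlgebra ℂ Γ))
    (U : Matrix (Fin m) (Fin m) A) : Prop extends IsBraidedComodule δ Z U where
  unitary_left : ∀ i j, ∑ k, braidedMul β comul δ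
      (braidedStar β comul δ (smashMat Z U k i) ⊗ₜ[ℂ] smashMat Z U k j) =
    if i = j then 1 ⊗ₜ[ℂ] 1 else 0
  unitary_right : ∀ i j, ∑ k, braidedMul β comul δ
      (smashMat Z U i k ⊗ₜ[ℂ] braidedStar β comul δ (smashMat Z U j k)) =
    if i = j then 1 ⊗ₜ[ℂ] 1 else 0

/-- The braided conjugate matrix `Ū_Z`, with entries `∑_{s,l,t} β(z_tj* z_sl, z_il*) u_st*`. -/
def braidedConj {B : Type*} [Ring B] [StarRing B] [Algebra ℂ B]
    (Z : Matrix (Fin m) (Fin m) (MonoidAlgebra ℂ Γ)) (U : Matrix (Fin m) (Fin m) B) :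
    Matrix (Fin m) (Fin m) B :=
  Matrix.of fun i j => ∑ s, ∑ l, ∑ t,
    bichar β ((star (Z t j) * Z s l) ⊗ₜ[ℂ] star (Z i l)) • star (U s t)

/-- The braided Hopf `*`-algebra `A`, with coaction `δ` and antipode `S`, is a braided compact
matrix quantum group over `(T, Z, β)` with fundamental unitary `U`, where `Γ` is the dual
of `T`. -/
structure IsBraidedCMQG (S : A →ₗ[ℂ] A) (Z : Matrix (Fin m) (Fin m) (MonoidAlgebra ℂ Γ))
    (U : Matrix (Fin m) (Fin m) A) : Prop where
  corep : IsCorepMat Z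
  unitary : IsUnitaryMat Z
  hopf : IsBraidedHopfStarAlgebra β δ S
  generates : StarAlgebra.adjoin ℂ {u : A | ∃ i j, u = U i j} = ⊤
  /-- `(Z, U)` defines a unitary comodule. -/
  fundamental : IsUnitaryBraidedComodule β δ Z U
  /-- `(Z̄, Ū_Z)` defines a unitarizable comodule: it becomes unitary after a change of basis. -/
  conjugate : IsBraidedComodule δ (conjMat Z) (braidedConj β Z U) ∧
    ∃ G : GL (Fin m) ℂ, IsUnitaryBraidedComodule β δ (conjugateBy G (conjMat Z))
      (conjugateBy G (braidedConj β Z U))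

end

/-- The relations of the braided free orthogonal quantum group, for a matrix `U` over a unital
`*`-algebra: `U` is unitary and `U = F Ū_Z F⁻¹`. -/
def IsBraidedOrthogonal (F : GL (Fin m) ℂ) (β : Γ →* Γ →* Circle)
    (Z : Matrix (Fin m) (Fin m) (MonoidAlgebra ℂ Γ)) {B : Type*} [Ring B] [StarRing B]
    [Algebra ℂ B] (U : Matrix (Fin m) (Fin m) B) : Prop :=
  IsUnitaryMat U ∧ U = conjugateBy F (braidedConj β Z U)

end Braided

namespace FreeOrth

variable {m : ℕ} (F : GL (Fin m) ℂ)

instance : HopfStarAlgebra (FreeOrth F) where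
  comul_star x := by
    induction x using FreeOrth.induction with
    | h1 c =>
      rw [← algebraMap_star_comm, Bialgebra.comul_algebraMap, Bialgebra.comul_algebraMap,
        Algebra.TensorProduct.algebraMap_apply, Algebra.TensorProduct.algebraMap_apply,
        TensorProduct.star_tmul, star_one, algebraMap_star_comm]
    | h2 i j => rw [comul_star_fund, comul_fund, star_sum]; rfl
    | h2' i j => rw [star_star, comul_star_fund, comul_fund, star_sum]; simp
    | h3 a b ha hb => rw [star_mul, Bialgebra.comul_mul, Bialgebra.comul_mul, ha, hb, star_mul]
    | h4 a b ha hb => rw [star_add, map_add, map_add, ha, hb, star_add]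

variable {F} {Γ : Type*} [CommGroup Γ]

theorem groupAlg_comul_star (x : MonoidAlgebra ℂ Γ) :
    comul (R := ℂ) (star x) = star (comul (R := ℂ) x) := by
  induction x using MonoidAlgebra.induction_linear with
  | zero => simp
  | add x y hx hy => simp only [star_add, map_add, hx, hy]
  | single g c =>
    rw [MonoidAlgebra.star_single', MonoidAlgebra.comul_single, MonoidAlgebra.comul_single]
    simp [MonoidAlgebra.star_single']

theorem groupAlg_counit_star (x : MonoidAlgebra ℂ Γ) :
    counit (R := ℂ) (star x) = star (counit (R := ℂ) x) := by
  induction x using MonoidAlgebra.induction_linear with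
  | zero => simp
  | add x y hx hy => simp only [star_add, map_add, hx, hy]
  | single g c => simp [MonoidAlgebra.star_single']

/-- The Hopf `*`-algebra map `π : ℂ[O_F⁺] → ℂΓ` with `π(u_ij) = z_ij`, for a unitary
corepresentation matrix `Z` such that `F Z̄ F⁻¹ = Z`. -/
def toTorus (Z : Matrix (Fin m) (Fin m) (MonoidAlgebra ℂ Γ)) (hZ : IsCorepMat Z)
    (hu : IsUnitaryMat Z) (hF : conjugateBy F (conjMat Z) = Z) : TorusMap (FreeOrth F) Γ where
  toBialgHom := BialgHom.ofAlgHom (lift Z (conjMat Z) (IsPair.of_unitary hu hF.symm))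
    (by
      apply algHom_ext <;> intro i j
      · simp [hZ.counit, counit_fund]
      · simp [conjMat, groupAlg_counit_star, hZ.counit, counit_star_fund, Matrix.one_apply,
          apply_ite (star : ℂ → ℂ)])
    (by
      apply algHom_ext <;> intro i j
      · simp [comul_fund, hZ.comul]
      · simp [comul_star_fund, conjMat, groupAlg_comul_star, hZ.comul])
  map_star x := by
    change lift Z (conjMat Z) (IsPair.of_unitary hu hF.symm) (star x) =
      star (lift Z (conjMat Z) (IsPair.of_unitary hu hF.symm) x)
    induction x using FreeOrth.induction with
    | h1 c => rw [← algebraMap_star_comm, AlgHom.commutes, AlgHom.commutes, algebraMap_star_comm]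
    | h2 i j => rw [lift_star_fund, lift_fund]; rfl
    | h2' i j => rw [star_star, lift_star_fund, lift_fund, conjMat, Matrix.map_apply, star_star]
    | h3 a b ha hb => rw [star_mul, map_mul, map_mul, star_mul, ha, hb]
    | h4 a b ha hb => rw [star_add, map_add, map_add, star_add, ha, hb]

theorem toTorus_fund (Z : Matrix (Fin m) (Fin m) (MonoidAlgebra ℂ Γ)) (hZ : IsCorepMat Z)
    (hu : IsUnitaryMat Z) (hF : conjugateBy F (conjMat Z) = Z) (i j : Fin m) :
    (toTorus Z hZ hu hF).lin (fund F i j) = Z i j :=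
  lift_fund (IsPair.of_unitary hu hF.symm) i j

end FreeOrth

end

noncomputable section

open scoped TensorProduct
open Coalgebra HopfAlgebra

/-! ### Braided Hopf structure of the transmutation -/

section TransmutationHopf

variable {H Γ : Type*} [Ring H] [StarRing H] [HopfAlgebra ℂ H] [CommGroup Γ]

namespace TorusMap

/-! Write Γ for the dual group of T and H for ℂ[O_F⁺]. The map π grades H by Γ × Γ, and on
homogeneous elements the product, involution and antipode of H_β differ from those of H by values of
β at the degrees alone. Almost every claim therefore reduces to a fact about H and an identity
between values of a bicharacter.

The grading is made concrete by expanding Z = ∑ p_a ⊗ a. Since Z is a unitary corepresentation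
matrix, the p_a are self-adjoint orthogonal idempotents with sum 1 (`spectralProj_mul`,
`sum_spectralProj`, `spectralProj_conjTranspose`), and the entries of p_a U p_b lie in H_{a,b}
(`isotypic_mem_homog`). On these components Δ takes values in the sum of the H_{a,c} ⊗ H_{c,b}, and
S in H_{b⁻¹,a⁻¹}. Both properties pass to products, and the entries of U generate H because Ū =
F⁻¹UF, so H is spanned by elements with both properties (`iSup_bihomog`). On them the braided Hopf
axioms are checked scalar by scalar (`isBraidedHopfStarAlgebra`).

Unitarity over the bosonization is inherited from H: the left coaction, x ↦ a ⊗ x on H_{a,b}, is a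
unital *-homomorphism from H to ℂΓ # H_β and carries U to Z # U. The coefficients of Ū_Z are chosen
to cancel the scalars of *_β, so that over H_β the matrix Ū_Z consists of the original elements
u_ij* (`braidedConj_transFund`). Hence U = FŪ_ZF⁻¹ is the old relation, and conjugation by F takes
the pair (Z̄, Ū_Z) to (Z, U), which is unitary.

For the universal property the twist is undone. Operators λ_{a,b} on functions Γ → B multiply with
the scalar β(a⁻¹b, c), the inverse of the one in the transmuted product. If V satisfies the braided
relations, then ∑ p_a V p_b λ_{a,b} satisfies the ordinary relations of ℂ[O_F⁺] (`isPair_untwist`);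
here F F̄ = ±1 is used. The resulting homomorphism has the form f(x)λ_{a,b} on H_{a,b}
(`iSup_untwistLift`), and f is the required map on H_β. Uniqueness holds because the entries of U
generate H_β (`adjoin_transFund`). -/

/-- The elements of `H_{a,b}` whose antipode lies in `H_{b⁻¹,a⁻¹}`. -/
def antihomog (π : TorusMap H Γ) (a b : Γ) : Submodule ℂ H :=
  π.homog a b ⊓ (π.homog b⁻¹ a⁻¹).comap (antipode ℂ)

/-- The span of the tensors `y ⊗ z` with `y ∈ H_{a,c}` and `z ∈ H_{c,b}` for some `c`, whose
antipodes are homogeneous. -/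
def homogTensor (π : TorusMap H Γ) (a b : Γ) : Submodule ℂ (H ⊗[ℂ] H) :=
  Submodule.span ℂ {t | ∃ c, ∃ y ∈ π.antihomog a c, ∃ z ∈ π.antihomog c b, t = y ⊗ₜ[ℂ] z}

/-- The elements of `H_{a,b}` whose coproduct and antipode are homogeneous. -/
def bihomog (π : TorusMap H Γ) (a b : Γ) : Submodule ℂ H :=
  π.antihomog a b ⊓ (π.homogTensor a b).comap comul

variable {π : TorusMap H Γ} {β : Γ →* Γ →* Circle}

theorem homog_of_bihomog {a b : Γ} {x : H} (hx : x ∈ π.bihomog a b) : x ∈ π.homog a b := hx.1.1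

theorem comul_of_bihomog {a b : Γ} {x : H} (hx : x ∈ π.bihomog a b) :
    comul (R := ℂ) x ∈ π.homogTensor a b := hx.2

theorem antipode_of_bihomog {a b : Γ} {x : H} (hx : x ∈ π.bihomog a b) :
    antipode ℂ x ∈ π.homog b⁻¹ a⁻¹ := hx.1.2

/-- Two linear maps that agree on the tensors `y ⊗ z` spanning `homogTensor a b`
agree on `homogTensor a b`. -/
theorem eq_on_homogTensor {M : Type*} [AddCommGroup M] [Module ℂ M] {f g : H ⊗[ℂ] H →ₗ[ℂ] M}
    {a b : Γ} (h : ∀ c, ∀ y ∈ π.antihomog a c, ∀ z ∈ π.antihomog c b, f (y ⊗ₜ z) = g (y ⊗ₜ z))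
    {t : H ⊗[ℂ] H} (ht : t ∈ π.homogTensor a b) : f t = g t :=
  LinearMap.eqOn_span (R := ℂ) (f := f) (g := g)
    (by rintro _ ⟨c, y, hy, z, hz, rfl⟩; exact h c y hy z hz) ht

/-- If the `bihomog a b` span `H`, a property stable under sums can be checked on them. -/
theorem bihomog_induction (hH : ⨆ p : Γ × Γ, π.bihomog p.1 p.2 = ⊤) {P : H → Prop} (h0 : P 0)
    (hadd : ∀ x y, P x → P y → P (x + y)) (hh : ∀ a b, ∀ x ∈ π.bihomog a b, P x) (x : H) : P x :=
  Submodule.iSup_induction _ (motive := P) (hH ▸ Submodule.mem_top : x ∈ ⨆ p : Γ × Γ, _)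
    (fun p => hh p.1 p.2) h0 hadd

/-- Apply the counit to the `H` leg of δ_L(x) = a ⊗ x and of δ_R(x) = x ⊗ b; both left-hand sides
become π(x). -/
theorem lin_of_mem {a b : Γ} {x : H} (hx : x ∈ π.homog a b) :
    π.lin x = counit (R := ℂ) x • MonoidAlgebra.single a 1 ∧
      π.lin x = counit (R := ℂ) x • MonoidAlgebra.single b 1 := by
  have h1 : ∀ t : H ⊗[ℂ] H, TensorProduct.rid ℂ _ ((counit (R := ℂ)).lTensor _
      (π.lin.rTensor H t)) = π.lin (TensorProduct.rid ℂ _ ((counit (R := ℂ)).lTensor H t)) := by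
    intro t
    induction t with
    | zero => simp
    | add s t hs ht => simp only [map_add, hs, ht]
    | tmul x t => simp
  have h2 : ∀ t : H ⊗[ℂ] H, TensorProduct.lid ℂ _ ((counit (R := ℂ)).rTensor _
      (π.lin.lTensor H t)) = π.lin (TensorProduct.lid ℂ _ ((counit (R := ℂ)).rTensor H t)) := by
    intro t
    induction t with
    | zero => simp
    | add s t hs ht => simp only [map_add, hs, ht]
    | tmul x t => simp
  have hx1 : π.lin.rTensor H (comul x) = _ := hx.1
  have hx2 : π.lin.lTensor H (comul x) = _ := hx.2
  have e1 := h1 (comul x)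
  have e2 := h2 (comul x)
  rw [hx1, Coalgebra.lTensor_counit_comul] at e1
  rw [hx2, Coalgebra.rTensor_counit_comul] at e2
  constructor
  · simpa using e1.symm
  · simpa using e2.symm

/-- The counit vanishes off the diagonal. -/
theorem counit_eq_zero {a b : Γ} {x : H} (hx : x ∈ π.homog a b) (hab : a ≠ b) :
    counit (R := ℂ) x = 0 := by
  -- Here ε(x)a = π(x) = ε(x)b; the coefficient at a is ε(x) on the left and 0 on the right.
  have h := congrArg (coef a) ((lin_of_mem hx).1.symm.trans (lin_of_mem hx).2)
  simpa [coef_single, hab.symm] using h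

end TorusMap

namespace Transmutation

open TorusMap

variable {π : TorusMap H Γ} {β : Γ →* Γ →* Circle}

/-- The transmutation keeps the coalgebra of `H`, so `of ⊗ of` is the identity map. Writing it
explicitly lets coproducts computed in `H` be rewritten inside H_β. -/
theorem comul_of (x : H) : comul (R := ℂ) (of π β x) =
    TensorProduct.map (of π β).toLinearMap (of π β).toLinearMap (comul (R := ℂ) x) :=
  (LinearMap.congr_fun (TensorProduct.map_id (R := ℂ) (M := H) (N := H)) (comul x)).symm

theorem counit_of (x : H) : counit (R := ℂ) (of π β x) = counit (R := ℂ) x := rfl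

theorem of_mul {a b c d : Γ} {x y : H} (hx : x ∈ π.homog a b) (hy : y ∈ π.homog c d) :
    of π β x * of π β y = (β (a⁻¹ * b) c⁻¹ : ℂ) • of π β (x * y) := by
  rw [mul_def, LinearEquiv.symm_apply_apply, LinearEquiv.symm_apply_apply, transMul_of_mem hx hy,
    map_smul]

theorem coaction_of {a b : Γ} {x : H} (hx : x ∈ π.homog a b) :
    coaction π β (of π β x) = of π β x ⊗ₜ MonoidAlgebra.single (a⁻¹ * b) 1 := by
  simp [coaction, adCoaction_of_mem hx]

theorem antipode_of {a b : Γ} {x : H} (hx : x ∈ π.homog a b) :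
    antipode π β (of π β x) = (β (a⁻¹ * b) b : ℂ) • of π β (HopfAlgebra.antipode ℂ x) := by
  simp [antipode, transAntipode_of_mem hx]

theorem star_of [HopfStarAlgebra H] {a b : Γ} {x : H} (hx : x ∈ π.homog a b) :
    star (of π β x) = (β (a⁻¹ * b) a⁻¹ : ℂ) • of π β (star x) :=
  (congrArg (of π β) (transStar_of_mem hx)).trans (map_smul _ _ _)

theorem of_one : of π β 1 = 1 := rfl

/-- The degree is stated for the starred element because `braidedStar` applies the stars before the
braiding. -/
theorem coaction_star_of [HopfStarAlgebra H] {a b : Γ} {x : H} (hx : x ∈ π.homog a b) :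
    coaction π β (star (of π β x)) = star (of π β x) ⊗ₜ MonoidAlgebra.single (a * b⁻¹) 1 := by
  rw [star_of hx, map_smul, coaction_of (star_mem hx), inv_inv, TensorProduct.smul_tmul']

end Transmutation

/-! ### Braided tensor products on homogeneous elements -/

section BraidedTensor

variable {A B : Type*} [Ring A] [Algebra ℂ A] [Ring B] [Algebra ℂ B]
  {δA : A →ₗ[ℂ] A ⊗[ℂ] MonoidAlgebra ℂ Γ} {δB : B →ₗ[ℂ] B ⊗[ℂ] MonoidAlgebra ℂ Γ}

/-- Multiplication moves only `x'` past `y`, so the two outer factors need not be homogeneous. -/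
theorem braidedMul_tmul (β : Γ →* Γ →* Circle) {g h : Γ} (x : A) {y : B} {x' : A} (y' : B)
    (hy : δB y = y ⊗ₜ MonoidAlgebra.single g 1) (hx' : δA x' = x' ⊗ₜ MonoidAlgebra.single h 1) :
    braidedMul β δA δB ((x ⊗ₜ y) ⊗ₜ (x' ⊗ₜ y')) = (β g h : ℂ) • ((x * x') ⊗ₜ (y * y')) := by
  simp [braidedMul, braiding, hx', hy, bichar, TensorProduct.tmul_smul, TensorProduct.smul_tmul']

theorem braidedStar_tmul [StarRing A] [StarModule ℂ A] [StarRing B] [StarModule ℂ B]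
    (β : Γ →* Γ →* Circle) {g h : Γ} {x : A} {y : B}
    (hx : δA (star x) = star x ⊗ₜ MonoidAlgebra.single g 1)
    (hy : δB (star y) = star y ⊗ₜ MonoidAlgebra.single h 1) :
    braidedStar β δA δB (x ⊗ₜ y) = (β h g : ℂ) • (star x ⊗ₜ star y) := by
  simp [braidedStar, braiding, hx, hy, bichar]

/-- `braidedStar` is conjugate-linear and is a bare function, so this lemma and the next two replace
the generic lemmas for linear maps. -/
theorem braidedStar_add [StarRing A] [StarModule ℂ A] [StarRing B] [StarModule ℂ B]
    (β : Γ →* Γ →* Circle) (s t : A ⊗[ℂ] B) :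
    braidedStar β δA δB (s + t) = braidedStar β δA δB s + braidedStar β δA δB t := by
  simp only [braidedStar, star_add, map_add]

theorem braidedStar_smul [StarRing A] [StarModule ℂ A] [StarRing B] [StarModule ℂ B]
    (β : Γ →* Γ →* Circle) (c : ℂ) (t : A ⊗[ℂ] B) :
    braidedStar β δA δB (c • t) = star c • braidedStar β δA δB t := by
  simp only [braidedStar, star_smul, map_smul]

theorem braidedStar_zero [StarRing A] [StarModule ℂ A] [StarRing B] [StarModule ℂ B]
    (β : Γ →* Γ →* Circle) : braidedStar β δA δB 0 = 0 := by
  simp only [braidedStar, star_zero, map_zero]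

theorem tensorCoaction_tmul {M N : Type*} [AddCommGroup M] [Module ℂ M] [AddCommGroup N]
    [Module ℂ N] {δM : M →ₗ[ℂ] M ⊗[ℂ] MonoidAlgebra ℂ Γ} {δN : N →ₗ[ℂ] N ⊗[ℂ] MonoidAlgebra ℂ Γ}
    {g h : Γ} {x : M} {y : N} (hx : δM x = x ⊗ₜ MonoidAlgebra.single g 1)
    (hy : δN y = y ⊗ₜ MonoidAlgebra.single h 1) :
    tensorCoaction δM δN (x ⊗ₜ y) = (x ⊗ₜ y) ⊗ₜ MonoidAlgebra.single (g * h) 1 := by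
  simp [tensorCoaction, hx, hy, MonoidAlgebra.single_mul_single]

end BraidedTensor

/-! ### The braided Hopf *-algebra axioms for the transmutation -/

namespace Transmutation

open TorusMap

variable {π : TorusMap H Γ} {β : Γ →* Γ →* Circle}

/-- The restricted adjoint coaction makes `H_β` a comodule `*`-algebra. -/
theorem isComoduleStarAlgebra [HopfStarAlgebra H] :
    IsComoduleStarAlgebra (coaction π β) where
  coassoc x := by
    obtain ⟨x, rfl⟩ := (of π β).surjective x
    induction x using π.homog_induction with
    | h0 => simp
    | hadd x y hx hy => simp only [map_add, hx, hy]
    | hh a b x hx => simp [coaction_of hx]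
  counit x := by
    obtain ⟨x, rfl⟩ := (of π β).surjective x
    induction x using π.homog_induction with
    | h0 => simp
    | hadd x y hx hy => simp only [map_add, hx, hy, TensorProduct.add_tmul]
    | hh a b x hx => simp [coaction_of hx]
  map_one := by
    rw [← of_one, coaction_of one_mem, inv_one, mul_one]
    rfl
  map_mul x y := by
    obtain ⟨x, rfl⟩ := (of π β).surjective x
    obtain ⟨y, rfl⟩ := (of π β).surjective y
    induction x using π.homog_induction with
    | h0 => simp
    | hadd x x' hx hx' => simp only [map_add, hx, hx', add_mul]
    | hh a b x hx =>
    induction y using π.homog_induction with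
    | h0 => simp
    | hadd x x' hx hx' => simp only [map_add, hx, hx', mul_add]
    | hh c d y hy =>
    rw [of_mul hx hy, map_smul, coaction_of (mul_mem hx hy), coaction_of hx, coaction_of hy,
      Algebra.TensorProduct.tmul_mul_tmul, of_mul hx hy, TensorProduct.smul_tmul',
      MonoidAlgebra.single_mul_single, mul_one, mul_inv, mul_mul_mul_comm]
  map_star x := by
    obtain ⟨x, rfl⟩ := (of π β).surjective x
    induction x using π.homog_induction with
    | h0 => simp
    | hadd x y hx hy => simp only [map_add, hx, hy, star_add]
    | hh a b x hx =>
    rw [coaction_star_of hx, coaction_of hx, TensorProduct.star_tmul, MonoidAlgebra.star_single',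
      star_one, mul_inv, inv_inv]

/-- A Hopf `*`-algebra spanned by its bihomogeneous elements transmutes to a braided Hopf
`*`-algebra. -/
theorem isBraidedHopfStarAlgebra [HopfStarAlgebra H]
    (hH : ⨆ p : Γ × Γ, π.bihomog p.1 p.2 = ⊤)
    (hε : ∀ x : H, counit (R := ℂ) (star x) = star (counit (R := ℂ) x)) :
    IsBraidedHopfStarAlgebra β (coaction π β) (antipode π β) where
  __ := isComoduleStarAlgebra
  comul_equivariant x := by
    obtain ⟨x, rfl⟩ := (of π β).surjective x
    induction x using bihomog_induction hH with
    | h0 => simp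
    | hadd x y hx hy => simp only [map_add, hx, hy]
    | hh a b x hx =>
    rw [coaction_of (homog_of_bihomog hx), LinearMap.rTensor_tmul, comul_of]
    refine eq_on_homogTensor (f := tensorCoaction (coaction π β) (coaction π β) ∘ₗ
      TensorProduct.map (of π β).toLinearMap (of π β).toLinearMap)
      (g := (TensorProduct.mk ℂ _ _).flip (MonoidAlgebra.single (a⁻¹ * b) 1) ∘ₗ
      TensorProduct.map (of π β).toLinearMap (of π β).toLinearMap) (fun c y hy z hz => ?_)
      (comul_of_bihomog hx)
    simp only [LinearMap.comp_apply, TensorProduct.map_tmul, LinearEquiv.coe_coe,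
      LinearMap.flip_apply, TensorProduct.mk_apply]
    rw [tensorCoaction_tmul (coaction_of hy.1) (coaction_of hz.1)]
    -- The degrees a⁻¹c and c⁻¹b of the two legs telescope to a⁻¹b.
    congr 2
    group
  counit_equivariant x := by
    obtain ⟨x, rfl⟩ := (of π β).surjective x
    induction x using π.homog_induction with
    | h0 => simp
    | hadd x y hx hy => simp only [map_add, hx, hy, TensorProduct.add_tmul]
    | hh a b x hx =>
    rw [coaction_of hx, LinearMap.rTensor_tmul]
    -- On the diagonal the coaction has degree 1; off it the counit is zero.
    by_cases hab : a = b
    · rw [hab, inv_mul_cancel]; rfl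
    · rw [counit_of, counit_eq_zero hx hab, TensorProduct.zero_tmul, TensorProduct.zero_tmul]
  antipode_equivariant x := by
    obtain ⟨x, rfl⟩ := (of π β).surjective x
    induction x using bihomog_induction hH with
    | h0 => simp
    | hadd x y hx hy => simp only [map_add, hx, hy]
    | hh a b x hx =>
    have hx' := homog_of_bihomog hx
    rw [coaction_of hx', LinearMap.rTensor_tmul, antipode_of hx', map_smul,
      coaction_of (antipode_of_bihomog hx), TensorProduct.smul_tmul', inv_inv, mul_comm b]
  comul_one := by
    rw [← of_one, comul_of, Bialgebra.comul_one]
    rfl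
  comul_mul x y := by
    obtain ⟨x, rfl⟩ := (of π β).surjective x
    obtain ⟨y, rfl⟩ := (of π β).surjective y
    induction x using bihomog_induction hH with
    | h0 => simp
    | hadd x x' hx hx' => simp only [map_add, add_mul, hx, hx', TensorProduct.add_tmul]
    | hh a b x hx =>
    induction y using bihomog_induction hH with
    | h0 => simp
    | hadd x x' hx hx' => simp only [map_add, mul_add, hx, hx', TensorProduct.tmul_add]
    | hh c d y hy =>
    rw [of_mul (homog_of_bihomog hx) (homog_of_bihomog hy), map_smul, comul_of, comul_of, comul_of,
      Bialgebra.comul_mul]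
    let e : H ⊗[ℂ] H →ₗ[ℂ] _ := TensorProduct.map (of π β).toLinearMap (of π β).toLinearMap
    -- Both sides are bilinear in Δ(x) and Δ(y). Each coproduct is reduced in turn to an elementary
    -- tensor, Δ(y) here and Δ(x) next.
    refine eq_on_homogTensor (f := (β (a⁻¹ * b) c⁻¹ : ℂ) • (e ∘ₗ LinearMap.mulLeft ℂ (comul x)))
      (g := braidedMul β (coaction π β) (coaction π β) ∘ₗ TensorProduct.mk ℂ _ _ (e (comul x)) ∘ₗ e)
      (fun q y₁ hy₁ y₂ hy₂ => ?_) (comul_of_bihomog hy)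
    refine eq_on_homogTensor (f := (β (a⁻¹ * b) c⁻¹ : ℂ) •
        (e ∘ₗ LinearMap.mulRight ℂ (y₁ ⊗ₜ[ℂ] y₂)))
      (g := braidedMul β (coaction π β) (coaction π β) ∘ₗ (TensorProduct.mk ℂ _ _).flip
        (e (y₁ ⊗ₜ[ℂ] y₂)) ∘ₗ e)
      (fun p x₁ hx₁ x₂ hx₂ => ?_) (comul_of_bihomog hx)
    simp only [e, LinearMap.comp_apply, LinearMap.smul_apply, LinearMap.mulRight_apply,
      TensorProduct.map_tmul, LinearEquiv.coe_coe, LinearMap.flip_apply, TensorProduct.mk_apply,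
      Algebra.TensorProduct.tmul_mul_tmul]
    rw [braidedMul_tmul β _ _ (coaction_of hx₂.1) (coaction_of hy₁.1), of_mul hx₁.1 hy₁.1,
      of_mul hx₂.1 hy₂.1,
      TensorProduct.smul_tmul_smul, smul_smul]
    congr 1
    -- With x₁ ∈ H_{a,p}, x₂ ∈ H_{p,b}, y₁ ∈ H_{c,q}, y₂ ∈ H_{q,d}, the braiding and the two
    -- products give β(p⁻¹b, c⁻¹q) β(a⁻¹p, c⁻¹) β(p⁻¹b, q⁻¹). The variable q cancels, then p,
    -- leaving β(a⁻¹b, c⁻¹).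
    simp only [map_mul, map_inv, MonoidHom.mul_apply, MonoidHom.inv_apply, Circle.coe_mul,
      Circle.coe_inv]
    field_simp
  comul_star x := by
    obtain ⟨x, rfl⟩ := (of π β).surjective x
    induction x using bihomog_induction hH with
    | h0 => simp [braidedStar_zero]
    | hadd x x' hx hx' => simp only [map_add, star_add, hx, hx', braidedStar_add]
    | hh a b x hx =>
    rw [star_of (homog_of_bihomog hx), map_smul, comul_of, comul_of, HopfStarAlgebra.comul_star]
    -- Both sides are conjugate-linear in t, so `eq_on_homogTensor` does not apply and the span
    -- induction is done by hand.
    have key : ∀ t ∈ π.homogTensor a b, (β (a⁻¹ * b) a⁻¹ : ℂ) •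
        TensorProduct.map (of π β).toLinearMap (of π β).toLinearMap (star t) =
        braidedStar β (coaction π β) (coaction π β)
          (TensorProduct.map (of π β).toLinearMap (of π β).toLinearMap t) := by
      intro t ht
      induction ht using Submodule.span_induction with
      | zero => simp [braidedStar_zero]
      | add s t _ _ hs ht => simp only [map_add, star_add, smul_add, hs, ht, braidedStar_add]
      | smul c t _ ht => rw [star_smul, map_smul, smul_comm, ht, map_smul, braidedStar_smul]
      | mem t ht =>
        obtain ⟨p, y, hy, z, hz, rfl⟩ := ht
        simp only [TensorProduct.star_tmul, TensorProduct.map_tmul, LinearEquiv.coe_coe]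
        rw [braidedStar_tmul β (coaction_star_of hy.1) (coaction_star_of hz.1), star_of hy.1,
          star_of hz.1,
          TensorProduct.smul_tmul_smul, smul_smul]
        congr 1
        -- The braiding of the stars gives β(pb⁻¹, ap⁻¹) = β(p⁻¹b, a⁻¹p). Together with β(p⁻¹b, p⁻¹)
        -- and β(a⁻¹p, a⁻¹) from the two involutions it makes β(a⁻¹b, a⁻¹).
        simp only [map_mul, map_inv, MonoidHom.mul_apply, MonoidHom.inv_apply, Circle.coe_mul,
          Circle.coe_inv]
        field_simp
    exact key _ (comul_of_bihomog hx)
  counit_one := Bialgebra.counit_one (R := ℂ) (A := H)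
  counit_mul x y := by
    obtain ⟨x, rfl⟩ := (of π β).surjective x
    obtain ⟨y, rfl⟩ := (of π β).surjective y
    induction x using π.homog_induction with
    | h0 => simp
    | hadd x x' hx hx' => simp only [map_add, hx, hx', add_mul]
    | hh a b x hx =>
    induction y using π.homog_induction with
    | h0 => simp
    | hadd x x' hx hx' => simp only [map_add, hx, hx', mul_add]
    | hh c d y hy =>
    rw [of_mul hx hy, map_smul, counit_of, counit_of, counit_of, Bialgebra.counit_mul]
    -- The twisting scalar is 1 when a = b; otherwise ε(x) = 0 and both sides vanish.
    by_cases hab : a = b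
    · simp [hab]
    · simp [counit_eq_zero hx hab]
  counit_star x := by
    obtain ⟨x, rfl⟩ := (of π β).surjective x
    induction x using π.homog_induction with
    | h0 => simp
    | hadd x y hx hy => simp only [map_add, hx, hy, star_add]
    | hh a b x hx =>
    rw [star_of hx, map_smul, counit_of, counit_of, hε]
    by_cases hab : a = b
    · simp [hab]
    · simp [counit_eq_zero hx hab]
  antipode_left x := by
    obtain ⟨x, rfl⟩ := (of π β).surjective x
    induction x using bihomog_induction hH with
    | h0 => simp
    | hadd x y hx hy => simp only [map_add, hx, hy]
    | hh a b x hx =>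
    -- For y ∈ H_{a,c} and z ∈ H_{c,b}, the scalar β(a⁻¹c, c) of S_β(y) cancels the scalar β(ca⁻¹,
    -- c⁻¹) of the product S(y)z, so the ordinary antipode sum remains.
    have h := eq_on_homogTensor (f := LinearMap.mul' ℂ (Transmutation π β) ∘ₗ
        (antipode π β).rTensor _ ∘ₗ
        TensorProduct.map (of π β).toLinearMap (of π β).toLinearMap)
      (g := (of π β).toLinearMap ∘ₗ LinearMap.mul' ℂ H ∘ₗ (HopfAlgebra.antipode ℂ).rTensor H)
      (fun c y hy z hz => by
        simp only [LinearMap.comp_apply, TensorProduct.map_tmul, LinearEquiv.coe_coe,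
          LinearMap.rTensor_tmul, LinearMap.mul'_apply]
        rw [antipode_of hy.1, smul_mul_assoc, of_mul hy.2 hz.1, smul_smul, ← Circle.coe_mul,
          inv_inv, mul_comm c, ← map_mul, mul_inv_cancel, map_one, Circle.coe_one, one_smul])
      (comul_of_bihomog hx)
    rw [comul_of, counit_of]
    simp only [LinearMap.comp_apply] at h
    rw [h, HopfAlgebra.mul_antipode_rTensor_comul_apply, Algebra.algebraMap_eq_smul_one,
      Algebra.algebraMap_eq_smul_one, LinearEquiv.coe_coe, map_smul, of_one]
  antipode_right x := by
    obtain ⟨x, rfl⟩ := (of π β).surjective x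
    induction x using bihomog_induction hH with
    | h0 => simp
    | hadd x y hx hy => simp only [map_add, hx, hy]
    | hh a b x hx =>
    -- Here the scalars are β(c⁻¹b, b) from S_β(z) and β(a⁻¹c, b) from the product. Their product
    -- β(a⁻¹b, b) does not depend on c, so it comes out of the sum; it is 1 when a = b, and
    -- otherwise ε(x) = 0.
    have h := eq_on_homogTensor (f := LinearMap.mul' ℂ (Transmutation π β) ∘ₗ
        (antipode π β).lTensor _ ∘ₗ
        TensorProduct.map (of π β).toLinearMap (of π β).toLinearMap)
      (g := (β (a⁻¹ * b) b : ℂ) •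
        ((of π β).toLinearMap ∘ₗ LinearMap.mul' ℂ H ∘ₗ (HopfAlgebra.antipode ℂ).lTensor H))
      (fun c y hy z hz => by
        simp only [LinearMap.comp_apply, TensorProduct.map_tmul, LinearEquiv.coe_coe,
          LinearMap.lTensor_tmul, LinearMap.mul'_apply, LinearMap.smul_apply]
        rw [antipode_of hz.1, mul_smul_comm, of_mul hy.1 hz.2, smul_smul]
        congr 1
        simp only [map_mul, map_inv, MonoidHom.mul_apply, MonoidHom.inv_apply, Circle.coe_mul,
          Circle.coe_inv]
        field_simp)
      (comul_of_bihomog hx)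
    rw [comul_of, counit_of]
    simp only [LinearMap.comp_apply, LinearMap.smul_apply] at h
    rw [h, HopfAlgebra.mul_antipode_lTensor_comul_apply, Algebra.algebraMap_eq_smul_one,
      Algebra.algebraMap_eq_smul_one, LinearEquiv.coe_coe, map_smul, of_one]
    by_cases hab : a = b
    · simp [hab]
    · simp [counit_eq_zero (homog_of_bihomog hx) hab]

end Transmutation

end TransmutationHopf

theorem comul_groupAlg_single {Γ : Type*} (a : Γ) :
    comul (R := ℂ) (MonoidAlgebra.single a (1 : ℂ)) =
      MonoidAlgebra.single a 1 ⊗ₜ MonoidAlgebra.single a 1 := by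
  simp

/-! ### Unitary comodules over the bosonization -/

section Bosonization

variable {H Γ : Type*} [Ring H] [StarRing H] [HopfAlgebra ℂ H] [CommGroup Γ]

namespace Transmutation

open TorusMap

variable (π : TorusMap H Γ) (β : Γ →* Γ →* Circle)

/-- The left coaction of `ℂΓ` on `H`, as a map to the bosonization `ℂΓ # H_β`. -/
def toBosonization : H →ₗ[ℂ] MonoidAlgebra ℂ Γ ⊗[ℂ] Transmutation π β :=
  (of π β).toLinearMap.lTensor _ ∘ₗ π.leftCoaction

variable {π β}

theorem toBosonization_of_mem {a b : Γ} {x : H} (hx : x ∈ π.homog a b) :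
    toBosonization π β x = MonoidAlgebra.single a 1 ⊗ₜ of π β x := by
  rw [toBosonization, LinearMap.comp_apply, hx.1, LinearMap.lTensor_tmul, LinearEquiv.coe_coe]

theorem toBosonization_one : toBosonization π β 1 = 1 ⊗ₜ 1 :=
  toBosonization_of_mem one_mem

/-- The left coaction is multiplicative as a map from `H` to the bosonization. -/
theorem toBosonization_mul (x y : H) : toBosonization π β (x * y) =
    braidedMul β comul (coaction π β) (toBosonization π β x ⊗ₜ toBosonization π β y) := by
  induction x using π.homog_induction with
  | h0 => simp
  | hadd x x' hx hx' => simp only [map_add, add_mul, hx, hx', TensorProduct.add_tmul]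
  | hh a b x hx =>
  induction y using π.homog_induction with
  | h0 => simp
  | hadd x x' hx hx' => simp only [map_add, mul_add, hx, hx', TensorProduct.tmul_add]
  | hh c d y hy =>
  -- Moving c past x costs β(a⁻¹b, c), the inverse of the scalar β(a⁻¹b, c⁻¹) in the transmuted
  -- product.
  rw [toBosonization_of_mem hx, toBosonization_of_mem hy, toBosonization_of_mem (mul_mem hx hy),
    braidedMul_tmul β _ _ (coaction_of hx) (comul_groupAlg_single c), of_mul hx hy,
    TensorProduct.tmul_smul, smul_smul, ← Circle.coe_mul, ← map_mul, mul_inv_cancel, map_one,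
    Circle.coe_one, one_smul, MonoidAlgebra.single_mul_single, mul_one]

/-- The left coaction is `*`-preserving as a map from `H` to the bosonization. -/
theorem toBosonization_star [HopfStarAlgebra H] (x : H) : toBosonization π β (star x) =
    braidedStar β comul (coaction π β) (toBosonization π β x) := by
  induction x using π.homog_induction with
  | h0 => simp [braidedStar_zero]
  | hadd x x' hx hx' => simp only [map_add, star_add, hx, hx', braidedStar_add]
  | hh a b x hx =>
  have hs : star (MonoidAlgebra.single a (1 : ℂ)) = MonoidAlgebra.single a⁻¹ 1 := by
    rw [MonoidAlgebra.star_single', star_one]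
  -- The first factor comes from the braiding of x* with a⁻¹, the second from *_β.
  have hc : (β (a * b⁻¹) a⁻¹ * β (a⁻¹ * b) a⁻¹ : ℂ) = 1 := by
    rw [← Circle.coe_mul, ← MonoidHom.mul_apply, ← map_mul, mul_mul_mul_comm, mul_inv_cancel,
      inv_mul_cancel, mul_one, map_one, MonoidHom.one_apply, Circle.coe_one]
  rw [toBosonization_of_mem hx, toBosonization_of_mem (star_mem hx),
    braidedStar_tmul β (g := a⁻¹) (by rw [hs]; exact comul_groupAlg_single _)
    (coaction_star_of hx), star_of hx, TensorProduct.tmul_smul, smul_smul, hs, hc, one_smul]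

variable {m : ℕ}

/-- This is the antipode axiom at z_ij: S(Z) is a right inverse of Z. It gives the equivariance of
the coaction and, for unitary Z, the identity Z* = S(Z). -/
theorem sum_mul_antipode_of_isCorepMat {C : Type*} [Ring C] [HopfAlgebra ℂ C]
    {Z : Matrix (Fin m) (Fin m) C} (hZ : IsCorepMat Z) (i j : Fin m) :
    ∑ k, Z i k * HopfAlgebra.antipode ℂ (Z k j) = (1 : Matrix (Fin m) (Fin m) C) i j := by
  have h := mul_antipode_lTensor_comul_apply (R := ℂ) (Z i j)
  rw [hZ.comul, hZ.counit] at h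
  simp only [map_sum, LinearMap.lTensor_tmul, LinearMap.mul'_apply] at h
  rw [h, Matrix.one_apply, Matrix.one_apply]
  split_ifs <;> simp

variable {U : Matrix (Fin m) (Fin m) H}

theorem isCorepMat_map_lin (hU : IsCorepMat U) : IsCorepMat (U.map π.lin) where
  comul i j := by simp [comul_lin, hU.comul]
  counit i j := by simp [counit_lin, hU.counit]

theorem isCorepMat_map_of (hU : IsCorepMat U) : IsCorepMat (U.map (of π β)) where
  comul i j := by simp [comul_of, hU.comul]
  counit i j := hU.counit i j

/-- Iterating the coproduct gives ∑ u_ik ⊗ u_kl ⊗ u_lj, so the adjoint coaction is explicit on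
matrix entries, which need not be homogeneous. -/
theorem coaction_of_corep (hU : IsCorepMat U) (i j : Fin m) :
    coaction π β (of π β (U i j)) = ∑ k, ∑ l, of π β (U k l) ⊗ₜ
      (HopfAlgebra.antipode ℂ (π.lin (U i k)) * π.lin (U l j)) := by
  simp [coaction, adCoaction, ad, hU.comul, TensorProduct.tmul_sum, lin_mul, lin_antipode]

theorem coactionOfMat_single {C : Type*} [AddCommGroup C] [Module ℂ C]
    (V : Matrix (Fin m) (Fin m) C) (j : Fin m) :
    coactionOfMat V (Pi.single j 1) = ∑ i, Pi.single i (1 : ℂ) ⊗ₜ[ℂ] V i j := by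
  rw [← Pi.basisFun_apply, coactionOfMat, Module.Basis.constr_basis]

/-- A corepresentation matrix `U` of `H` and its image `π(U)` define a comodule over `H_β`. -/
theorem isBraidedComodule (hU : IsCorepMat U) :
    IsBraidedComodule (coaction π β) (U.map π.lin) (U.map (of π β)) where
  corep_left := isCorepMat_map_lin hU
  corep_right := isCorepMat_map_of hU
  equivariant := by
    refine (Pi.basisFun ℂ (Fin m)).ext fun j => ?_
    have hZ := sum_mul_antipode_of_isCorepMat (isCorepMat_map_lin (π := π) hU)
    simp only [Pi.basisFun_apply, LinearMap.comp_apply, coactionOfMat_single, map_sum,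
      LinearMap.rTensor_tmul, TensorProduct.sum_tmul, tensorCoaction, TensorProduct.map_tmul,
      Matrix.map_apply, coaction_of_corep hU, TensorProduct.tmul_sum, LinearEquiv.coe_coe,
      TensorProduct.tensorTensorTensorComm_tmul, LinearMap.lTensor_tmul, LinearMap.mul'_apply,
      ← mul_assoc]
    -- The middle expression contains Z S(Z) = 1. Collapsing it gives (δ_U ⊗ ι)δ_Z; expanding it
    -- gives the tensor product coaction, with S(z_ir)z_lj coming from the adjoint coaction.
    trans ∑ l, ∑ k, ∑ r, Pi.single k (1 : ℂ) ⊗ₜ[ℂ] of π β (U r l) ⊗ₜ[ℂ]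
      ((∑ i, U.map π.lin k i * HopfAlgebra.antipode ℂ (U.map π.lin i r)) * π.lin (U l j))
    · simp only [hZ, Matrix.one_apply, ite_mul, one_mul, zero_mul, TensorProduct.tmul_ite,
        Finset.sum_ite_eq, Finset.mem_univ, if_true]
    · simp only [Finset.sum_mul, TensorProduct.tmul_sum, Matrix.map_apply]
      symm
      rw [Finset.sum_comm]
      refine (Finset.sum_congr rfl fun r _ => Finset.sum_comm).trans ?_
      rw [Finset.sum_comm]
      refine Finset.sum_congr rfl fun l _ => ?_
      refine (Finset.sum_congr rfl fun r _ => Finset.sum_comm).trans ?_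
      rw [Finset.sum_comm]

/-- Since Δ(u_ij) = ∑ u_ik ⊗ u_kj, applying π to the first leg produces Z # U. Unitarity of U in `H`
is thus transported along the *-homomorphism `toBosonization`. -/
theorem smashMat_eq (i j : Fin m) (hU : IsCorepMat U) :
    smashMat (U.map π.lin) (U.map (of π β)) i j = toBosonization π β (U i j) := by
  simp [smashMat, toBosonization, leftCoaction, hU.comul]

/-- A unitary corepresentation matrix `U` of `H` and its image `π(U)` define a unitary comodule
over `H_β`. -/
theorem isUnitaryBraidedComodule [HopfStarAlgebra H] (hU : IsCorepMat U) (hu : IsUnitaryMat U) :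
    IsUnitaryBraidedComodule β (coaction π β) (U.map π.lin) (U.map (of π β)) where
  __ := isBraidedComodule hU
  unitary_left i j := by
    have h := congrFun (congrFun hu.1 i) j
    simp only [Matrix.mul_apply, Matrix.conjTranspose_apply] at h
    simp only [smashMat_eq _ _ hU, ← toBosonization_star, ← toBosonization_mul, ← map_sum, h,
      Matrix.one_apply, ← toBosonization_one]
    split_ifs <;> simp
  unitary_right i j := by
    have h := congrFun (congrFun hu.2 i) j
    simp only [Matrix.mul_apply, Matrix.conjTranspose_apply] at h
    simp only [smashMat_eq _ _ hU, ← toBosonization_star, ← toBosonization_mul, ← map_sum, h,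
      Matrix.one_apply, ← toBosonization_one]
    split_ifs <;> simp

end Transmutation
end Bosonization

/-! ### Two-sided multiplication by scalar matrices -/

section Sandwich

variable {m : ℕ}

/-- The matrix `P M Q` for scalar matrices `P`, `Q` and a matrix `M` over a vector space. -/
def sandwich {A : Type*} [AddCommGroup A] [Module ℂ A] (P Q : Matrix (Fin m) (Fin m) ℂ)
    (M : Matrix (Fin m) (Fin m) A) : Matrix (Fin m) (Fin m) A :=
  Matrix.of fun i j => ∑ k, ∑ l, (P i k * Q l j) • M k l

section Module

variable {A C : Type*} [AddCommGroup A] [Module ℂ A] [AddCommGroup C] [Module ℂ C]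
  (P Q P' Q' : Matrix (Fin m) (Fin m) ℂ) (M : Matrix (Fin m) (Fin m) A)

theorem sandwich_apply (i j : Fin m) :
    sandwich P Q M i j = ∑ k, ∑ l, (P i k * Q l j) • M k l := rfl

/-- Only linearity of `f` matters. This is why `sandwich` is defined over vector spaces: it will be
moved through Δ, S, `of` and coefficient functionals, which need not be multiplicative for the
products in play. -/
theorem sandwich_map (f : A →ₗ[ℂ] C) : sandwich P Q (M.map f) = (sandwich P Q M).map f := by
  ext i j
  simp [sandwich_apply]

theorem sandwich_mem {N : Submodule ℂ A} (h : ∀ i j, M i j ∈ N) (i j : Fin m) :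
    sandwich P Q M i j ∈ N := by
  rw [sandwich_apply]
  exact Submodule.sum_mem _ fun k _ => Submodule.sum_mem _ fun l _ => Submodule.smul_mem _ _ (h k l)

theorem sandwich_one_one : sandwich 1 1 M = M := by
  ext i j
  simp [sandwich_apply, Matrix.one_apply]

theorem sum_sandwich {ι : Type*} (s : Finset ι) (p q : ι → Matrix (Fin m) (Fin m) ℂ) :
    ∑ a ∈ s, ∑ b ∈ s, sandwich (p a) (q b) M = sandwich (∑ a ∈ s, p a) (∑ b ∈ s, q b) M := by
  ext i j
  simp only [Matrix.sum_apply, sandwich_apply, Finset.sum_mul_sum, Finset.sum_smul]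
  refine (Finset.sum_congr rfl fun a _ => Finset.sum_comm).trans ?_
  rw [Finset.sum_comm]
  refine Finset.sum_congr rfl fun k _ => ?_
  refine (Finset.sum_congr rfl fun a _ => Finset.sum_comm).trans ?_
  rw [Finset.sum_comm]

theorem sandwich_conjTranspose [StarAddMonoid A] [StarModule ℂ A] :
    (sandwich P Q M).conjTranspose =
      sandwich Q.conjTranspose P.conjTranspose M.conjTranspose := by
  ext i j
  simp only [Matrix.conjTranspose_apply, sandwich_apply, star_sum, star_smul, star_mul']
  rw [Finset.sum_comm]
  simp only [mul_comm]

end Module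

section Algebra

variable {A : Type*} [Ring A] [Algebra ℂ A]
  (P Q P' Q' : Matrix (Fin m) (Fin m) ℂ) (M M' : Matrix (Fin m) (Fin m) A)

theorem sandwich_eq : sandwich P Q M = scalarMat A P * M * scalarMat A Q := by
  ext i j
  simp only [sandwich_apply, scalarMat, Matrix.mul_apply, Matrix.map_apply, Finset.sum_mul]
  rw [Finset.sum_comm]
  refine Finset.sum_congr rfl fun k _ => Finset.sum_congr rfl fun l _ => ?_
  rw [mul_assoc, ← Algebra.commutes, ← mul_assoc, ← map_mul, Algebra.smul_def]

theorem conjugateBy_eq_sandwich (G : GL (Fin m) ℂ) :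
    conjugateBy G M = sandwich (G : Matrix (Fin m) (Fin m) ℂ)
      ((G⁻¹ : GL (Fin m) ℂ) : Matrix (Fin m) (Fin m) ℂ) M :=
  (sandwich_eq _ _ _).symm

theorem sandwich_sandwich :
    sandwich P Q (sandwich P' Q' M) = sandwich (P * P') (Q' * Q) M := by
  simp only [sandwich_eq, ← scalarMat_mul, mul_assoc]

theorem sandwich_mul_sandwich : sandwich P Q M * sandwich P' Q' M' =
    sandwich P Q' (M * scalarMat A (Q * P') * M') := by
  simp only [sandwich_eq, ← scalarMat_mul, mul_assoc]

theorem sandwich_one : sandwich P Q (1 : Matrix (Fin m) (Fin m) A) = scalarMat A (P * Q) := by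
  rw [sandwich_eq, mul_one, scalarMat_mul]

theorem scalarMat_sum {ι : Type*} (s : Finset ι) (p : ι → Matrix (Fin m) (Fin m) ℂ) :
    scalarMat A (∑ a ∈ s, p a) = ∑ a ∈ s, scalarMat A (p a) := by
  ext i j
  simp [scalarMat, Matrix.sum_apply]

theorem sum_sandwich_right {ι : Type*} (s : Finset ι) (N : ι → Matrix (Fin m) (Fin m) A) :
    ∑ a ∈ s, sandwich P Q (N a) = sandwich P Q (∑ a ∈ s, N a) := by
  simp only [sandwich_eq, Finset.mul_sum, Finset.sum_mul]

theorem scalarMat_zero : scalarMat A (0 : Matrix (Fin m) (Fin m) ℂ) = 0 := by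
  ext i j
  simp [scalarMat]

theorem sandwich_zero : sandwich P Q (0 : Matrix (Fin m) (Fin m) A) = 0 := by
  rw [sandwich_eq, mul_zero, zero_mul]

/-- Let `M M' = 1` and let `p` be a resolution of the identity by orthogonal idempotents. If linear
maps are applied to the products `p_a M p_b p_c M' p_d` that for `b = c` do not depend on `b`, then
the sum is the image of the identity. -/
theorem sum_sandwich_mul_map {Γ C : Type*} [DecidableEq Γ] [AddCommGroup C] [Module ℂ C]
    {s : Finset Γ} {p : Γ → Matrix (Fin m) (Fin m) ℂ}
    (hp : ∀ a b, p a * p b = if a = b then p a else 0) (hs : ∑ a ∈ s, p a = 1)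
    {M M' : Matrix (Fin m) (Fin m) A} (hM : M * M' = 1) (T : Γ → Γ → Γ → Γ → A →ₗ[ℂ] C)
    {T₀ : Γ → Γ → A →ₗ[ℂ] C} {t : A →ₗ[ℂ] C} (hT : ∀ a b d, T a b b d = T₀ a d)
    (hT₀ : ∀ a, T₀ a a = t) :
    ∑ a ∈ s, ∑ b ∈ s, ∑ c ∈ s, ∑ d ∈ s,
      (sandwich (p a) (p b) M * sandwich (p c) (p d) M').map (T a b c d) =
    (1 : Matrix (Fin m) (Fin m) A).map t := by
  have hmap : ∀ (f : A →ₗ[ℂ] C) (N : Γ → Matrix (Fin m) (Fin m) A),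
      ∑ a ∈ s, (N a).map f = (∑ a ∈ s, N a).map f := by
    intro f N
    ext i j
    simp [Matrix.sum_apply]
  -- Terms with c ≠ b vanish because p_b p_c = 0. In the rest the map no longer depends on b, so the
  -- sum over b can be carried out inside it.
  have h1 : ∀ a, ∀ b ∈ s, ∑ c ∈ s, ∑ d ∈ s,
      (sandwich (p a) (p b) M * sandwich (p c) (p d) M').map (T a b c d) =
      ∑ d ∈ s, (sandwich (p a) (p d) (M * scalarMat A (p b) * M')).map (T₀ a d) := by
    intro a b hb
    rw [Finset.sum_eq_single_of_mem b hb]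
    · simp only [sandwich_mul_sandwich, hp, if_true, hT]
    · intro c _ hc
      refine Finset.sum_eq_zero fun d _ => ?_
      rw [sandwich_mul_sandwich, hp, if_neg hc.symm, scalarMat_zero, mul_zero, zero_mul,
        sandwich_zero]
      exact Matrix.map_zero _ (map_zero _)
  have h2 : ∀ a ∈ s, ∑ b ∈ s, ∑ c ∈ s, ∑ d ∈ s,
      (sandwich (p a) (p b) M * sandwich (p c) (p d) M').map (T a b c d) =
      (scalarMat A (p a)).map t := by
    intro a ha
    rw [Finset.sum_congr rfl (h1 a), Finset.sum_comm]
    -- Summing over b replaces the middle p_b by 1, which leaves p_a M M' p_d = p_a p_d. Only a = d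
    -- survives, and there the map is `t`.
    have h3 : ∀ d, ∑ b ∈ s, (sandwich (p a) (p d) (M * scalarMat A (p b) * M')).map (T₀ a d) =
        if a = d then (scalarMat A (p a)).map t else 0 := by
      intro d
      rw [hmap, sum_sandwich_right, ← Finset.sum_mul, ← Finset.mul_sum, ← scalarMat_sum, hs,
        scalarMat_one, mul_one, hM, sandwich_one, hp]
      split_ifs with h
      · rw [h, hT₀]
      · rw [scalarMat_zero]
        exact Matrix.map_zero _ (map_zero _)
    simp only [h3, Finset.sum_ite_eq, ha, if_true]
  rw [Finset.sum_congr rfl h2, hmap, ← scalarMat_sum, hs, scalarMat_one]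

end Algebra

end Sandwich

/-! ### Spectral projections of a corepresentation matrix of a torus -/

section SpectralProj

variable {m : ℕ} {Γ : Type*}

/-- The coefficient `p_a` of `Z = ∑ₐ p_a ⊗ a`. -/
def spectralProj (Z : Matrix (Fin m) (Fin m) (MonoidAlgebra ℂ Γ)) (a : Γ) :
    Matrix (Fin m) (Fin m) ℂ :=
  Z.map (coef a)

open scoped Classical in
/-- A finite set containing all characters that occur in `Z`. -/
def spectrumSet (Z : Matrix (Fin m) (Fin m) (MonoidAlgebra ℂ Γ)) : Finset Γ :=
  Finset.univ.biUnion fun i => Finset.univ.biUnion fun j => (Z i j).coeff.support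

variable {Z : Matrix (Fin m) (Fin m) (MonoidAlgebra ℂ Γ)}

theorem groupAlg_eq_sum (x : MonoidAlgebra ℂ Γ) {s : Finset Γ} (hs : x.coeff.support ⊆ s) :
    x = ∑ a ∈ s, coef a x • MonoidAlgebra.single a 1 := by
  classical
  ext b
  have hc : ∀ a, coef a x = x.coeff a := fun a => rfl
  simp only [hc, MonoidAlgebra.coeff_sum, Finsupp.finsetSum_apply, MonoidAlgebra.coeff_smul]
  simp [Finsupp.single_apply]
  intro h
  by_contra h'
  exact h (hs (by simpa using h'))

theorem groupAlg_ext {x y : MonoidAlgebra ℂ Γ} (h : ∀ a, coef a x = coef a y) : x = y := by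
  ext a
  exact h a

theorem eq_sum_spectralProj (i j : Fin m) : Z i j =
    ∑ a ∈ spectrumSet Z, spectralProj Z a i j • MonoidAlgebra.single a 1 := by
  classical
  refine groupAlg_eq_sum (Z i j) fun a ha => ?_
  simp only [spectrumSet, Finset.mem_biUnion, Finset.mem_univ, true_and]
  exact ⟨i, j, ha⟩

/-- Group elements are grouplike, so Δ(x) has coefficient zero at a ⊗ b unless a = b. Compare the
coefficients of both sides of Δ(z_ij) = ∑ z_ik ⊗ z_kj. -/
theorem spectralProj_mul [DecidableEq Γ] (hZ : IsCorepMat Z) (a b : Γ) :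
    spectralProj Z a * spectralProj Z b = if a = b then spectralProj Z a else 0 := by
  have h : ∀ x : MonoidAlgebra ℂ Γ, TensorProduct.lid ℂ ℂ (TensorProduct.map (coef a) (coef b)
      (comul (R := ℂ) x)) = if a = b then coef a x else 0 := by
    intro x
    induction x using MonoidAlgebra.induction_linear with
    | zero => simp
    | add x y hx hy =>
      simp only [map_add, hx, hy]
      split_ifs <;> simp
    | single g c =>
      have hc : (MonoidAlgebra.single g c : MonoidAlgebra ℂ Γ) = c • MonoidAlgebra.single g 1 := by
        simp
      rw [hc, map_smul, comul_groupAlg_single, map_smul, map_smul, map_smul, TensorProduct.map_tmul,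
        TensorProduct.lid_tmul, coef_single, coef_single, Finsupp.single_apply,
        Finsupp.single_apply]
      by_cases h1 : g = a
      · by_cases h2 : a = b <;> simp [h1, h2]
      · by_cases h2 : a = b
        · subst h2; simp [h1]
        · simp [h1, h2]
  ext i j
  have := h (Z i j)
  rw [hZ.comul] at this
  simp only [map_sum, TensorProduct.map_tmul, TensorProduct.lid_tmul, smul_eq_mul] at this
  rw [Matrix.mul_apply]
  refine this.trans ?_
  split_ifs <;> rfl

/-- Apply the counit to Z = ∑ p_a ⊗ a, using ε(Z) = 1. -/
theorem sum_spectralProj (hZ : IsCorepMat Z) : ∑ a ∈ spectrumSet Z, spectralProj Z a = 1 := by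
  ext i j
  have h := congrArg (counit (R := ℂ)) (eq_sum_spectralProj (Z := Z) i j)
  rw [hZ.counit] at h
  rw [h, Matrix.sum_apply]
  simp

/-- In matrix form this is p_a Z = p_a ⊗ a, and the next lemma is Z p_b = p_b ⊗ b. These eigenvector
equations make p_a U p_b homogeneous. -/
theorem sum_spectralProj_smul (hZ : IsCorepMat Z) (a : Γ) (i j : Fin m) :
    ∑ k, spectralProj Z a i k • Z k j = spectralProj Z a i j • MonoidAlgebra.single a 1 := by
  classical
  refine groupAlg_ext fun b => ?_
  have h := congrFun (congrFun (spectralProj_mul hZ a b) i) j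
  rw [Matrix.mul_apply] at h
  simp only [map_sum, map_smul, coef_single, smul_eq_mul]
  refine h.trans ?_
  by_cases hab : a = b <;> simp [hab]

theorem sum_smul_spectralProj (hZ : IsCorepMat Z) (b : Γ) (i j : Fin m) :
    ∑ k, spectralProj Z b k j • Z i k = spectralProj Z b i j • MonoidAlgebra.single b 1 := by
  classical
  refine groupAlg_ext fun a => ?_
  have h := congrFun (congrFun (spectralProj_mul hZ a b) i) j
  rw [Matrix.mul_apply] at h
  simp only [map_sum, map_smul, coef_single, smul_eq_mul]
  rw [Finset.sum_congr rfl fun k _ => mul_comm _ _]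
  refine h.trans ?_
  by_cases hab : a = b
  · simp [hab]
  · simp [hab]

variable [CommGroup Γ]

theorem coef_star (a : Γ) (x : MonoidAlgebra ℂ Γ) :
    coef a (star x) = star (coef a⁻¹ x) := by
  classical
  induction x using MonoidAlgebra.induction_linear with
  | zero => simp
  | add x y hx hy => simp only [star_add, map_add, hx, hy]
  | single g c =>
    rw [MonoidAlgebra.star_single', coef_single, coef_single, Finsupp.single_apply,
      Finsupp.single_apply]
    by_cases h : g = a⁻¹
    · simp [h]
    · rw [if_neg h, if_neg (by rintro rfl; simp at h), star_zero]

theorem coef_antipode (a : Γ) (x : MonoidAlgebra ℂ Γ) :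
    coef a (HopfAlgebra.antipode ℂ x) = coef a⁻¹ x := by
  classical
  induction x using MonoidAlgebra.induction_linear with
  | zero => simp
  | add x y hx hy => simp only [map_add, hx, hy]
  | single g c =>
    rw [MonoidAlgebra.antipode_single, coef_single, coef_single, Finsupp.single_apply,
      Finsupp.single_apply]
    by_cases h : g = a⁻¹
    · simp [h]
    · rw [if_neg h, if_neg (by rintro rfl; simp at h)]

/-- Both Z* and S(Z) are inverse to Z, hence equal. Star and antipode both replace a by a⁻¹, and
star also conjugates the coefficients; comparing coefficients at a⁻¹ gives p_a* = p_a. -/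
theorem spectralProj_conjTranspose (hZ : IsCorepMat Z) (hu : IsUnitaryMat Z) (a : Γ) :
    (spectralProj Z a).conjTranspose = spectralProj Z a := by
  have h1 : Z * Z.map (HopfAlgebra.antipode ℂ) = 1 := by
    refine Matrix.ext fun i j => ?_
    exact Transmutation.sum_mul_antipode_of_isCorepMat hZ i j
  have h2 : Z.conjTranspose = Z.map (HopfAlgebra.antipode ℂ) := left_inv_eq_right_inv hu.1 h1
  ext i j
  have h := congrArg (coef a⁻¹) (congrFun (congrFun h2 i) j)
  rwa [Matrix.conjTranspose_apply, Matrix.map_apply, coef_star, coef_antipode, inv_inv] at h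

/-- Take the coefficient at a in Z = F Z̄ F⁻¹. The star on ℂΓ inverts characters, so the conjugate
of p_{a⁻¹} appears. -/
theorem spectralProj_mul_coe {F : GL (Fin m) ℂ} (hF : conjugateBy F (conjMat Z) = Z) (a : Γ) :
    spectralProj Z a * (F : Matrix (Fin m) (Fin m) ℂ) =
      (F : Matrix (Fin m) (Fin m) ℂ) * (spectralProj Z a⁻¹).map star := by
  have h : spectralProj Z a = conjugateBy F ((spectralProj Z a⁻¹).map star) := by
    conv_lhs => rw [← hF]
    have h1 : (spectralProj Z a⁻¹).map star = (conjMat Z).map (coef a) := by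
      ext i j
      exact (coef_star a _).symm
    rw [h1, conjugateBy_eq_sandwich, conjugateBy_eq_sandwich, sandwich_map]
    rfl
  rw [h, conjugateBy_eq_sandwich, sandwich_eq]
  have h2 : ∀ G : Matrix (Fin m) (Fin m) ℂ, scalarMat ℂ G = G := fun G => by
    ext i j; rfl
  rw [h2, h2, mul_assoc, ← Units.val_mul, inv_mul_cancel, Units.val_one, mul_one]

end SpectralProj

/-! ### Homogeneous components of a corepresentation matrix -/

section Isotypic

variable {m : ℕ} {Γ : Type*}

/-- The component `p_a U p_b` of the matrix `U`. -/
def isotypic {A : Type*} [AddCommGroup A] [Module ℂ A]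
    (Z : Matrix (Fin m) (Fin m) (MonoidAlgebra ℂ Γ)) (U : Matrix (Fin m) (Fin m) A) (a b : Γ) :
    Matrix (Fin m) (Fin m) A :=
  sandwich (spectralProj Z a) (spectralProj Z b) U

theorem sum_isotypic {A : Type*} [AddCommGroup A] [Module ℂ A]
    {Z : Matrix (Fin m) (Fin m) (MonoidAlgebra ℂ Γ)} (hZ : IsCorepMat Z)
    (U : Matrix (Fin m) (Fin m) A) :
    ∑ a ∈ spectrumSet Z, ∑ b ∈ spectrumSet Z, isotypic Z U a b = U := by
  simp only [isotypic, sum_sandwich, sum_spectralProj hZ, sandwich_one_one]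

theorem sum_isotypic_apply {A : Type*} [AddCommGroup A] [Module ℂ A]
    {Z : Matrix (Fin m) (Fin m) (MonoidAlgebra ℂ Γ)} (hZ : IsCorepMat Z)
    (U : Matrix (Fin m) (Fin m) A) (i j : Fin m) :
    ∑ a ∈ spectrumSet Z, ∑ b ∈ spectrumSet Z, isotypic Z U a b i j = U i j := by
  conv_rhs => rw [← sum_isotypic hZ U]
  simp only [Matrix.sum_apply]

variable [CommGroup Γ] {H : Type*} [Ring H] [StarRing H] [HopfAlgebra ℂ H] {π : TorusMap H Γ}
  {U : Matrix (Fin m) (Fin m) H} {Z : Matrix (Fin m) (Fin m) (MonoidAlgebra ℂ Γ)}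

theorem isotypic_conjTranspose {A : Type*} [AddCommGroup A] [Module ℂ A] [StarAddMonoid A]
    [StarModule ℂ A] (hZ : IsCorepMat Z) (hu : IsUnitaryMat Z) (U : Matrix (Fin m) (Fin m) A)
    (a b : Γ) : (isotypic Z U a b).conjTranspose = isotypic Z U.conjTranspose b a := by
  rw [isotypic, sandwich_conjTranspose, spectralProj_conjTranspose hZ hu,
    spectralProj_conjTranspose hZ hu, isotypic]

/-- From Δ(U) one gets δ_L(U) = Z ⊗ U and δ_R(U) = U ⊗ Z as matrix products. Multiplying by p_a on
the left or by p_b on the right turns Z into the character a or b. -/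
theorem isotypic_mem_homog (hU : IsCorepMat U) (hUZ : U.map π.lin = Z) (a b : Γ) (i j : Fin m) :
    isotypic Z U a b i j ∈ π.homog a b := by
  have hZ : IsCorepMat Z := hUZ ▸ Transmutation.isCorepMat_map_lin hU
  have hz : ∀ i j, π.lin (U i j) = Z i j := fun i j => congrFun (congrFun hUZ i) j
  constructor
  · have h : ∀ l, ∑ k, spectralProj Z a i k • π.leftCoaction (U k l) =
        ∑ r, spectralProj Z a i r • (MonoidAlgebra.single a 1 ⊗ₜ U r l) := by
      intro l
      simp only [TorusMap.leftCoaction, LinearMap.comp_apply, hU.comul, map_sum,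
        LinearMap.rTensor_tmul, hz, Finset.smul_sum]
      rw [Finset.sum_comm]
      refine Finset.sum_congr rfl fun r _ => ?_
      simp only [TensorProduct.smul_tmul', ← TensorProduct.sum_tmul, sum_spectralProj_smul hZ]
    simp only [isotypic, sandwich_apply, map_sum, map_smul, TensorProduct.tmul_sum,
      TensorProduct.tmul_smul]
    rw [Finset.sum_comm]
    conv_rhs => rw [Finset.sum_comm]
    refine Finset.sum_congr rfl fun l _ => ?_
    simp only [mul_comm _ (spectralProj Z b l j), mul_smul, ← Finset.smul_sum, h]
  · have h : ∀ k, ∑ l, spectralProj Z b l j • π.rightCoaction (U k l) =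
        ∑ r, spectralProj Z b r j • (U k r ⊗ₜ MonoidAlgebra.single b 1) := by
      intro k
      simp only [TorusMap.rightCoaction, LinearMap.comp_apply, hU.comul, map_sum,
        LinearMap.lTensor_tmul, hz, Finset.smul_sum]
      rw [Finset.sum_comm]
      refine Finset.sum_congr rfl fun r _ => ?_
      simp only [← TensorProduct.tmul_smul, ← TensorProduct.tmul_sum, sum_smul_spectralProj hZ]
    simp only [isotypic, sandwich_apply, map_sum, map_smul, TensorProduct.sum_tmul,
      ← TensorProduct.smul_tmul']
    refine Finset.sum_congr rfl fun k _ => ?_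
    simp only [mul_smul, ← Finset.smul_sum, h]

/-- Insert 1 = ∑ p_c p_c between the two copies of U in Δ(U). -/
theorem comul_isotypic (hU : IsCorepMat U) (hUZ : U.map π.lin = Z) (a b : Γ) (i j : Fin m) :
    comul (R := ℂ) (isotypic Z U a b i j) = ∑ c ∈ spectrumSet Z, ∑ k,
      isotypic Z U a c i k ⊗ₜ[ℂ] isotypic Z U c b k j := by
  classical
  have hZ : IsCorepMat Z := hUZ ▸ Transmutation.isCorepMat_map_lin hU
  -- With the two embeddings into `H ⊗ H`, Δ(U) becomes an honest product of matrices over one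
  -- algebra.
  let L : H →ₐ[ℂ] H ⊗[ℂ] H := Algebra.TensorProduct.includeLeft
  let R : H →ₐ[ℂ] H ⊗[ℂ] H := Algebra.TensorProduct.includeRight
  have hc : U.map (comul (R := ℂ)) = U.map L.toLinearMap * U.map R.toLinearMap := by
    ext i j
    simp [hU.comul, Matrix.mul_apply, L, R]
  have h1 : (isotypic Z U a b).map (comul (R := ℂ)) = ∑ c ∈ spectrumSet Z,
      (isotypic Z U a c).map L.toLinearMap * (isotypic Z U c b).map R.toLinearMap := by
    simp only [isotypic, ← sandwich_map, hc, sandwich_mul_sandwich, spectralProj_mul hZ, if_true,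
      sum_sandwich_right, ← Finset.sum_mul, ← Finset.mul_sum, ← scalarMat_sum, sum_spectralProj hZ,
      scalarMat_one, mul_one]
  have h2 := congrFun (congrFun h1 i) j
  rw [Matrix.map_apply] at h2
  rw [h2, Matrix.sum_apply]
  simp [Matrix.mul_apply, L, R]

namespace TorusMap

theorem mul_mem_antihomog {a b c d : Γ} {x y : H} (hx : x ∈ π.antihomog a b)
    (hy : y ∈ π.antihomog c d) : x * y ∈ π.antihomog (a * c) (b * d) := by
  refine ⟨mul_mem hx.1 hy.1, ?_⟩
  have h := mul_mem hy.2 hx.2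
  rwa [← mul_inv_rev, ← mul_inv_rev, ← HopfAlgebra.antipode_mul_antidistrib] at h

/-- The middle degrees multiply as well: from H_{a,p} ⊗ H_{p,b} and H_{c,q} ⊗ H_{q,d} one lands in
the middle degree pq. -/
theorem mul_mem_homogTensor {a b c d : Γ} {s t : H ⊗[ℂ] H} (hs : s ∈ π.homogTensor a b)
    (ht : t ∈ π.homogTensor c d) : s * t ∈ π.homogTensor (a * c) (b * d) := by
  have h := Submodule.mul_mem_mul hs ht
  rw [homogTensor, homogTensor, Submodule.span_mul_span] at h
  refine Submodule.span_mono ?_ h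
  rintro _ ⟨_, ⟨p, y, hy, z, hz, rfl⟩, _, ⟨q, y', hy', z', hz', rfl⟩, rfl⟩
  exact ⟨p * q, y * y', mul_mem_antihomog hy hy', z * z', mul_mem_antihomog hz hz',
    Algebra.TensorProduct.tmul_mul_tmul _ _ _ _⟩

theorem mul_mem_bihomog {a b c d : Γ} {x y : H} (hx : x ∈ π.bihomog a b)
    (hy : y ∈ π.bihomog c d) : x * y ∈ π.bihomog (a * c) (b * d) := by
  refine ⟨mul_mem_antihomog hx.1 hy.1, ?_⟩
  rw [SetLike.mem_coe, Submodule.mem_comap, Bialgebra.comul_mul]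
  exact mul_mem_homogTensor hx.2 hy.2

theorem one_mem_antihomog : (1 : H) ∈ π.antihomog 1 1 := by
  refine ⟨one_mem, ?_⟩
  rw [SetLike.mem_coe, Submodule.mem_comap, HopfAlgebra.antipode_one, inv_one]
  exact one_mem

theorem one_mem_bihomog : (1 : H) ∈ π.bihomog 1 1 := by
  refine ⟨one_mem_antihomog, ?_⟩
  rw [SetLike.mem_coe, Submodule.mem_comap, Bialgebra.comul_one]
  exact Submodule.subset_span ⟨1, 1, one_mem_antihomog, 1, one_mem_antihomog, rfl⟩

/-- As S(U) = U* and the p_a are self-adjoint, S(p_a U p_b) = (p_b U p_a)*, which has degree (b⁻¹,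
a⁻¹). The coproduct is handled by `comul_isotypic`. -/
theorem isotypic_mem_bihomog [HopfStarAlgebra H] (hU : IsCorepMat U) (hUZ : U.map π.lin = Z)
    (hu : IsUnitaryMat Z) (hS : U.map (HopfAlgebra.antipode ℂ) = U.conjTranspose) (a b : Γ)
    (i j : Fin m) : isotypic Z U a b i j ∈ π.bihomog a b := by
  have hZ : IsCorepMat Z := hUZ ▸ Transmutation.isCorepMat_map_lin hU
  have h : ∀ a b i j, isotypic Z U a b i j ∈ π.antihomog a b := by
    intro a b i j
    refine ⟨isotypic_mem_homog hU hUZ a b i j, ?_⟩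
    have h1 : (isotypic Z U a b).map (HopfAlgebra.antipode ℂ) =
        (isotypic Z U b a).conjTranspose := by
      rw [isotypic_conjTranspose hZ hu, isotypic, isotypic, ← sandwich_map, hS]
    have h2 : HopfAlgebra.antipode ℂ (isotypic Z U a b i j) = star (isotypic Z U b a j i) :=
      congrFun (congrFun h1 i) j
    rw [SetLike.mem_coe, Submodule.mem_comap, h2]
    exact star_mem (isotypic_mem_homog hU hUZ b a j i)
  refine ⟨h a b i j, ?_⟩
  rw [SetLike.mem_coe, Submodule.mem_comap, comul_isotypic hU hUZ]
  exact Submodule.sum_mem _ fun c _ => Submodule.sum_mem _ fun k _ =>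
    Submodule.subset_span ⟨c, _, h a c i k, _, h c b k j, rfl⟩

end TorusMap

end Isotypic

/-! ### Homogeneous elements spanning ℂ[O_F⁺] -/

namespace FreeOrth

variable {m : ℕ} {F : GL (Fin m) ℂ} {Γ : Type*} [CommGroup Γ]
  {Z : Matrix (Fin m) (Fin m) (MonoidAlgebra ℂ Γ)}

theorem isCorepMat_fund : IsCorepMat (fund F) := ⟨comul_fund F, counit_fund F⟩

theorem isCorepMat_conjMat_fund : IsCorepMat (conjMat (fund F)) :=
  ⟨comul_star_fund F, counit_star_fund F⟩

theorem counit_star (x : FreeOrth F) :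
    counit (R := ℂ) (star x) = star (counit (R := ℂ) x) := by
  induction x using FreeOrth.induction with
  | h1 c =>
    rw [← algebraMap_star_comm, Bialgebra.counit_algebraMap, Bialgebra.counit_algebraMap]
  | h2 i j =>
    rw [counit_star_fund, counit_fund, Matrix.one_apply]
    split_ifs <;> simp
  | h2' i j =>
    rw [star_star, counit_star_fund, counit_fund, Matrix.one_apply]
    split_ifs <;> simp
  | h3 a b ha hb =>
    rw [star_mul, Bialgebra.counit_mul, Bialgebra.counit_mul, ha, hb, star_mul]
  | h4 a b ha hb => rw [star_add, map_add, map_add, ha, hb, star_add]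

/-- Subspaces `N a b` that are compatible with products and contain the components `p_a U p_b`
span `ℂ[O_F⁺]`. -/
theorem iSup_eq_top_of_isotypic_mem (hZ : IsCorepMat Z) {N : Γ → Γ → Submodule ℂ (FreeOrth F)}
    (h1 : 1 ∈ N 1 1)
    (hmul : ∀ a b c d, ∀ x ∈ N a b, ∀ y ∈ N c d, x * y ∈ N (a * c) (b * d))
    (hN : ∀ a b i j, isotypic Z (fund F) a b i j ∈ N a b) :
    ⨆ p : Γ × Γ, N p.1 p.2 = ⊤ := by
  have hle : ∀ a b, N a b ≤ ⨆ p : Γ × Γ, N p.1 p.2 := fun a b =>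
    le_iSup (fun p : Γ × Γ => N p.1 p.2) (a, b)
  have hfund : ∀ i j, fund F i j ∈ ⨆ p : Γ × Γ, N p.1 p.2 := fun i j => by
    rw [← sum_isotypic_apply hZ (fund F) i j]
    exact Submodule.sum_mem _ fun a _ => Submodule.sum_mem _ fun b _ => hle a b (hN a b i j)
  refine eq_top_iff.2 fun x _ => ?_
  induction x using FreeOrth.induction with
  | h1 c =>
    rw [Algebra.algebraMap_eq_smul_one]
    exact Submodule.smul_mem _ _ (hle 1 1 h1)
  | h2 i j => exact hfund i j
  | h2' i j =>
    -- The relation Ū = F⁻¹UF makes the adjoints of the generators linear combinations of the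
    -- generators, so no closure of `N` under the involution is needed.
    have h : star (fund F i j) = conjugateBy F⁻¹ (fund F) i j :=
      congrFun (congrFun (conjMat_fund F) i) j
    rw [h, conjugateBy_eq_sandwich]
    exact sandwich_mem _ _ _ hfund i j
  | h3 x y hx hy =>
    refine Submodule.iSup_induction _ (motive := fun x => x * y ∈ _) (hx trivial) (fun p x hx => ?_)
      (by simp) (fun x x' hx hx' => by rw [add_mul]; exact Submodule.add_mem _ hx hx')
    refine Submodule.iSup_induction _ (motive := fun y => x * y ∈ _) (hy trivial) (fun q y hy => ?_)
      (by simp) (fun y y' hy hy' => by rw [mul_add]; exact Submodule.add_mem _ hy hy')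
    exact hle _ _ (hmul _ _ _ _ x hx y hy)
  | h4 x y hx hy => exact Submodule.add_mem _ (hx trivial) (hy trivial)

variable (hZ : IsCorepMat Z) (hu : IsUnitaryMat Z) (hF : conjugateBy F (conjMat Z) = Z)

theorem fund_map_lin : (fund F).map (toTorus Z hZ hu hF).lin = Z := by
  refine Matrix.ext fun i j => ?_
  exact toTorus_fund Z hZ hu hF i j

theorem isotypic_fund_mem_bihomog (a b : Γ) (i j : Fin m) :
    isotypic Z (fund F) a b i j ∈ (toTorus Z hZ hu hF).bihomog a b := by
  refine TorusMap.isotypic_mem_bihomog isCorepMat_fund (fund_map_lin hZ hu hF) hu ?_ a b i j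
  refine Matrix.ext fun i j => ?_
  exact antipode_fund F i j

theorem isotypic_fund_mem_homog (a b : Γ) (i j : Fin m) :
    isotypic Z (fund F) a b i j ∈ (toTorus Z hZ hu hF).homog a b :=
  isotypic_mem_homog isCorepMat_fund (fund_map_lin hZ hu hF) a b i j

theorem iSup_bihomog : ⨆ p : Γ × Γ, (toTorus Z hZ hu hF).bihomog p.1 p.2 = ⊤ :=
  iSup_eq_top_of_isotypic_mem hZ TorusMap.one_mem_bihomog
    (fun _ _ _ _ _ hx _ hy => TorusMap.mul_mem_bihomog hx hy)
    (isotypic_fund_mem_bihomog hZ hu hF)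

end FreeOrth

/-! ### The braided free orthogonal relations in the transmutation -/

theorem sum_sum_mul_sum_sum {ι R : Type*} [NonUnitalNonAssocSemiring R] (s : Finset ι)
    (f g : ι → ι → R) : (∑ a ∈ s, ∑ b ∈ s, f a b) * (∑ c ∈ s, ∑ d ∈ s, g c d) =
      ∑ a ∈ s, ∑ b ∈ s, ∑ c ∈ s, ∑ d ∈ s, f a b * g c d := by
  rw [Finset.sum_mul]
  refine Finset.sum_congr rfl fun a _ => ?_
  rw [Finset.sum_mul]
  simp only [Finset.mul_sum]

section BraidedConj

variable {m : ℕ} {Γ : Type*} [CommGroup Γ] {Z : Matrix (Fin m) (Fin m) (MonoidAlgebra ℂ Γ)}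

theorem isotypic_map {Γ : Type*} {Z : Matrix (Fin m) (Fin m) (MonoidAlgebra ℂ Γ)} {A C : Type*} [AddCommGroup A] [Module ℂ A] [AddCommGroup C] [Module ℂ C]
    (U : Matrix (Fin m) (Fin m) A) (f : A →ₗ[ℂ] C) (a b : Γ) :
    isotypic Z (U.map f) a b = (isotypic Z U a b).map f :=
  sandwich_map _ _ _ _

theorem bichar_sum (β : Γ →* Γ →* Circle) (s : Finset Γ) (f g h : Γ → ℂ) :
    bichar β ((star (∑ b ∈ s, f b • MonoidAlgebra.single b (1 : ℂ)) *
      ∑ a ∈ s, g a • MonoidAlgebra.single a 1) ⊗ₜ[ℂ]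
      star (∑ c ∈ s, h c • MonoidAlgebra.single c (1 : ℂ))) =
    ∑ a ∈ s, ∑ b ∈ s, ∑ c ∈ s, (star (f b) * (g a * star (h c))) * (β (b⁻¹ * a) c⁻¹ : ℂ) := by
  simp only [star_sum, star_smul, MonoidAlgebra.star_single', star_one, Finset.sum_mul_sum,
    TensorProduct.sum_tmul, TensorProduct.tmul_sum, map_sum, smul_mul_assoc, mul_smul_comm,
    MonoidAlgebra.single_mul_single, mul_one, ← TensorProduct.smul_tmul', TensorProduct.tmul_smul,
    map_smul, bichar, biExt_single, smul_eq_mul]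
  simp only [Finset.mul_sum]
  refine (Finset.sum_congr rfl fun c _ => Finset.sum_comm).trans ?_
  rw [Finset.sum_comm]
  refine (Finset.sum_congr rfl fun a _ => Finset.sum_comm).trans ?_
  refine Finset.sum_congr rfl fun a _ => Finset.sum_congr rfl fun b _ =>
    Finset.sum_congr rfl fun c _ => ?_
  ring

/-- Inverting both arguments of a bicharacter leaves its value unchanged. -/
theorem bichar_inv_mul_inv (β : Γ →* Γ →* Circle) (a b : Γ) :
    (β (b⁻¹ * a) a⁻¹ : ℂ) = (β (a⁻¹ * b) a : ℂ) := by
  rw [show b⁻¹ * a = (a⁻¹ * b)⁻¹ by rw [mul_inv, inv_inv, mul_comm], map_inv, map_inv,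
    MonoidHom.inv_apply, inv_inv]

/-- The braided conjugate matrix in terms of the components of `V`. -/
theorem braidedConj_eq (hZ : IsCorepMat Z) (hu : IsUnitaryMat Z) (β : Γ →* Γ →* Circle)
    {B : Type*} [Ring B] [StarRing B] [Algebra ℂ B] [StarModule ℂ B]
    (V : Matrix (Fin m) (Fin m) B) (i j : Fin m) :
    braidedConj β Z V i j = ∑ a ∈ spectrumSet Z, ∑ b ∈ spectrumSet Z,
      (β (a⁻¹ * b) a : ℂ) • star (isotypic Z V a b i j) := by
  classical
  have hp : ∀ a i k, star (spectralProj Z a i k) = spectralProj Z a k i := fun a i k =>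
    congrFun (congrFun (spectralProj_conjTranspose hZ hu a) k) i
  -- After expanding the entries of Z in characters, the sum over l forms the product p_a p_c,
  -- because the conjugate of (p_c)_il is (p_c)_li. So c = a, and two characters are left.
  have hl : ∀ s t, ∑ l, bichar β ((star (Z t j) * Z s l) ⊗ₜ[ℂ] star (Z i l)) =
      ∑ a ∈ spectrumSet Z, ∑ b ∈ spectrumSet Z,
        star (spectralProj Z b t j) * spectralProj Z a s i * (β (a⁻¹ * b) a : ℂ) := by
    intro s t
    have h1 : ∀ l, bichar β ((star (Z t j) * Z s l) ⊗ₜ[ℂ] star (Z i l)) = _ := fun l => by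
      rw [eq_sum_spectralProj (Z := Z) t j, eq_sum_spectralProj (Z := Z) s l,
        eq_sum_spectralProj (Z := Z) i l, bichar_sum]
    rw [Finset.sum_congr rfl fun l _ => h1 l, Finset.sum_comm]
    refine Finset.sum_congr rfl fun a ha => ?_
    rw [Finset.sum_comm]
    refine Finset.sum_congr rfl fun b _ => ?_
    rw [Finset.sum_comm]
    have h2 : ∀ c, ∑ l, star (spectralProj Z b t j) *
        (spectralProj Z a s l * star (spectralProj Z c i l)) * (β (b⁻¹ * a) c⁻¹ : ℂ) =
        if a = c then star (spectralProj Z b t j) * spectralProj Z a s i *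
          (β (a⁻¹ * b) a : ℂ) else 0 := by
      intro c
      have h3 := congrFun (congrFun (spectralProj_mul hZ a c) s) i
      rw [Matrix.mul_apply] at h3
      simp only [hp c i]
      rw [← Finset.sum_mul, ← Finset.mul_sum, h3]
      split_ifs with h
      · rw [← h, bichar_inv_mul_inv]
      · simp
    simp only [h2, Finset.sum_ite_eq, ha, if_true]
  rw [braidedConj, Matrix.of_apply]
  have h4 : ∀ s, ∑ l, ∑ t, bichar β ((star (Z t j) * Z s l) ⊗ₜ[ℂ] star (Z i l)) • star (V s t) =
      ∑ t, ∑ a ∈ spectrumSet Z, ∑ b ∈ spectrumSet Z, (star (spectralProj Z b t j) *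
        spectralProj Z a s i * (β (a⁻¹ * b) a : ℂ)) • star (V s t) := by
    intro s
    rw [Finset.sum_comm]
    simp only [← Finset.sum_smul, hl]
  simp only [h4, isotypic, sandwich_apply, star_sum, star_smul, star_mul', hp _ i, Finset.smul_sum,
    smul_smul]
  symm
  refine (Finset.sum_congr rfl fun a _ => Finset.sum_comm).trans ?_
  rw [Finset.sum_comm]
  refine Finset.sum_congr rfl fun k _ => ?_
  refine (Finset.sum_congr rfl fun a _ => Finset.sum_comm).trans ?_
  rw [Finset.sum_comm]
  refine Finset.sum_congr rfl fun l _ => Finset.sum_congr rfl fun a _ =>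
    Finset.sum_congr rfl fun b _ => ?_
  congr 1
  ring

end BraidedConj

namespace FreeOrth

variable {m : ℕ} {F : GL (Fin m) ℂ} {Γ : Type*} [CommGroup Γ]
  {Z : Matrix (Fin m) (Fin m) (MonoidAlgebra ℂ Γ)}
  (hZ : IsCorepMat Z) (hu : IsUnitaryMat Z) (hF : conjugateBy F (conjMat Z) = Z)
  (β : Γ →* Γ →* Circle)

/-- The fundamental matrix of the transmutation of `ℂ[O_F⁺]`. -/
abbrev transFund : Matrix (Fin m) (Fin m) (Transmutation (toTorus Z hZ hu hF) β) :=
  (fund F).map (Transmutation.of (toTorus Z hZ hu hF) β)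

theorem isotypic_transFund (a b : Γ) : isotypic Z (transFund hZ hu hF β) a b =
    (isotypic Z (fund F) a b).map (Transmutation.of (toTorus Z hZ hu hF) β) :=
  isotypic_map (fund F) (Transmutation.of (toTorus Z hZ hu hF) β).toLinearMap a b

/-- On the component in H_{a,b} the involution *_β contributes β(a⁻¹b, a⁻¹), which cancels the
coefficient β(a⁻¹b, a) of Ū_Z. -/
theorem braidedConj_transFund : braidedConj β Z (transFund hZ hu hF β) =
    (conjMat (fund F)).map (Transmutation.of (toTorus Z hZ hu hF) β) := by
  refine Matrix.ext fun i j => ?_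
  rw [braidedConj_eq hZ hu]
  have h : ∀ a b : Γ, (β (a⁻¹ * b) a : ℂ) • star (isotypic Z (transFund hZ hu hF β) a b i j) =
      Transmutation.of (toTorus Z hZ hu hF) β (star (isotypic Z (fund F) a b i j)) := by
    intro a b
    rw [isotypic_transFund, Matrix.map_apply,
      Transmutation.star_of (isotypic_fund_mem_homog hZ hu hF a b i j), smul_smul,
      ← Circle.coe_mul, ← map_mul, mul_inv_cancel, map_one, Circle.coe_one, one_smul]
  simp only [h, ← map_sum, ← star_sum, sum_isotypic_apply hZ]
  rfl

theorem transFund_eq : transFund hZ hu hF β =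
    conjugateBy F (braidedConj β Z (transFund hZ hu hF β)) := by
  rw [braidedConj_transFund, conjugateBy_eq_sandwich]
  refine Eq.trans ?_ (sandwich_map _ _ _
    (Transmutation.of (toTorus Z hZ hu hF) β).toLinearMap).symm
  rw [← conjugateBy_eq_sandwich, ← fund_conj]
  rfl

theorem sum_transFund : ∑ a ∈ spectrumSet Z, ∑ b ∈ spectrumSet Z,
    (isotypic Z (fund F) a b).map (Transmutation.of (toTorus Z hZ hu hF) β) =
      transFund hZ hu hF β := by
  simp only [← isotypic_transFund, sum_isotypic hZ]

/-- U and its H_β-adjoint are decomposed into components, whose products are scalar multiples of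
products in `H`. After the p_b collapse, the scalars fit the pattern of `sum_sandwich_mul_map`. -/
theorem transFund_unitary : IsUnitaryMat (transFund hZ hu hF β) := by
  classical
  have hp : ∀ a b, sandwich (spectralProj Z a) (spectralProj Z b) (fund F).conjTranspose =
      (isotypic Z (fund F) b a).conjTranspose :=
    fun a b => (isotypic_conjTranspose hZ hu _ _ _).symm
  have hm := isotypic_fund_mem_homog hZ hu hF
  have h1 : (1 : Matrix (Fin m) (Fin m) (FreeOrth F)).map
      (Transmutation.of (toTorus Z hZ hu hF) β).toLinearMap = 1 :=
    Matrix.map_one _ (map_zero _) Transmutation.of_one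
  have hs := sum_transFund hZ hu hF β
  have hs' : ∑ a ∈ spectrumSet Z, ∑ b ∈ spectrumSet Z, ((isotypic Z (fund F) b a).map
      (Transmutation.of (toTorus Z hZ hu hF) β)).conjTranspose =
      (transFund hZ hu hF β).conjTranspose := by
    rw [← hs, Finset.sum_comm]
    simp only [Matrix.conjTranspose_sum]
  constructor
  · rw [← hs']
    conv_lhs => rw [← hs]
    -- The (a,b) component of the adjoint is the star of an element of H_{b,a}: the involution gives
    -- β(b⁻¹a, b⁻¹) and the product with H_{c,d} gives β(ba⁻¹, c⁻¹). For c = b they cancel.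
    rw [sum_sum_mul_sum_sum, ← h1, ← sum_sandwich_mul_map (spectralProj_mul hZ) (sum_spectralProj hZ)
      (fund_unitary F).1 (fun a b c _ => ((β (b⁻¹ * a) b⁻¹ : ℂ) * (β (b * a⁻¹) c⁻¹ : ℂ)) •
        (Transmutation.of (toTorus Z hZ hu hF) β).toLinearMap)
      (T₀ := fun _ _ => (Transmutation.of (toTorus Z hZ hu hF) β).toLinearMap) ?_ fun _ => rfl]
    · refine Finset.sum_congr rfl fun a _ => Finset.sum_congr rfl fun b _ =>
        Finset.sum_congr rfl fun c _ => Finset.sum_congr rfl fun d _ => ?_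
      rw [hp]
      refine Matrix.ext fun i j => ?_
      simp only [Matrix.mul_apply, Matrix.map_apply, Matrix.conjTranspose_apply, map_sum]
      refine Finset.sum_congr rfl fun k _ => ?_
      rw [Transmutation.star_of (hm b a k i), smul_mul_assoc,
        Transmutation.of_mul (TorusMap.star_mem (hm b a k i)) (hm c d k j), smul_smul, inv_inv]
      rfl
    · intro a b d
      have h : (β (b⁻¹ * a) b⁻¹ : ℂ) * (β (b * a⁻¹) b⁻¹ : ℂ) = 1 := by
        rw [← Circle.coe_mul, ← MonoidHom.mul_apply, ← map_mul, mul_mul_mul_comm, inv_mul_cancel,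
          mul_inv_cancel, mul_one, map_one, MonoidHom.one_apply, Circle.coe_one]
      rw [h, one_smul]
  · rw [← hs']
    conv_lhs => rw [← hs]
    -- In this order the scalars at b = c combine to β(a⁻¹d, d). This need not be 1, but it does not
    -- involve b and equals 1 when a = d, the only case that remains after summing over b.
    rw [sum_sum_mul_sum_sum, ← h1, ← sum_sandwich_mul_map (spectralProj_mul hZ) (sum_spectralProj hZ)
      (fund_unitary F).2 (fun a b c d => ((β (d⁻¹ * c) d⁻¹ : ℂ) * (β (a⁻¹ * b) d : ℂ)) •
        (Transmutation.of (toTorus Z hZ hu hF) β).toLinearMap)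
      (T₀ := fun a d => (β (a⁻¹ * d) d : ℂ) •
        (Transmutation.of (toTorus Z hZ hu hF) β).toLinearMap) ?_ fun _ => by simp]
    · refine Finset.sum_congr rfl fun a _ => Finset.sum_congr rfl fun b _ =>
        Finset.sum_congr rfl fun c _ => Finset.sum_congr rfl fun d _ => ?_
      rw [hp]
      refine Matrix.ext fun i j => ?_
      simp only [Matrix.mul_apply, Matrix.map_apply, Matrix.conjTranspose_apply, map_sum]
      refine Finset.sum_congr rfl fun k _ => ?_
      rw [Transmutation.star_of (hm d c j k), mul_smul_comm,
        Transmutation.of_mul (hm a b i k) (TorusMap.star_mem (hm d c j k)), smul_smul, inv_inv]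
      rfl
    · intro a b d
      congr 1
      simp only [map_mul, map_inv, MonoidHom.mul_apply, MonoidHom.inv_apply, Circle.coe_mul,
        Circle.coe_inv]
      field_simp

theorem transFund_isBraidedOrthogonal : IsBraidedOrthogonal F β Z (transFund hZ hu hF β) :=
  ⟨transFund_unitary hZ hu hF β, transFund_eq hZ hu hF β⟩

/-- On homogeneous elements the products of `H` and of H_β agree up to a nonzero scalar. So the
homogeneous elements in the *-subalgebra generated by U inside H_β are closed under the ordinary
product, and the entries of U already generate `H` under that. -/
theorem adjoin_transFund :
    StarAlgebra.adjoin ℂ {u | ∃ i j, u = transFund hZ hu hF β i j} = ⊤ := by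
  let D := StarAlgebra.adjoin ℂ {u | ∃ i j, u = transFund hZ hu hF β i j}
  -- Membership in `homog a b` is kept alongside membership in `D` so that the scalar relating the
  -- two products is known.
  let N : Γ → Γ → Submodule ℂ (FreeOrth F) := fun a b => (toTorus Z hZ hu hF).homog a b ⊓
    (Subalgebra.toSubmodule D.toSubalgebra).comap
      (Transmutation.of (toTorus Z hZ hu hF) β).toLinearMap
  have hfund : ∀ i j, Transmutation.of (toTorus Z hZ hu hF) β (fund F i j) ∈ D := fun i j =>
    StarAlgebra.subset_adjoin ℂ _ ⟨i, j, rfl⟩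
  have hN : ⨆ p : Γ × Γ, N p.1 p.2 = ⊤ := by
    refine iSup_eq_top_of_isotypic_mem hZ ⟨TorusMap.one_mem, one_mem D⟩ ?_ ?_
    · intro a b c d x hx y hy
      refine ⟨TorusMap.mul_mem hx.1 hy.1, ?_⟩
      have h : (β (a⁻¹ * b) c⁻¹ : ℂ)⁻¹ • (Transmutation.of (toTorus Z hZ hu hF) β x *
          Transmutation.of (toTorus Z hZ hu hF) β y) ∈ D := D.smul_mem (mul_mem hx.2 hy.2) _
      rw [Transmutation.of_mul hx.1 hy.1, smul_smul,
        inv_mul_cancel₀ (Circle.coe_ne_zero _), one_smul] at h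
      exact h
    · intro a b i j
      refine ⟨isotypic_fund_mem_homog hZ hu hF a b i j, ?_⟩
      exact sandwich_mem (N := (Subalgebra.toSubmodule D.toSubalgebra).comap
        (Transmutation.of (toTorus Z hZ hu hF) β).toLinearMap) _ _ _ hfund i j
  refine eq_top_iff.2 fun x _ => ?_
  obtain ⟨x, rfl⟩ := (Transmutation.of (toTorus Z hZ hu hF) β).surjective x
  have hle : ⨆ p : Γ × Γ, N p.1 p.2 ≤ (Subalgebra.toSubmodule D.toSubalgebra).comap
      (Transmutation.of (toTorus Z hZ hu hF) β).toLinearMap :=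
    iSup_le fun p => inf_le_right
  exact hle (hN ▸ Submodule.mem_top : x ∈ _)

/-- The transmutation of `ℂ[O_F⁺]` is a braided compact matrix quantum group. -/
theorem isBraidedCMQG : IsBraidedCMQG β (Transmutation.coaction (toTorus Z hZ hu hF) β)
    (Transmutation.antipode (toTorus Z hZ hu hF) β) Z (transFund hZ hu hF β) := by
  have hU : IsUnitaryBraidedComodule β (Transmutation.coaction (toTorus Z hZ hu hF) β) Z
      (transFund hZ hu hF β) := by
    have h := Transmutation.isUnitaryBraidedComodule (π := toTorus Z hZ hu hF) (β := β)
      isCorepMat_fund (fund_unitary F)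
    rwa [fund_map_lin hZ hu hF] at h
  refine ⟨hZ, hu, Transmutation.isBraidedHopfStarAlgebra (iSup_bihomog hZ hu hF) counit_star,
    adjoin_transFund hZ hu hF β, hU, ?_, F, ?_⟩
  -- The ordinary conjugate Ū is a corepresentation matrix of `H` with π(Ū) = Z̄; over H_β it
  -- becomes Ū_Z.
  · have h := Transmutation.isBraidedComodule (π := toTorus Z hZ hu hF) (β := β)
      (isCorepMat_conjMat_fund (F := F))
    have hc : (conjMat (fund F)).map (toTorus Z hZ hu hF).lin = conjMat Z := by
      conv_rhs => rw [← fund_map_lin hZ hu hF]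
      refine Matrix.ext fun i j => ?_
      exact (toTorus Z hZ hu hF).lin_star _
    rwa [hc, ← braidedConj_transFund] at h
  -- The change of basis is F itself: it carries (Z̄, Ū_Z) to (Z, U).
  · rwa [hF, ← transFund_eq]

end FreeOrth

/-! ### Twisted shifts on functions with values in an algebra -/

section TwistedShift

variable {Γ : Type*} [CommGroup Γ] (β : Γ →* Γ →* Circle) {B : Type*} [Ring B] [Algebra ℂ B]

/-- The operators `(x λ_{a,b} ξ)(k) = β(k, a⁻¹) x ξ(a b⁻¹ k)` on functions `ξ : Γ → B`. -/
def twistedShift (a b : Γ) : B →ₗ[ℂ] Module.End ℂ (Γ → B) where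
  toFun x :=
    { toFun := fun ξ k => (β k a⁻¹ : ℂ) • (x * ξ (a * b⁻¹ * k))
      map_add' := fun ξ η => by ext k; simp [mul_add]
      map_smul' := fun c ξ => by ext k; simp [smul_comm c] }
  map_add' x y := by ext ξ k; simp [add_mul]
  map_smul' c x := by ext ξ k; simp [smul_comm c]

theorem twistedShift_apply (a b : Γ) (x : B) (ξ : Γ → B) (k : Γ) :
    twistedShift β a b x ξ k = (β k a⁻¹ : ℂ) • (x * ξ (a * b⁻¹ * k)) := rfl

/-- Composing evaluates the second scalar at ab⁻¹k, and this produces the extra factor β(ab⁻¹, c⁻¹)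
= β(a⁻¹b, c). It is inverse to the scalar of the transmuted product. -/
theorem twistedShift_mul (a b c d : Γ) (x y : B) :
    twistedShift β a b x * twistedShift β c d y =
      (β (a⁻¹ * b) c : ℂ) • twistedShift β (a * c) (b * d) (x * y) := by
  refine LinearMap.ext fun ξ => funext fun k => ?_
  have hk : c * d⁻¹ * (a * b⁻¹ * k) = a * c * (b * d)⁻¹ * k := by
    simp only [mul_inv, mul_assoc, mul_comm, mul_left_comm]
  have hβ : (β k a⁻¹ * β (a * b⁻¹ * k) c⁻¹ : ℂ) = β (a⁻¹ * b) c * β k (a * c)⁻¹ := by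
    simp only [map_mul, map_inv, MonoidHom.mul_apply, MonoidHom.inv_apply, Circle.coe_mul,
      Circle.coe_inv]
    field_simp
  simp only [Module.End.mul_apply, LinearMap.smul_apply, Pi.smul_apply, twistedShift_apply,
    mul_smul_comm, smul_smul, hk, hβ, mul_assoc x]

theorem twistedShift_one : twistedShift β 1 1 (1 : B) = 1 := by
  refine LinearMap.ext fun ξ => funext fun k => ?_
  simp [twistedShift_apply]

/-- The evaluation of an operator at the constant function `1` and the unit of the group. -/
def evalOne (Γ B : Type*) [CommGroup Γ] [Ring B] [Algebra ℂ B] :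
    Module.End ℂ (Γ → B) →ₗ[ℂ] B where
  toFun T := T (fun _ => 1) 1
  map_add' _ _ := rfl
  map_smul' _ _ := rfl

/-- At the unit of the group the scalar is β(1, a⁻¹) = 1, so evaluation recovers the coefficient
from any twisted shift, whatever its degrees. -/
theorem evalOne_twistedShift (a b : Γ) (x : B) : evalOne Γ B (twistedShift β a b x) = x := by
  change twistedShift β a b x (fun _ => 1) 1 = x
  simp [twistedShift_apply]

end TwistedShift

/-! ### Sums of components -/

section Components

variable {m : ℕ} {Γ : Type*} {A C : Type*} [Ring A] [Algebra ℂ A] [Ring C] [Algebra ℂ C]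

/-- Orthogonality of the p_a selects the single summand (a,b). If a or b lies outside `s`, both
sides are zero. -/
theorem sandwich_sum_sandwich_map [DecidableEq Γ] {s : Finset Γ}
    {p : Γ → Matrix (Fin m) (Fin m) ℂ} (hp : ∀ a b, p a * p b = if a = b then p a else 0)
    (hs : ∀ a, a ∉ s → p a = 0) (M : Matrix (Fin m) (Fin m) A) (T : Γ → Γ → A →ₗ[ℂ] C) (a b : Γ) :
    sandwich (p a) (p b) (∑ c ∈ s, ∑ d ∈ s, (sandwich (p c) (p d) M).map (T c d)) =
      (sandwich (p a) (p b) M).map (T a b) := by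
  have h0 : ∀ Q, sandwich 0 Q M = 0 := fun Q => by
    rw [sandwich_eq, scalarMat_zero, zero_mul, zero_mul]
  have h0' : ∀ P, sandwich P 0 M = 0 := fun P => by
    rw [sandwich_eq, scalarMat_zero, mul_zero]
  have hz : ∀ f : A →ₗ[ℂ] C, (0 : Matrix (Fin m) (Fin m) A).map f = 0 := fun f =>
    Matrix.map_zero _ (map_zero _)
  simp only [← sum_sandwich_right, sandwich_map, sandwich_sandwich, hp]
  by_cases ha : a ∈ s
  · by_cases hb : b ∈ s
    · rw [Finset.sum_eq_single_of_mem a ha, Finset.sum_eq_single_of_mem b hb]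
      · simp
      · intro d _ hd
        rw [if_neg hd, h0', hz]
      · intro c _ hc
        simp only [if_neg hc.symm, h0, hz, Finset.sum_const_zero]
    · simp only [hs b hb, h0', hz]
      refine Finset.sum_eq_zero fun c _ => Finset.sum_eq_zero fun d hd => ?_
      rw [if_neg (show ¬d = b from fun h => hb (h ▸ hd)), h0', hz]
  · simp only [hs a ha, ite_self, h0, hz, Finset.sum_const_zero]

theorem map_mul_map {C : Type*} [Ring C] [Algebra ℂ C] {f g h : A →ₗ[ℂ] C}
    (hfg : ∀ x y, f x * g y = h (x * y)) (M N : Matrix (Fin m) (Fin m) A) :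
    M.map f * N.map g = (M * N).map h := by
  ext i j
  simp [Matrix.mul_apply, hfg]

/-- The entrywise star does not transpose, so the scalar matrices stay on their sides and are only
conjugated. -/
theorem conjMat_sandwich [StarRing A] [StarModule ℂ A] (P Q : Matrix (Fin m) (Fin m) ℂ)
    (M : Matrix (Fin m) (Fin m) A) :
    conjMat (sandwich P Q M) = sandwich (P.map star) (Q.map star) (conjMat M) := by
  ext i j
  simp [conjMat, sandwich_apply]

variable {Z : Matrix (Fin m) (Fin m) (MonoidAlgebra ℂ Γ)}

theorem spectralProj_eq_zero {a : Γ} (ha : a ∉ spectrumSet Z) : spectralProj Z a = 0 := by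
  ext i j
  by_contra h
  refine ha ?_
  simp only [spectrumSet, Finset.mem_biUnion, Finset.mem_univ, true_and, Finsupp.mem_support_iff]
  exact ⟨i, j, h⟩

theorem spectralProj_ne_zero {a : Γ} (ha : a ∈ spectrumSet Z) : spectralProj Z a ≠ 0 := by
  simp only [spectrumSet, Finset.mem_biUnion, Finset.mem_univ, true_and,
    Finsupp.mem_support_iff] at ha
  obtain ⟨i, j, h⟩ := ha
  exact fun h' => h (congrFun (congrFun h' i) j)

theorem spectralProj_map_star_mul [DecidableEq Γ] (hZ : IsCorepMat Z) (a b : Γ) :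
    (spectralProj Z a).map star * (spectralProj Z b).map star =
      if a = b then (spectralProj Z a).map star else 0 := by
  have h := congrArg (fun M : Matrix (Fin m) (Fin m) ℂ => M.map (starRingEnd ℂ))
    (spectralProj_mul hZ a b)
  simp only [Matrix.map_mul] at h
  refine h.trans ?_
  split_ifs
  · rfl
  · exact Matrix.map_zero _ (map_zero _)

/-- From p_a F = F p̄_{a⁻¹} with F invertible, p_{a⁻¹} = 0 would force p_a = 0. This symmetry
permits reindexing by inversion. -/
theorem inv_mem_spectrumSet [CommGroup Γ] {F : GL (Fin m) ℂ}
    (hF : conjugateBy F (conjMat Z) = Z) {a : Γ} (ha : a ∈ spectrumSet Z) :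
    a⁻¹ ∈ spectrumSet Z := by
  by_contra h
  refine spectralProj_ne_zero ha ?_
  have h1 := spectralProj_mul_coe hF a
  rw [spectralProj_eq_zero h, Matrix.map_zero _ (star_zero _), mul_zero] at h1
  have h2 := congrArg (· * ((F⁻¹ : GL (Fin m) ℂ) : Matrix (Fin m) (Fin m) ℂ)) h1
  simpa only [mul_assoc, ← Units.val_mul, mul_inv_cancel, Units.val_one, mul_one, zero_mul] using h2

theorem coe_inv_mul_spectralProj [CommGroup Γ] {F : GL (Fin m) ℂ}
    (hF : conjugateBy F (conjMat Z) = Z) (a : Γ) :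
    ((F⁻¹ : GL (Fin m) ℂ) : Matrix (Fin m) (Fin m) ℂ) * spectralProj Z a =
      (spectralProj Z a⁻¹).map star * ((F⁻¹ : GL (Fin m) ℂ) : Matrix (Fin m) (Fin m) ℂ) := by
  have h := congrArg (fun M => ((F⁻¹ : GL (Fin m) ℂ) : Matrix (Fin m) (Fin m) ℂ) * M *
    ((F⁻¹ : GL (Fin m) ℂ) : Matrix (Fin m) (Fin m) ℂ)) (spectralProj_mul_coe hF a)
  simp only [mul_assoc, ← Units.val_mul, mul_inv_cancel, Units.val_one, mul_one] at h
  rwa [← mul_assoc _ (F : Matrix (Fin m) (Fin m) ℂ), ← Units.val_mul, inv_mul_cancel,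
    Units.val_one, one_mul] at h

end Components

/-! ### The universal property of the transmutation -/

section Untwist

variable {m : ℕ} {Γ : Type*} [CommGroup Γ] {F : GL (Fin m) ℂ} (β : Γ →* Γ →* Circle)
  (Z : Matrix (Fin m) (Fin m) (MonoidAlgebra ℂ Γ))
  {B : Type*} [Ring B] [Algebra ℂ B]

/-- The operators `x ↦ β(a⁻¹b, a) x λ_{a⁻¹,b⁻¹}`. -/
def twistedShiftConj (a b : Γ) : B →ₗ[ℂ] Module.End ℂ (Γ → B) :=
  (β (a⁻¹ * b) a : ℂ) • twistedShift β a⁻¹ b⁻¹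

theorem twistedShiftConj_apply (a b : Γ) (x : B) :
    twistedShiftConj β a b x = (β (a⁻¹ * b) a : ℂ) • twistedShift β a⁻¹ b⁻¹ x := rfl

/-- The matrix `∑ p_a V p_b λ_{a,b}` over the operators on functions `Γ → B`. -/
def untwist (V : Matrix (Fin m) (Fin m) B) : Matrix (Fin m) (Fin m) (Module.End ℂ (Γ → B)) :=
  ∑ a ∈ spectrumSet Z, ∑ b ∈ spectrumSet Z, (isotypic Z V a b).map (twistedShift β a b)

variable {Z} in
theorem isotypic_untwist (hZ : IsCorepMat Z) (V : Matrix (Fin m) (Fin m) B) (a b : Γ) :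
    isotypic Z (untwist β Z V) a b = (isotypic Z V a b).map (twistedShift β a b) := by
  classical
  exact sandwich_sum_sandwich_map (spectralProj_mul hZ) (fun _ => spectralProj_eq_zero) V
    (twistedShift β) a b

variable [StarRing B]

/-- The matrix `∑ β(a⁻¹b, a) \overline{p_a V p_b} λ_{a⁻¹,b⁻¹}` over the operators on functions
`Γ → B`. -/
def untwistConj (V : Matrix (Fin m) (Fin m) B) : Matrix (Fin m) (Fin m) (Module.End ℂ (Γ → B)) :=
  ∑ a ∈ spectrumSet Z, ∑ b ∈ spectrumSet Z,
    (conjMat (isotypic Z V a b)).map (twistedShiftConj β a b)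

variable [StarModule ℂ B] {Z}

theorem sandwich_untwistConj (hZ : IsCorepMat Z) (V : Matrix (Fin m) (Fin m) B) (a b : Γ) :
    sandwich ((spectralProj Z a).map star) ((spectralProj Z b).map star) (untwistConj β Z V) =
      (conjMat (isotypic Z V a b)).map (twistedShiftConj β a b) := by
  classical
  simp only [untwistConj, isotypic, conjMat_sandwich]
  refine sandwich_sum_sandwich_map (spectralProj_map_star_mul hZ) (fun a ha => ?_) (conjMat V)
    (twistedShiftConj β) a b
  rw [spectralProj_eq_zero ha, Matrix.map_zero _ (star_zero _)]

variable {β}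

/-- Take the (a⁻¹, b⁻¹) component of V = F V̄_Z F⁻¹. Moving the projections through F and F⁻¹ turns
them into p̄_a and p̄_b, which cut out one term of V̄_Z together with its coefficient. -/
theorem isotypic_inv (hZ : IsCorepMat Z) (hu : IsUnitaryMat Z)
    (hF : conjugateBy F (conjMat Z) = Z) {V : Matrix (Fin m) (Fin m) B}
    (hV : V = conjugateBy F (braidedConj β Z V)) (a b : Γ) :
    isotypic Z V a⁻¹ b⁻¹ =
      (β (a⁻¹ * b) a : ℂ) • conjugateBy F (conjMat (isotypic Z V a b)) := by
  classical
  have h1 : braidedConj β Z V = ∑ a ∈ spectrumSet Z, ∑ b ∈ spectrumSet Z,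
      (sandwich ((spectralProj Z a).map star) ((spectralProj Z b).map star) (conjMat V)).map
        ((β (a⁻¹ * b) a : ℂ) • (LinearMap.id : B →ₗ[ℂ] B)) := by
    refine Matrix.ext fun i j => ?_
    simp only [← conjMat_sandwich, braidedConj_eq hZ hu, Matrix.sum_apply]
    rfl
  have h2 := sandwich_sum_sandwich_map (spectralProj_map_star_mul hZ)
    (s := spectrumSet Z) (fun a ha => by
      rw [spectralProj_eq_zero ha, Matrix.map_zero _ (star_zero _)]) (conjMat V)
    (fun a b => (β (a⁻¹ * b) a : ℂ) • (LinearMap.id : B →ₗ[ℂ] B)) a b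
  rw [← h1, ← conjMat_sandwich] at h2
  conv_lhs => rw [hV]
  rw [isotypic, conjugateBy_eq_sandwich, sandwich_sandwich, spectralProj_mul_coe hF,
    coe_inv_mul_spectralProj hF, inv_inv, inv_inv, ← sandwich_sandwich, h2, sandwich_map,
    ← conjugateBy_eq_sandwich]
  rfl

/-- The condition F F̄ = ±1 says F̄ = ±F⁻¹, and the sign cancels in a conjugation. -/
theorem conjGL_eq (hFF : F * conjGL F = 1 ∨ F * conjGL F = -1) {C : Type*} [Ring C] [Algebra ℂ C]
    (M : Matrix (Fin m) (Fin m) C) : conjugateBy (conjGL F) M = conjugateBy F⁻¹ M := by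
  rcases hFF with h | h
  · rw [eq_inv_of_mul_eq_one_right h]
  · have h' : conjGL F = -F⁻¹ := by
      rw [← neg_eq_iff_eq_neg]
      refine eq_inv_of_mul_eq_one_right ?_
      rw [mul_neg, h, neg_neg]
    refine Matrix.ext fun i j => ?_
    have hi : (-F⁻¹)⁻¹ = -F := by
      rw [inv_eq_iff_mul_eq_one, neg_mul_neg, inv_mul_cancel]
    rw [h', FreeOrth.conjugateBy_eq, FreeOrth.conjugateBy_eq, hi, inv_inv]
    simp

/-- A unitary solution of the braided relations untwists to a solution of the relations of
`ℂ[O_F⁺]`. -/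
theorem isPair_untwist (hZ : IsCorepMat Z) (hu : IsUnitaryMat Z)
    (hF : conjugateBy F (conjMat Z) = Z) (hFF : F * conjGL F = 1 ∨ F * conjGL F = -1)
    {V : Matrix (Fin m) (Fin m) B} (hV : IsBraidedOrthogonal F β Z V) :
    FreeOrth.IsPair F (untwist β Z V) (untwistConj β Z V) := by
  classical
  have hone : (1 : Matrix (Fin m) (Fin m) B).map (twistedShift β 1 1) = 1 :=
    Matrix.map_one _ (map_zero _) (twistedShift_one β)
  -- The transpose consists of the components of V*, with the two degrees exchanged.
  have ht : (untwistConj β Z V).transpose = ∑ a ∈ spectrumSet Z, ∑ b ∈ spectrumSet Z,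
      (sandwich (spectralProj Z a) (spectralProj Z b) V.conjTranspose).map
        (twistedShiftConj β b a) := by
    rw [untwistConj, Finset.sum_comm, Matrix.transpose_sum]
    refine Finset.sum_congr rfl fun a _ => ?_
    rw [Matrix.transpose_sum]
    refine Finset.sum_congr rfl fun b _ => ?_
    rw [show sandwich (spectralProj Z a) (spectralProj Z b) V.conjTranspose =
      (isotypic Z V b a).conjTranspose from (isotypic_conjTranspose hZ hu V b a).symm]
    rfl
  have horth : untwist β Z V = conjugateBy F (untwistConj β Z V) := by
    rw [conjugateBy_eq_sandwich, untwistConj, ← sum_sandwich_right]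
    simp only [← sum_sandwich_right, sandwich_map]
    rw [untwist]
    -- The terms of `untwistConj` carry λ_{a⁻¹,b⁻¹}, so the two sums match after inverting both
    -- indices, by `isotypic_inv`.
    refine Finset.sum_nbij' (·⁻¹) (·⁻¹) (fun a ha => inv_mem_spectrumSet hF ha)
      (fun a ha => inv_mem_spectrumSet hF ha) (fun a _ => inv_inv a) (fun a _ => inv_inv a)
      fun a _ => ?_
    refine Finset.sum_nbij' (·⁻¹) (·⁻¹) (fun a ha => inv_mem_spectrumSet hF ha)
      (fun a ha => inv_mem_spectrumSet hF ha) (fun a _ => inv_inv a) (fun a _ => inv_inv a)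
      fun b _ => ?_
    have h := isotypic_inv hZ hu hF hV.2 a⁻¹ b⁻¹
    rw [inv_inv, inv_inv] at h
    rw [h, conjugateBy_eq_sandwich]
    refine Matrix.ext fun i j => ?_
    rw [Matrix.map_apply, Matrix.map_apply, twistedShiftConj_apply, Matrix.smul_apply, map_smul,
      inv_inv, inv_inv]
  refine ⟨?_, ?_, horth, ?_⟩
  · rw [ht, untwist, sum_sum_mul_sum_sum, ← hone,
      ← sum_sandwich_mul_map (spectralProj_mul hZ) (sum_spectralProj hZ) hV.1.1
      (fun a b c d => ((β (b⁻¹ * a) b : ℂ) * (β (b * a⁻¹) c : ℂ)) •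
        twistedShift β (b⁻¹ * c) (a⁻¹ * d)) (T₀ := fun a d => twistedShift β 1 (a⁻¹ * d)) ?_
      fun a => by rw [inv_mul_cancel]]
    · refine Finset.sum_congr rfl fun a _ => Finset.sum_congr rfl fun b _ =>
        Finset.sum_congr rfl fun c _ => Finset.sum_congr rfl fun d _ => ?_
      refine map_mul_map (fun x y => ?_) _ _
      rw [twistedShiftConj_apply, smul_mul_assoc, twistedShift_mul, smul_smul, inv_inv]
      rfl
    · intro a b d
      have h : (β (b⁻¹ * a) b : ℂ) * (β (b * a⁻¹) b : ℂ) = 1 := by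
        rw [← Circle.coe_mul, ← MonoidHom.mul_apply, ← map_mul, mul_mul_mul_comm, inv_mul_cancel,
          mul_inv_cancel, mul_one, map_one, MonoidHom.one_apply, Circle.coe_one]
      rw [h, one_smul, inv_mul_cancel]
  · rw [ht, untwist, sum_sum_mul_sum_sum, ← hone,
      ← sum_sandwich_mul_map (spectralProj_mul hZ) (sum_spectralProj hZ) hV.1.2
      (fun a b c d => ((β (d⁻¹ * c) d : ℂ) * (β (a⁻¹ * b) d⁻¹ : ℂ)) •
        twistedShift β (a * d⁻¹) (b * c⁻¹))
      (T₀ := fun a d => (β (d⁻¹ * a) d : ℂ) • twistedShift β (a * d⁻¹) 1) ?_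
      fun a => by simp]
    · refine Finset.sum_congr rfl fun a _ => Finset.sum_congr rfl fun b _ =>
        Finset.sum_congr rfl fun c _ => Finset.sum_congr rfl fun d _ => ?_
      refine map_mul_map (fun x y => ?_) _ _
      rw [twistedShiftConj_apply, mul_smul_comm, twistedShift_mul, smul_smul]
      rfl
    · intro a b d
      rw [mul_inv_cancel]
      congr 1
      simp only [map_mul, map_inv, MonoidHom.mul_apply, MonoidHom.inv_apply, Circle.coe_mul,
        Circle.coe_inv]
      field_simp
  -- No involution has been put on the operators, so the conjugate relation cannot be had by taking
  -- stars of `horth`; it comes from F̄ = ±F⁻¹.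
  · rw [conjGL_eq hFF, horth, FreeOrth.conjugateBy_inv]

end Untwist

/-! ### The homomorphism out of the transmutation -/

namespace FreeOrth

variable {m : ℕ} {F : GL (Fin m) ℂ} {Γ : Type*} [CommGroup Γ]
  {Z : Matrix (Fin m) (Fin m) (MonoidAlgebra ℂ Γ)} {β : Γ →* Γ →* Circle}
  {B : Type*} [Ring B] [StarRing B] [Algebra ℂ B]
  {V : Matrix (Fin m) (Fin m) B}

section transLift

variable (h : IsPair F (untwist β Z V) (untwistConj β Z V))

/-- The linear map `ℂ[O_F⁺] → B` obtained from the untwisted matrix. -/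
def untwistLift : FreeOrth F →ₗ[ℂ] B :=
  evalOne Γ B ∘ₗ (lift (untwist β Z V) (untwistConj β Z V) h).toLinearMap

theorem lift_isotypic_fund (hZ : IsCorepMat Z) (a b : Γ) (i j : Fin m) :
    lift _ _ h (isotypic Z (fund F) a b i j) = twistedShift β a b (isotypic Z V a b i j) := by
  have h1 := isotypic_map (Z := Z) (fund F) (lift _ _ h).toLinearMap a b
  have h2 : (fund F).map (lift _ _ h).toLinearMap = untwist β Z V := by
    refine Matrix.ext fun i j => ?_
    exact lift_fund h i j
  rw [h2, isotypic_untwist β hZ] at h1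
  exact (congrFun (congrFun h1 i) j).symm

variable (hZ : IsCorepMat Z) (hu : IsUnitaryMat Z) (hF : conjugateBy F (conjMat Z) = Z)

/-- On H_{a,b} the lift should be λ_{a,b} with coefficient `untwistLift`. This holds for 1 and for
the components of U. It survives products because twisted shifts multiply to a scalar multiple of a
twisted shift, whose coefficient `evalOne` recovers. -/
theorem iSup_untwistLift : ⨆ p : Γ × Γ, (toTorus Z hZ hu hF).homog p.1 p.2 ⊓
    LinearMap.eqLocus (lift _ _ h).toLinearMap (twistedShift β p.1 p.2 ∘ₗ untwistLift h) = ⊤ := by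
  refine iSup_eq_top_of_isotypic_mem hZ (N := fun a b => (toTorus Z hZ hu hF).homog a b ⊓
    LinearMap.eqLocus (lift _ _ h).toLinearMap (twistedShift β a b ∘ₗ untwistLift h))
    ⟨TorusMap.one_mem, ?_⟩ ?_ ?_
  · change lift _ _ h 1 = twistedShift β 1 1 (evalOne Γ B (lift _ _ h 1))
    rw [map_one, ← twistedShift_one β, evalOne_twistedShift]
  · intro a b c d x hx y hy
    refine ⟨TorusMap.mul_mem hx.1 hy.1, ?_⟩
    have hx' : lift _ _ h x = twistedShift β a b (untwistLift h x) := hx.2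
    have hy' : lift _ _ h y = twistedShift β c d (untwistLift h y) := hy.2
    change lift _ _ h (x * y) = twistedShift β (a * c) (b * d) (evalOne Γ B (lift _ _ h (x * y)))
    rw [map_mul, hx', hy', twistedShift_mul, map_smul, evalOne_twistedShift, map_smul]
  · intro a b i j
    refine ⟨isotypic_fund_mem_homog hZ hu hF a b i j, ?_⟩
    change lift _ _ h _ = twistedShift β a b (evalOne Γ B (lift _ _ h _))
    rw [lift_isotypic_fund h hZ, evalOne_twistedShift]

/-- For degrees (a,b) and (c,d) the shifts contribute β(a⁻¹b, c) and the transmuted product β(a⁻¹b,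
c⁻¹), so the twists cancel. -/
theorem untwistLift_mul (x y : Transmutation (toTorus Z hZ hu hF) β) :
    untwistLift h ((Transmutation.of (toTorus Z hZ hu hF) β).symm (x * y)) =
      untwistLift h ((Transmutation.of (toTorus Z hZ hu hF) β).symm x) *
        untwistLift h ((Transmutation.of (toTorus Z hZ hu hF) β).symm y) := by
  have hN := iSup_untwistLift h hZ hu hF
  obtain ⟨x, rfl⟩ := (Transmutation.of (toTorus Z hZ hu hF) β).surjective x
  obtain ⟨y, rfl⟩ := (Transmutation.of (toTorus Z hZ hu hF) β).surjective y
  refine Submodule.iSup_induction _ (motive := fun x => untwistLift h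
      ((Transmutation.of (toTorus Z hZ hu hF) β).symm
      (Transmutation.of (toTorus Z hZ hu hF) β x * Transmutation.of (toTorus Z hZ hu hF) β y)) =
      untwistLift h ((Transmutation.of (toTorus Z hZ hu hF) β).symm
        (Transmutation.of (toTorus Z hZ hu hF) β x)) * _)
    (hN ▸ Submodule.mem_top : x ∈ _) (fun p x hx => ?_) (by simp)
    (fun x x' hx hx' => by simp only [map_add, add_mul, hx, hx'])
  refine Submodule.iSup_induction _ (motive := fun y => untwistLift h
      ((Transmutation.of (toTorus Z hZ hu hF) β).symm
      (Transmutation.of (toTorus Z hZ hu hF) β x * Transmutation.of (toTorus Z hZ hu hF) β y)) =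
      _ * untwistLift h ((Transmutation.of (toTorus Z hZ hu hF) β).symm
        (Transmutation.of (toTorus Z hZ hu hF) β y)))
    (hN ▸ Submodule.mem_top : y ∈ _) (fun q y hy => ?_) (by simp)
    (fun x x' hx hx' => by simp only [map_add, mul_add, hx, hx'])
  have hx' : lift _ _ h x = twistedShift β p.1 p.2 (untwistLift h x) := hx.2
  have hy' : lift _ _ h y = twistedShift β q.1 q.2 (untwistLift h y) := hy.2
  have hxy : untwistLift h (x * y) = (β (p.1⁻¹ * p.2) q.1 : ℂ) •
      (untwistLift h x * untwistLift h y) := by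
    change evalOne Γ B (lift _ _ h (x * y)) = _
    rw [map_mul, hx', hy', twistedShift_mul, map_smul, evalOne_twistedShift]
  simp only [LinearEquiv.symm_apply_apply]
  rw [Transmutation.of_mul hx.1 hy.1, map_smul, LinearEquiv.symm_apply_apply, map_smul, hxy,
    smul_smul, ← Circle.coe_mul, ← map_mul, inv_mul_cancel, map_one, Circle.coe_one, one_smul]

/-- The homomorphism from the transmutation to `B`. -/
def transLift : Transmutation (toTorus Z hZ hu hF) β →ₐ[ℂ] B :=
  AlgHom.ofLinearMap
    (untwistLift h ∘ₗ (Transmutation.of (toTorus Z hZ hu hF) β).symm.toLinearMap)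
    (by
      change evalOne Γ B (lift _ _ h 1) = 1
      rw [map_one, ← twistedShift_one β, evalOne_twistedShift])
    (untwistLift_mul h hZ hu hF)

theorem transLift_fund (i j : Fin m) :
    transLift h hZ hu hF (transFund hZ hu hF β i j) = V i j := by
  change untwistLift h (fund F i j) = V i j
  rw [← sum_isotypic_apply hZ (fund F) i j, ← sum_isotypic_apply hZ V i j, map_sum]
  refine Finset.sum_congr rfl fun a _ => ?_
  rw [map_sum]
  refine Finset.sum_congr rfl fun b _ => ?_
  change evalOne Γ B (lift _ _ h _) = _
  rw [lift_isotypic_fund h hZ, evalOne_twistedShift]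

variable [StarModule ℂ B]

theorem lift_star_isotypic_fund (hZ : IsCorepMat Z) (a b : Γ) (i j : Fin m) :
    lift _ _ h (star (isotypic Z (fund F) a b i j)) =
      (β (a⁻¹ * b) a : ℂ) • twistedShift β a⁻¹ b⁻¹ (star (isotypic Z V a b i j)) := by
  have h0 : conjMat (isotypic Z (fund F) a b) = sandwich ((spectralProj Z a).map star)
    ((spectralProj Z b).map star) (conjMat (fund F)) := conjMat_sandwich _ _ _
  have h1 := sandwich_map ((spectralProj Z a).map star) ((spectralProj Z b).map star)
    (conjMat (fund F)) (lift _ _ h).toLinearMap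
  have h2 : (conjMat (fund F)).map (lift _ _ h).toLinearMap = untwistConj β Z V := by
    refine Matrix.ext fun i j => ?_
    exact lift_star_fund h i j
  rw [h2, sandwich_untwistConj β hZ, ← h0] at h1
  exact (congrFun (congrFun h1 i) j).symm

/-- On each component the scalar β(a⁻¹b, a⁻¹) of *_β cancels the scalar β(a⁻¹b, a) built into
`twistedShiftConj`. -/
theorem transLift_star_fund (i j : Fin m) :
    transLift h hZ hu hF (star (transFund hZ hu hF β i j)) = star (V i j) := by
  have h1 : ∀ a b : Γ, transLift h hZ hu hF
      (star (Transmutation.of (toTorus Z hZ hu hF) β (isotypic Z (fund F) a b i j))) =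
      star (isotypic Z V a b i j) := by
    intro a b
    rw [Transmutation.star_of (isotypic_fund_mem_homog hZ hu hF a b i j), map_smul]
    change _ • evalOne Γ B (lift _ _ h (star (isotypic Z (fund F) a b i j))) = _
    rw [lift_star_isotypic_fund h hZ, map_smul, evalOne_twistedShift, smul_smul, ← Circle.coe_mul,
      ← map_mul, inv_mul_cancel, map_one, Circle.coe_one, one_smul]
  have h2 : transFund hZ hu hF β i j = Transmutation.of (toTorus Z hZ hu hF) β (fund F i j) := rfl
  rw [h2, ← sum_isotypic_apply hZ (fund F) i j, ← sum_isotypic_apply hZ V i j]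
  simp only [map_sum, star_sum, h1]

/-- The map is already an algebra homomorphism, so compatibility with the involution need only be
checked on generators of the *-algebra. -/
theorem transLift_star (x : Transmutation (toTorus Z hZ hu hF) β) :
    transLift h hZ hu hF (star x) = star (transLift h hZ hu hF x) := by
  have hx : x ∈ StarAlgebra.adjoin ℂ {u | ∃ i j, u = transFund hZ hu hF β i j} := by
    rw [adjoin_transFund]; trivial
  induction hx using StarAlgebra.adjoin_induction with
  | mem x hx =>
    obtain ⟨i, j, rfl⟩ := hx
    rw [transLift_star_fund, transLift_fund]
  | algebraMap c =>
    rw [← algebraMap_star_comm, AlgHom.commutes, AlgHom.commutes, algebraMap_star_comm]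
  | add x y _ _ hx hy => rw [star_add, map_add, map_add, star_add, hx, hy]
  | mul x y _ _ hx hy => rw [star_mul, map_mul, map_mul, star_mul, hx, hy]
  | star x _ hx => rw [star_star, hx, star_star]

end transLift

theorem starAlgHom_ext_transFund {B : Type*} [Ring B] [StarRing B] [Algebra ℂ B] (hZ : IsCorepMat Z) (hu : IsUnitaryMat Z)
    (hF : conjugateBy F (conjMat Z) = Z) {f g : Transmutation (toTorus Z hZ hu hF) β →⋆ₐ[ℂ] B}
    (hfg : ∀ i j, f (transFund hZ hu hF β i j) = g (transFund hZ hu hF β i j)) : f = g := by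
  refine StarAlgHom.ext_of_adjoin_eq_top (adjoin_transFund hZ hu hF β) ?_
  rintro _ ⟨i, j, rfl⟩
  exact hfg i j

end FreeOrth

end

theorem mainTheorem6 {T : Type*} [CommGroup T] [TopologicalSpace T] [IsTopologicalGroup T]
    [CompactSpace T] [T2Space T] {m : ℕ} (hm : 2 ≤ m) (F : GL (Fin m) ℂ)
    (hF : F * conjGL F = 1 ∨ F * conjGL F = -1)
    (Z : Matrix (Fin m) (Fin m) (MonoidAlgebra ℂ (PontryaginDual T)))
    (hZ : IsCorepMat Z) (hZu : IsUnitaryMat Z) (hFZ : conjugateBy F (conjMat Z) = Z)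
    (β : PontryaginDual T →* PontryaginDual T →* Circle) :
    IsBraidedCMQG β (Transmutation.coaction (FreeOrth.toTorus Z hZ hZu hFZ) β)
        (Transmutation.antipode (FreeOrth.toTorus Z hZ hZu hFZ) β) Z
        ((FreeOrth.fund F).map (Transmutation.of (FreeOrth.toTorus Z hZ hZu hFZ) β)) ∧
      IsBraidedOrthogonal F β Z
        ((FreeOrth.fund F).map (Transmutation.of (FreeOrth.toTorus Z hZ hZu hFZ) β)) ∧
      ∀ (B : Type*) [Ring B] [StarRing B] [Algebra ℂ B] [StarModule ℂ B]
        (V : Matrix (Fin m) (Fin m) B), IsBraidedOrthogonal F β Z V →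
        ∃! f : Transmutation (FreeOrth.toTorus Z hZ hZu hFZ) β →⋆ₐ[ℂ] B,
          ∀ i j, f (Transmutation.of (FreeOrth.toTorus Z hZ hZu hFZ) β (FreeOrth.fund F i j)) =
            V i j := by
  refine ⟨FreeOrth.isBraidedCMQG hZ hZu hFZ β,
    FreeOrth.transFund_isBraidedOrthogonal hZ hZu hFZ β, fun B _ _ _ _ V hV => ?_⟩
  have h := isPair_untwist hZ hZu hFZ hF hV
  refine ⟨{ FreeOrth.transLift h hZ hZu hFZ with
    map_star' := FreeOrth.transLift_star h hZ hZu hFZ },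
    FreeOrth.transLift_fund h hZ hZu hFZ, fun g hg => ?_⟩
  refine FreeOrth.starAlgHom_ext_transFund hZ hZu hFZ fun i j => ?_
  exact (hg i j).trans (FreeOrth.transLift_fund h hZ hZu hFZ i j).symm
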